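/- **Setting.** Let $A$ be an abelian group (written multiplicatively) and $R$ a commutative ring. *Pairs.* For a finite group $G$ let $\mathcal M(G)$ be the set of pairs $(U,\varphi)$ with $U\le G$ and $\varphi\in\operatorname{Hom}(U,A)$, ordered by $(L,\psi)\le(K,\lambda)$ iff $L\le K$ and $\lambda|_L=\psi$; $G$ acts on it by conjugation. *Fibered sets.* An $A$-fibered $G$-set is a left $(G\times A)$-set $X$ on which $A$ acts freely with finitely many orbits. For $x\in X$ let $G_x$ be the stabilizer in $G$ of the orbit $Ax$ and $\varphi_x:G_x\to A$ the homomorphism with $gx=\varphi_x(g)x$; let $[X/A]$ be a set of representatives of the $A$-orbits. For $(U,\varphi)\in\mathcal M(G)$ put $\frac{G\times A}{(U,\varphi)}:=(G\times A)/\{(u,\varphi(u)^{-1}):u\in U\}$ (written $\frac{G\times H}{(U,\varphi)}$, with $A$ suppressed, if the group is $G\times H$). Let $B^A_R(G)$ be $R\otimes_{\mathbb Z}$ the Grothendieck group of isomorphism classes of $A$-fibered $G$-sets under disjoint union. Put $B^A_R(G,H):=B^A_R(G\times H)$. For an $A$-fibered $(G,H)$-biset $X$ and an $A$-fibered $(H,K)$-biset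 $Y$, $X\otimes_{AH}Y$ is the set of those $(H\times A)$-orbits on $X\times Y$ that are $A$-free; this extends $R$-bilinearly. *Products.* For $D\le G\times H$ write $p_1(D),p_2(D)$ for its projections, $k_1(D)=\{g:(g,1)\in D\}$, $k_2(D)=\{h:(1,h)\in D\}$. Write $D*E=\{(g,k):\exists h,\ (g,h)\in D,\ (h,k)\in E\}$ for $E\le H\times K$, $D*K=\{g:\exists k\in K,\ (g,k)\in D\}$ for $K\le H$, and $K*D=\{h:\exists k\in K,\ (k,h)\in D\}$ for $K\le G$. If $\varphi(1,h)^{-1}=\psi(h,1)$ for all $h\in k_2(D)\cap k_1(E)$, put $(D,\varphi)*(E,\psi)=(D*E,\varphi*\psi)$ with $(\varphi*\psi)(g,k)=\varphi(g,h)\psi(h,k)$. Let $\Delta(K)=\{(k,k):k\in K\}$. *The data.* Let $\mathcal G$ be a class of finite groups and $\mathcal S=(\mathcal S(G,H))_{G,H\in\mathcal G}$ a family of sets $\mathcal S(G,H)\subseteq\mathcal M(G\times H)$ such that for all $G,H,K\in\mathcal G$: 1. $(\Delta(G),1)\in\mathcal S(G,G)$; 2. $\mathcal S(G,H)$ is closed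 under $(G\times H)$-conjugation; 3. if $(D,\varphi)\in\mathcal S(G,H)$, $(E,\psi)\in\mathcal S(H,K)$ and $(D,\varphi)*(E,\psi)$ is defined, it lies in $\mathcal S(G,K)$; 4. if $(D,\varphi)\in\mathcal S(G,H)$ and $L\le H$ with $L\in\mathcal G$, then $D*L\in\mathcal G$ and $(D,\varphi)*(\Delta(L),1)\in\mathcal S(D*L,L)$; 5. if $L\le G$ and $L\in\mathcal G$, then $(\Delta(L),1)\in\mathcal S(L,G)$ (a subgroup of a subgroup of $G$ is identified with a subgroup of $G$); 6. if $(D,\varphi)\in\mathcal S(G,H)$, then $p_2(D)\in\mathcal G$, and for $L\le p_2(D)$ with $L\in\mathcal G$ one has $D*L\in\mathcal G$ and $(D,\varphi)*(\Delta(L),1)\in\mathcal S(D*L,L)$; 7. if $(D,\varphi)\in\mathcal S(G,H)$, then $p_1(D)\in\mathcal G$, and for $L\le p_1(D)$ with $L\in\mathcal G$ one has $L*D\in\mathcal G$ and $(\Delta(L),1)*(D,\varphi)\in\mathcal S(L,L*D)$. Let $\mathcal D$ be the $R$-linear category with objects the groups in $\mathcal G$, with morphisms $H\to G$ the $R$-span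 of the classes $\big[\frac{G\times H}{(U,\varphi)}\big]\in B^A_R(G,H)$, $(U,\varphi)\in\mathcal S(G,H)$, and with composition $\otimes_{AH}$. Let $F:\mathcal D\to R\text{-Mod}$ be an $R$-linear functor and $G\in\mathcal G$. For $L\le K\le G$ in $\mathcal G$ and $g\in G$ let $\mathrm{Res}^K_L=\big[\frac{L\times K}{(\Delta(L),1)}\big]:K\to L$, and for $x\in F(K)$ let ${}^gx\in F({}^gK)$ be its image under $F\big(\big[\frac{{}^gK\times K}{(\{(gkg^{-1},k):k\in K\},1)}\big]\big)$. *The module $F_+(G)$.* Consider pairs $(X,s)$ where $X$ is an $A$-fibered $G$-set with all $G_x\in\mathcal G$, and $s$ is a function with $s(x)\in F(G_x)$ and $s((g,a)x)={}^gs(x)$ for all $x\in X$, $g\in G$, $a\in A$. An isomorphism $(X,s)\to(Y,t)$ is an isomorphism $\alpha:X\to Y$ of $A$-fibered $G$-sets with $t(\alpha(x))=s(x)$ for all $x$. $F_+(G)$ is the free abelian group on the isomorphism classes $\{X,s\}$ modulo all $\{X\sqcup Y,s\sqcup t\}-\{X,s\}-\{Y,t\}$ and all $\{X,s+t\}-\{X,s\}-\{X,t\}$;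 the class of $\{X,s\}$ is $[X,s]$, and $r[X,s]=[X,rs]$ makes $F_+(G)$ an $R$-module. For $(L,\psi)\in\mathcal M(G)$ with $L\in\mathcal G$ and $a\in F(L)$, $[L,\psi,a]$ is the class of $\frac{G\times A}{(L,\psi)}$ with the unique such section taking the value $a$ at the base point. *The module $F^+(G)$.* Let $\mathcal M'(G)=\{(K,\lambda)\in\mathcal M(G):K\in\mathcal G\}$, a subposet of $\mathcal M(G)$ with Möbius function $\mu$. $F^+(G)$ is the $R$-module of families $(x_{(K,\lambda)})\in\bigoplus_{(K,\lambda)\in\mathcal M'(G)}F(K)$ with ${}^gx_{(K,\lambda)}=x_{{}^g(K,\lambda)}$ for all $g\in G$. *The maps.* Let $m_{F,G}:F_+(G)\to F^+(G)$ be the $R$-linear map whose coordinate at $(K,\lambda)$ is $$m_{F,G}([X,s])_{(K,\lambda)}=\sum_{\substack{x\in[X/A]\\(K,\lambda)\le(G_x,\varphi_x)}}F(\mathrm{Res}^{G_x}_K)(s(x)),$$ and let $n_{F,G}:F^+(G)\to F_+(G)$ be the $R$-linear map $$n_{F,G}\big((x_{(K,\lambda)})\big)=\sum_{\substack{(L,\psi),(K,\lambda)\in\mathcal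 M'(G)\\(L,\psi)\le(K,\lambda)}}|L|\,\mu\big((L,\psi),(K,\lambda)\big)\,\big[L,\psi,F(\mathrm{Res}^K_L)(x_{(K,\lambda)})\big].$$ **Statement.** * $n_{F,G}\circ m_{F,G}=|G|\cdot\mathrm{Id}_{F_+(G)}$ and $m_{F,G}\circ n_{F,G}=|G|\cdot\mathrm{Id}_{F^+(G)}$. * If $|G|$ is invertible in $R$, then $m_{F,G}$ and $|G|^{-1}n_{F,G}$ are mutually inverse isomorphisms of $R$-modules. * If $F_+(G)$ has trivial $|G|$-torsion (that is, $|G|x=0$ implies $x=0$ for $x\in F_+(G)$), then $m_{F,G}$ is injective. -/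

import Mathlib

open CategoryTheory TensorProduct

universe u v w

namespace Fibered

/-- The set `M(G)` of pairs `(U, φ)` with `U ≤ G` and `φ ∈ Hom(U, A)`. -/
structure MonPair (A G : Type u) [CommGroup A] [Group G] where
  sub : Subgroup G
  char : sub →* A

namespace MonPair

variable {A G H K : Type u} [CommGroup A] [Group G] [Group H] [Group K]

theorem ext' {p q : MonPair A G} (h : p.sub = q.sub)
    (hc : ∀ (g : G) (h₁ : g ∈ p.sub) (h₂ : g ∈ q.sub), p.char ⟨g, h₁⟩ = q.char ⟨g, h₂⟩) :
    p = q := by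
  obtain ⟨U, φ⟩ := p
  obtain ⟨V, ψ⟩ := q
  obtain rfl : U = V := h
  have : φ = ψ := MonoidHom.ext fun x => hc x.1 x.2 x.2
  rw [this]

/-- `(L, φ) ≤ (K, κ)` iff `L ≤ K` and `φ` is the restriction of `κ`. -/
instance : PartialOrder (MonPair A G) where
  le p q := ∃ h : p.sub ≤ q.sub, ∀ x : p.sub, p.char x = q.char (Subgroup.inclusion h x)
  le_refl p := ⟨le_rfl, fun _ => rfl⟩
  le_trans p q r := fun ⟨h₁, e₁⟩ ⟨h₂, e₂⟩ =>
    ⟨h₁.trans h₂, fun x => (e₁ x).trans (e₂ _)⟩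
  le_antisymm p q := fun ⟨h₁, e₁⟩ ⟨h₂, _⟩ =>
    ext' (le_antisymm h₁ h₂) fun g hg _ => e₁ ⟨g, hg⟩

/-- The pair `(U, 1)`. -/
def triv (U : Subgroup G) : MonPair A G := ⟨U, 1⟩

/-- `k ↦ g⁻¹ k g` as a homomorphism `K → H`, for subgroups with `g⁻¹ K g ≤ H`. -/
def conjHom (g : G) {H K : Subgroup G} (h : ∀ k ∈ K, g⁻¹ * k * g ∈ H) : K →* H where
  toFun k := ⟨g⁻¹ * k * g, h k k.2⟩
  map_one' := by ext; simp
  map_mul' a b := by ext; simp [mul_assoc]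

/-- The conjugate subgroup `ᵍU = g U g⁻¹`. -/
def conjSub (g : G) (U : Subgroup G) : Subgroup G := U.map (MulAut.conj g).toMonoidHom

theorem mem_conjSub {g x : G} {U : Subgroup G} : x ∈ conjSub g U ↔ g⁻¹ * x * g ∈ U := by
  simp only [conjSub, Subgroup.mem_map]
  constructor
  · rintro ⟨y, hy, rfl⟩
    simpa [mul_assoc] using hy
  · intro h
    exact ⟨_, h, by simp [mul_assoc]⟩

/-- The conjugate pair `ᵍ(U, φ)`, with `ᵍφ (g u g⁻¹) = φ u`. -/
def conj (g : G) (p : MonPair A G) : MonPair A G :=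
  ⟨conjSub g p.sub, p.char.comp (conjHom g fun _ h => mem_conjSub.1 h)⟩

/-- `φ₂ = ψ₁` on `k₂(U) ∩ k₁(V)`, where `φ₂ h = φ (1, h)⁻¹` and `ψ₁ h = ψ (h, 1)`. -/
def StarCompat (p : MonPair A (G × H)) (q : MonPair A (H × K)) : Prop :=
  ∀ (h : H) (h₁ : ((1 : G), h) ∈ p.sub) (h₂ : (h, (1 : K)) ∈ q.sub),
    (p.char ⟨_, h₁⟩)⁻¹ = q.char ⟨_, h₂⟩

/-- `U * V`, the subgroup of all `(g, k)` with `(g, h) ∈ U` and `(h, k) ∈ V` for some `h`. -/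
def starSub (U : Subgroup (G × H)) (V : Subgroup (H × K)) : Subgroup (G × K) where
  carrier := {x | ∃ h : H, (x.1, h) ∈ U ∧ (h, x.2) ∈ V}
  one_mem' := ⟨1, U.one_mem, V.one_mem⟩
  mul_mem' := fun ⟨h, h₁, h₂⟩ ⟨h', h₁', h₂'⟩ =>
    ⟨h * h', U.mul_mem h₁ h₁', V.mul_mem h₂ h₂'⟩
  inv_mem' := fun ⟨h, h₁, h₂⟩ => ⟨h⁻¹, U.inv_mem h₁, V.inv_mem h₂⟩

theorem starChar_wd {p : MonPair A (G × H)} {q : MonPair A (H × K)} (hc : StarCompat p q)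
    {g : G} {k : K} {h h' : H} (h₁ : (g, h) ∈ p.sub) (h₂ : (h, k) ∈ q.sub)
    (h₁' : (g, h') ∈ p.sub) (h₂' : (h', k) ∈ q.sub) :
    p.char ⟨_, h₁⟩ * q.char ⟨_, h₂⟩ = p.char ⟨_, h₁'⟩ * q.char ⟨_, h₂'⟩ := by
  have e₁ : ((1 : G), h'⁻¹ * h) ∈ p.sub := by
    simpa using p.sub.mul_mem (p.sub.inv_mem h₁') h₁
  have e₂ : (h'⁻¹ * h, (1 : K)) ∈ q.sub := by
    simpa using q.sub.mul_mem (q.sub.inv_mem h₂') h₂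
  have a₁ : (⟨_, h₁⟩ : p.sub) = ⟨_, h₁'⟩ * ⟨_, e₁⟩ := by ext <;> simp
  have a₂ : (⟨_, h₂⟩ : q.sub) = ⟨_, h₂'⟩ * ⟨_, e₂⟩ := by ext <;> simp
  have := hc _ e₁ e₂
  rw [a₁, a₂, map_mul, map_mul, ← this]
  rw [mul_mul_mul_comm, mul_inv_cancel, mul_one]

/-- `(U, φ) * (V, ψ) = (U * V, φ * ψ)` with `(φ * ψ)(g, k) = φ (g, h) ψ (h, k)`. -/
noncomputable def star (p : MonPair A (G × H)) (q : MonPair A (H × K)) (hc : StarCompat p q) :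
    MonPair A (G × K) where
  sub := starSub p.sub q.sub
  char :=
    { toFun := fun x =>
        p.char ⟨(x.1.1, x.2.choose), x.2.choose_spec.1⟩ *
          q.char ⟨(x.2.choose, x.1.2), x.2.choose_spec.2⟩
      map_one' := by
        have := starChar_wd hc (g := 1) (k := 1) (1 : starSub p.sub q.sub).2.choose_spec.1
          (1 : starSub p.sub q.sub).2.choose_spec.2 p.sub.one_mem q.sub.one_mem
        refine this.trans ?_
        have e₁ : p.char ⟨1, p.sub.one_mem⟩ = 1 := map_one p.char
        have e₂ : q.char ⟨1, q.sub.one_mem⟩ = 1 := map_one q.char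
        exact (congrArg₂ (· * ·) e₁ e₂).trans (mul_one 1)
      map_mul' := fun x y => by
        have hx := x.2.choose_spec
        have hy := y.2.choose_spec
        refine (starChar_wd hc (x * y).2.choose_spec.1 (x * y).2.choose_spec.2
          (p.sub.mul_mem hx.1 hy.1) (q.sub.mul_mem hx.2 hy.2)).trans ?_
        rw [mul_mul_mul_comm, ← map_mul, ← map_mul]
        rfl }

theorem star_char {p : MonPair A (G × H)} {q : MonPair A (H × K)} (hc : StarCompat p q)
    {g : G} {k : K} {h : H} (h₁ : (g, h) ∈ p.sub) (h₂ : (h, k) ∈ q.sub)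
    (h₃ : (g, k) ∈ (p.star q hc).sub) :
    (p.star q hc).char ⟨(g, k), h₃⟩ = p.char ⟨_, h₁⟩ * q.char ⟨_, h₂⟩ :=
  starChar_wd hc (h := h₃.choose) h₃.choose_spec.1 h₃.choose_spec.2 h₁ h₂

/-- `U * L = {g ∈ G : (g, l) ∈ U for some l ∈ L}` for `U ≤ G × H` and `L ≤ H`. -/
def starRight (U : Subgroup (G × H)) (L : Subgroup H) : Subgroup G :=
  (U ⊓ L.comap (MonoidHom.snd G H)).map (MonoidHom.fst G H)

/-- `L * U = {h ∈ H : (l, h) ∈ U for some l ∈ L}` for `L ≤ G` and `U ≤ G × H`. -/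
def starLeft (L : Subgroup G) (U : Subgroup (G × H)) : Subgroup H :=
  (U ⊓ L.comap (MonoidHom.fst G H)).map (MonoidHom.snd G H)

/-- The restriction of `(U, φ)` to `U ∩ (P × Q)`, viewed as an element of `M(P × Q)`.
For `P = U * Q` it is `(U, φ) * (Δ(Q), 1)`, and for `Q = P * U` it is `(Δ(P), 1) * (U, φ)`. -/
def restr (p : MonPair A (G × H)) (P : Subgroup G) (Q : Subgroup H) : MonPair A (P × Q) where
  sub := p.sub.comap (P.subtype.prodMap Q.subtype)
  char := p.char.comp ((P.subtype.prodMap Q.subtype).subgroupComap p.sub)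

end MonPair

/-- A left `A`-fibered `G`-set: a `(G × A)`-set on which `A` acts freely with finitely many
orbits. An `A`-fibered `(G, H)`-biset is an `A`-fibered `(G × H)`-set. -/
structure FiberedSet (A G : Type u) [CommGroup A] [Group G] where
  carrier : Type u
  [action : MulAction (G × A) carrier]
  free : ∀ (a : A) (x : carrier), ((1 : G), a) • x = x → a = 1
  finite_orbits : ∃ T : Set carrier, T.Finite ∧ ∀ x, ∃ t ∈ T, ∃ a : A, x = ((1 : G), a) • t

namespace FiberedSet

instance (A G : Type u) [CommGroup A] [Group G] : CoeSort (FiberedSet A G) (Type u) := ⟨carrier⟩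

attribute [instance] FiberedSet.action

variable {A G H K L : Type u} [CommGroup A] [Group G] [Group H] [Group K] [Group L]

/-- Isomorphism of `A`-fibered `G`-sets. -/
def Isomorphic (X Y : FiberedSet A G) : Prop :=
  ∃ e : X ≃ Y, ∀ (m : G × A) (x : X), e (m • x) = m • e x

/-- The `A`-orbits `X/A`. -/
def orbitSetoid (X : FiberedSet A G) : Setoid X where
  r x y := ∃ a : A, ((1 : G), a) • x = y
  iseqv :=
    { refl := fun x => ⟨1, one_smul _ x⟩
      symm := by
        rintro x _ ⟨a, rfl⟩
        exact ⟨a⁻¹, by rw [smul_smul]; simp [← Prod.one_eq_mk]⟩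
      trans := by
        rintro x _ _ ⟨a, rfl⟩ ⟨b, rfl⟩
        exact ⟨b * a, by rw [smul_smul]; simp⟩ }

/-- The set `X/A` of `A`-orbits. -/
def Orbits (X : FiberedSet A G) : Type u := Quotient X.orbitSetoid

instance (X : FiberedSet A G) : Finite X.Orbits := by
  obtain ⟨T, hT, h⟩ := X.finite_orbits
  have := hT.to_subtype
  refine Finite.of_surjective (fun t : T => (Quotient.mk X.orbitSetoid t.1 : X.Orbits)) ?_
  rintro ⟨x⟩
  obtain ⟨t, ht, a, rfl⟩ := h x
  exact ⟨⟨t, ht⟩, Quotient.sound ⟨a, rfl⟩⟩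

theorem smul_free (X : FiberedSet A G) {a b : A} {x : X}
    (h : ((1 : G), a) • x = ((1 : G), b) • x) : a = b := by
  have := X.free (b⁻¹ * a) x (by
    rw [show ((1 : G), b⁻¹ * a) = ((1 : G), b⁻¹) * ((1 : G), a) by simp, mul_smul, h, smul_smul]
    simp [← Prod.one_eq_mk])
  rwa [inv_mul_eq_one, eq_comm] at this

/-- The stabilizer `G_x` of the `A`-orbit of `x`. -/
def stab (X : FiberedSet A G) (x : X) : Subgroup G where
  carrier := {g | ∃ a : A, (g, (1 : A)) • x = ((1 : G), a) • x}
  one_mem' := ⟨1, rfl⟩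
  mul_mem' := by
    rintro g h ⟨a, ha⟩ ⟨b, hb⟩
    refine ⟨a * b, ?_⟩
    rw [show (g * h, (1 : A)) = (g, (1 : A)) * (h, 1) by simp, mul_smul, hb, smul_smul,
      show (g, (1 : A)) * ((1 : G), b) = ((1 : G), b) * (g, (1 : A)) by simp, mul_smul, ha,
      smul_smul]
    simp [mul_comm]
  inv_mem' := by
    rintro g ⟨a, ha⟩
    refine ⟨a⁻¹, ?_⟩
    rw [show (g⁻¹, (1 : A)) = ((1 : G), a⁻¹) * (g⁻¹, 1) * ((1 : G), a) by simp, mul_smul, ← ha,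
      smul_smul]
    simp

theorem mem_stab {X : FiberedSet A G} {x : X} {g : G} :
    g ∈ X.stab x ↔ ∃ a : A, (g, (1 : A)) • x = ((1 : G), a) • x := Iff.rfl

theorem mem_stab' {X : FiberedSet A G} {x : X} {g : G} :
    g ∈ X.stab x ↔ ∃ a : A, (g, a) • x = x := by
  rw [mem_stab]
  constructor
  · rintro ⟨a, ha⟩
    refine ⟨a⁻¹, ?_⟩
    rw [show (g, a⁻¹) = ((1 : G), a⁻¹) * (g, 1) by simp, mul_smul, ha, smul_smul]
    simp [← Prod.one_eq_mk]
  · rintro ⟨a, ha⟩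
    refine ⟨a⁻¹, ?_⟩
    nth_rewrite 2 [← ha]
    rw [smul_smul]; simp

/-- The homomorphism `φ_x : G_x → A` determined by `g x = φ_x(g) x`. -/
noncomputable def stabChar (X : FiberedSet A G) (x : X) : X.stab x →* A where
  toFun g := g.2.choose
  map_one' := X.smul_free ((1 : X.stab x).2.choose_spec.symm)
  map_mul' g h := by
    apply X.smul_free (x := x)
    rw [← (g * h).2.choose_spec, mul_comm]
    rw [show ((1 : G), h.2.choose * g.2.choose) = ((1 : G), h.2.choose) * (1, g.2.choose) by simp,
      mul_smul, ← g.2.choose_spec, smul_smul,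
      show ((1 : G), h.2.choose) * (g.1, (1 : A)) = (g.1, (1 : A)) * (1, h.2.choose) by simp,
      mul_smul, ← h.2.choose_spec, smul_smul]
    simp

theorem stabChar_spec (X : FiberedSet A G) (x : X) (g : X.stab x) :
    (g.1, (1 : A)) • x = ((1 : G), X.stabChar x g) • x := g.2.choose_spec

theorem stabChar_eq_iff (X : FiberedSet A G) (x : X) (g : X.stab x) (a : A) :
    X.stabChar x g = a ↔ (g.1, a⁻¹) • x = x := by
  have e : (g.1, a⁻¹) • x = ((1 : G), a⁻¹ * X.stabChar x g) • x := by
    rw [show (g.1, a⁻¹) = ((1 : G), a⁻¹) * (g.1, 1) by simp, mul_smul, stabChar_spec, smul_smul]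
    simp
  rw [e]
  constructor
  · rintro rfl
    simp [← Prod.one_eq_mk]
  · intro h
    have := X.free _ _ h
    rwa [inv_mul_eq_one, eq_comm] at this

/-- The stabilizing pair `(G_x, φ_x)`. -/
noncomputable def pair (X : FiberedSet A G) (x : X) : MonPair A G := ⟨X.stab x, X.stabChar x⟩

theorem pair_eq_of {X : FiberedSet A G} {x : X} {p : MonPair A G}
    (h₁ : ∀ g, g ∈ X.stab x → g ∈ p.sub)
    (h₂ : ∀ g (h : g ∈ p.sub), (g, (p.char ⟨g, h⟩)⁻¹) • x = x) : X.pair x = p := by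
  refine MonPair.ext' (le_antisymm h₁ fun g h => mem_stab'.2 ⟨_, h₂ g h⟩) fun g h h' => ?_
  exact (X.stabChar_eq_iff x ⟨g, h⟩ _).2 (h₂ g h')

theorem pair_smul (X : FiberedSet A G) (x : X) (g : G) (a : A) :
    X.pair ((g, a) • x) = (X.pair x).conj g := by
  apply pair_eq_of
  · intro k hk
    obtain ⟨b, hb⟩ := mem_stab'.1 hk
    refine MonPair.mem_conjSub.2 (mem_stab'.2 ⟨b, ?_⟩)
    have : ((g, a) : G × A)⁻¹ • (k, b) • (g, a) • x = x := by rw [hb, inv_smul_smul]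
    rw [smul_smul, smul_smul] at this
    simpa [mul_assoc] using this
  · intro k hk
    have hk' := MonPair.mem_conjSub.1 hk
    have := (X.stabChar_eq_iff x ⟨_, hk'⟩ _).1 rfl
    change (k, (X.stabChar x ⟨_, hk'⟩)⁻¹) • (g, a) • x = _
    generalize (X.stabChar x ⟨_, hk'⟩)⁻¹ = b at this
    rw [smul_smul]
    nth_rewrite 2 [← this]
    rw [smul_smul]
    simp [mul_assoc, mul_comm]

theorem stab_smul (X : FiberedSet A G) (x : X) (g : G) (a : A) :
    X.stab ((g, a) • x) = MonPair.conjSub g (X.stab x) :=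
  congrArg MonPair.sub (X.pair_smul x g a)

theorem pair_congr {X Y : FiberedSet A G} (e : X ≃ Y)
    (he : ∀ (m : G × A) (x : X), e (m • x) = m • e x) (x : X) : Y.pair (e x) = X.pair x := by
  apply pair_eq_of
  · intro g hg
    obtain ⟨a, ha⟩ := mem_stab'.1 hg
    exact mem_stab'.2 ⟨a, e.injective (by rw [he, ha])⟩
  · intro g hg
    rw [← he]
    exact congrArg e ((X.stabChar_eq_iff x ⟨g, hg⟩ _).1 rfl)

/-- A relation that matches the points of `X` and `Y` equivariantly gives an isomorphism. -/
theorem isomorphic_of_rel {X Y : FiberedSet A G} (R : X → Y → Prop)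
    (h₁ : ∀ x, ∃ y, R x y) (h₂ : ∀ y, ∃ x, R x y)
    (h₃ : ∀ x x' y y', R x y → R x' y' → (x = x' ↔ y = y'))
    (h₄ : ∀ (m : G × A) x y, R x y → R (m • x) (m • y)) : Isomorphic X Y := by
  choose f hf using h₁
  choose k hk using h₂
  refine ⟨⟨f, k, fun x => ?_, fun y => ?_⟩, fun m x => ?_⟩
  · exact (h₃ _ _ _ _ (hk (f x)) (hf x)).2 rfl
  · exact (h₃ _ _ _ _ (hf (k y)) (hk y)).1 rfl
  · exact (h₃ _ _ _ _ (hf (m • x)) (h₄ m _ _ (hf x))).1 rfl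

theorem Isomorphic.refl (X : FiberedSet A G) : Isomorphic X X := ⟨Equiv.refl _, fun _ _ => rfl⟩

theorem Isomorphic.symm {X Y : FiberedSet A G} : Isomorphic X Y → Isomorphic Y X := by
  rintro ⟨e, he⟩
  exact ⟨e.symm, fun m x => e.injective (by rw [he]; simp)⟩

theorem Isomorphic.trans {X Y Z : FiberedSet A G} :
    Isomorphic X Y → Isomorphic Y Z → Isomorphic X Z := by
  rintro ⟨e, he⟩ ⟨f, hf⟩
  exact ⟨e.trans f, fun m x => by simp [he, hf]⟩

/-- The disjoint union `X ⊔ Y`. -/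
def sum (X Y : FiberedSet A G) : FiberedSet A G where
  carrier := X ⊕ Y
  action :=
    { smul := fun m => Sum.map (m • ·) (m • ·)
      one_smul := by rintro (x | y) <;> simp [HSMul.hSMul] <;> exact one_smul _ _
      mul_smul := by
        rintro m n (x | y) <;> simp [HSMul.hSMul] <;> exact mul_smul _ _ _ }
  free := by
    rintro a (x | y) h
    · exact X.free a x (Sum.inl_injective h)
    · exact Y.free a y (Sum.inr_injective h)
  finite_orbits := by
    obtain ⟨S, hS, h⟩ := X.finite_orbits
    obtain ⟨T, hT, h'⟩ := Y.finite_orbits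
    refine ⟨Sum.inl '' S ∪ Sum.inr '' T, (hS.image _).union (hT.image _), ?_⟩
    rintro (x | y)
    · obtain ⟨t, ht, a, rfl⟩ := h x
      exact ⟨_, Or.inl ⟨t, ht, rfl⟩, a, rfl⟩
    · obtain ⟨t, ht, a, rfl⟩ := h' y
      exact ⟨_, Or.inr ⟨t, ht, rfl⟩, a, rfl⟩

/-- The inclusion `X → X ⊔ Y`. -/
def sumInl {X Y : FiberedSet A G} (x : X) : X.sum Y := Sum.inl x

/-- The inclusion `Y → X ⊔ Y`. -/
def sumInr {X Y : FiberedSet A G} (y : Y) : X.sum Y := Sum.inr y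

theorem sum_cases {X Y : FiberedSet A G} (z : X.sum Y) :
    (∃ x, z = sumInl x) ∨ ∃ y, z = sumInr y := by
  obtain x | y := z
  · exact Or.inl ⟨x, rfl⟩
  · exact Or.inr ⟨y, rfl⟩

section sum

variable {X Y : FiberedSet A G}

theorem smul_sumInl (m : G × A) (x : X) : m • (sumInl x : X.sum Y) = sumInl (m • x) := rfl

theorem smul_sumInr (m : G × A) (y : Y) : m • (sumInr y : X.sum Y) = sumInr (m • y) := rfl

theorem sumInl_inj {x x' : X} : (sumInl x : X.sum Y) = sumInl x' ↔ x = x' := Sum.inl_injective.eq_iff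

theorem sumInr_inj {y y' : Y} : (sumInr y : X.sum Y) = sumInr y' ↔ y = y' := Sum.inr_injective.eq_iff

theorem sumInl_ne {x : X} {y : Y} : (sumInl x : X.sum Y) ≠ sumInr y := Sum.inl_ne_inr

theorem sumInr_ne {x : X} {y : Y} : (sumInr y : X.sum Y) ≠ sumInl x := Sum.inr_ne_inl

end sum

/-- The empty `A`-fibered `G`-set. -/
def empty : FiberedSet A G where
  carrier := PEmpty
  action :=
    { smul := fun _ x => x
      one_smul := fun _ => rfl
      mul_smul := fun _ _ _ => rfl }
  free _ x := x.elim
  finite_orbits := ⟨∅, Set.finite_empty, fun x => x.elim⟩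

/-- The subgroup `{(u, φ(u)⁻¹) : u ∈ U}` of `G × A`. -/
def transSub (p : MonPair A G) : Subgroup (G × A) where
  carrier := {m | ∃ h : m.1 ∈ p.sub, m.2 = (p.char ⟨m.1, h⟩)⁻¹}
  one_mem' := ⟨p.sub.one_mem, (inv_eq_one.2 (map_one p.char)).symm⟩
  mul_mem' := by
    rintro ⟨g, a⟩ ⟨h, b⟩ ⟨hg, ha⟩ ⟨hh, hb⟩
    refine ⟨p.sub.mul_mem hg hh, ?_⟩
    change a * b = _
    rw [show a = _ from ha, show b = _ from hb, ← mul_inv, ← map_mul]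
    rfl
  inv_mem' := by
    rintro ⟨g, a⟩ ⟨hg, ha⟩
    refine ⟨p.sub.inv_mem hg, ?_⟩
    change a⁻¹ = _
    rw [show a = _ from ha, ← map_inv]
    rfl

/-- The transitive `A`-fibered `G`-set `(G × A) / {(u, φ(u)⁻¹) : u ∈ U}` attached to `(U, φ)`. -/
def trans [Finite G] (p : MonPair A G) : FiberedSet A G where
  carrier := (G × A) ⧸ transSub p
  free := by
    rintro a ⟨g, b⟩ h
    have h := QuotientGroup.eq.1 (show (QuotientGroup.mk ((1 * g, a * b) : G × A) :
      (G × A) ⧸ transSub p) = QuotientGroup.mk (g, b) from h)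
    obtain ⟨h₁, h₂⟩ := h
    have : (⟨_, h₁⟩ : p.sub) = 1 := by ext; simp
    rw [this] at h₂
    simpa using h₂
  finite_orbits := by
    refine ⟨Set.range fun g : G => QuotientGroup.mk (g, (1 : A)), Set.finite_range _, ?_⟩
    rintro ⟨g, b⟩
    refine ⟨_, ⟨g, rfl⟩, b, ?_⟩
    change (QuotientGroup.mk (g, b) : (G × A) ⧸ transSub p) = QuotientGroup.mk (1 * g, b * 1)
    simp

/-- The base point of the transitive `A`-fibered `G`-set attached to `(U, φ)`. -/
def transBase [Finite G] (p : MonPair A G) : trans p := (QuotientGroup.mk 1 : (G × A) ⧸ transSub p)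

theorem exists_smul_transBase [Finite G] (p : MonPair A G) (x : trans p) :
    ∃ m : G × A, x = m • transBase p := by
  obtain ⟨m⟩ := x
  exact ⟨m, show QuotientGroup.mk m = QuotientGroup.mk (m * 1) by rw [mul_one]⟩

theorem smul_transBase_eq_iff [Finite G] (p : MonPair A G) (m n : G × A) :
    m • transBase p = n • transBase p ↔ m⁻¹ * n ∈ transSub p := by
  have : ∀ m : G × A, m • transBase p = (QuotientGroup.mk m : (G × A) ⧸ transSub p) := fun m =>
    show QuotientGroup.mk (m * 1) = QuotientGroup.mk m by rw [mul_one]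
  rw [this, this]
  exact QuotientGroup.eq

theorem smul_transBase_eq_self_iff [Finite G] (p : MonPair A G) (m : G × A) :
    m • transBase p = transBase p ↔ m ∈ transSub p := by
  have := smul_transBase_eq_iff p 1 m
  rw [one_smul] at this
  rw [eq_comm, this]; simp

theorem pair_transBase [Finite G] (p : MonPair A G) : (trans p).pair (transBase p) = p := by
  apply pair_eq_of
  · intro g hg
    obtain ⟨a, ha⟩ := mem_stab'.1 hg
    exact ((smul_transBase_eq_self_iff p _).1 ha).1
  · intro g hg
    exact (smul_transBase_eq_self_iff p _).2 ⟨hg, rfl⟩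

theorem mem_transSub_pair_iff {X : FiberedSet A G} {x : X} {m : G × A} :
    m ∈ transSub (X.pair x) ↔ m • x = x := by
  constructor
  · rintro ⟨h, e⟩
    have := (X.stabChar_eq_iff x ⟨m.1, h⟩ _).1 rfl
    have e' : m = (m.1, (X.stabChar x ⟨m.1, h⟩)⁻¹) := Prod.ext rfl e
    rw [e']
    exact this
  · intro h
    have h₁ : m.1 ∈ X.stab x := mem_stab'.2 ⟨m.2, h⟩
    refine ⟨h₁, ?_⟩
    have := (X.stabChar_eq_iff x ⟨m.1, h₁⟩ m.2⁻¹).2 (by simpa using h)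
    change m.2 = (X.stabChar x ⟨m.1, h₁⟩)⁻¹
    rw [this, inv_inv]

/-- A transitive `A`-fibered `G`-set is determined by the stabilizing pair of a point. -/
theorem isomorphic_trans [Finite G] {X : FiberedSet A G} (x : X)
    (h : ∀ y : X, ∃ m : G × A, y = m • x) : Isomorphic X (trans (X.pair x)) := by
  refine isomorphic_of_rel (fun y t => ∃ m : G × A, y = m • x ∧ t = m • transBase _) ?_ ?_ ?_ ?_
  · intro y
    obtain ⟨m, hm⟩ := h y
    exact ⟨_, m, hm, rfl⟩
  · intro t
    obtain ⟨m, hm⟩ := exists_smul_transBase _ t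
    exact ⟨_, m, rfl, hm⟩
  · rintro _ _ _ _ ⟨m, rfl, rfl⟩ ⟨n, rfl, rfl⟩
    rw [smul_transBase_eq_iff, mem_transSub_pair_iff, mul_smul, inv_smul_eq_iff, eq_comm]
  · rintro m _ _ ⟨n, rfl, rfl⟩
    exact ⟨m * n, mul_smul _ _ _ |>.symm, mul_smul _ _ _ |>.symm⟩

end FiberedSet
end Fibered
namespace Fibered
namespace FiberedSet

variable {A G H K L : Type u} [CommGroup A] [Group G] [Group H] [Group K] [Group L]

/-- The `(H × A)`-orbits on `X × Y` for the action `(h, a)(x, y) = (x (ha)⁻¹, h a y)`. In terms of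
the left `(G × H × A)`-action on `X`, `x (ha)⁻¹` is `((1, h), a⁻¹) • x`. -/
def tensorSetoid (X : FiberedSet A (G × H)) (Y : FiberedSet A (H × K)) : Setoid (X × Y) where
  r p q := ∃ (h : H) (a : A), q = ((((1 : G), h), a⁻¹) • p.1, ((h, (1 : K)), a) • p.2)
  iseqv :=
    { refl := fun p => ⟨1, 1, by simp [← Prod.one_eq_mk]⟩
      symm := by
        rintro p _ ⟨h, a, rfl⟩
        exact ⟨h⁻¹, a⁻¹, by ext <;> simp [smul_smul, ← Prod.one_eq_mk]⟩
      trans := by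
        rintro p _ _ ⟨h, a, rfl⟩ ⟨k, b, rfl⟩
        exact ⟨k * h, b * a, by ext <;> simp [smul_smul, mul_comm]⟩ }

/-- All `(H × A)`-orbits on `X × Y`. -/
def PreTensor (X : FiberedSet A (G × H)) (Y : FiberedSet A (H × K)) : Type u :=
  Quotient (tensorSetoid X Y)

/-- The `(H × A)`-orbit of `(x, y)`. -/
def preMk {X : FiberedSet A (G × H)} {Y : FiberedSet A (H × K)} (p : X × Y) : PreTensor X Y :=
  Quotient.mk (tensorSetoid X Y) p

/-- The action `(g, k, a)[x, y] = [(g, a) x, k y]`. -/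
instance (X : FiberedSet A (G × H)) (Y : FiberedSet A (H × K)) :
    MulAction ((G × K) × A) (PreTensor X Y) where
  smul m := Quotient.map
    (fun p => (((m.1.1, (1 : H)), m.2) • p.1, (((1 : H), m.1.2), (1 : A)) • p.2)) (by
      rintro p _ ⟨h, a, rfl⟩
      exact ⟨h, a, by ext <;> simp [smul_smul, mul_comm]⟩)
  one_smul := by
    rintro ⟨p⟩
    exact congrArg (Quotient.mk _) (by ext <;> simp [← Prod.one_eq_mk])
  mul_smul := by
    rintro m n ⟨p⟩
    exact congrArg (Quotient.mk _) (by ext <;> simp [smul_smul])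

theorem preTensor_smul_mk {X : FiberedSet A (G × H)} {Y : FiberedSet A (H × K)} (m : (G × K) × A)
    (p : X × Y) : m • preMk p = preMk (X := X) (Y := Y) (((m.1.1, (1 : H)), m.2) • p.1, (((1 : H), m.1.2), (1 : A)) • p.2) := rfl

/-- The orbit of `(x, y)` is `A`-free. -/
def TFree {X : FiberedSet A (G × H)} {Y : FiberedSet A (H × K)} (x : X) (y : Y) : Prop :=
  ∀ (h : H) (a b : A), (((1 : G), h), a) • x = x → ((h, (1 : K)), b) • y = y → a * b = 1

theorem tfree_iff {X : FiberedSet A (G × H)} {Y : FiberedSet A (H × K)} (x : X) (y : Y) :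
    (∀ a : A, ((1 : G × K), a) • preMk (x, y) = preMk (x, y) → a = 1) ↔ TFree x y := by
  constructor
  · intro hf h a b hx hy
    refine hf _ (Quotient.sound ⟨h, b, ?_⟩)
    ext
    · simp only [smul_smul]
      nth_rewrite 1 [← hx]
      simp [Prod.one_eq_mk, mul_comm]
    · simp only [smul_smul]
      nth_rewrite 1 [← hy]
      simp [Prod.one_eq_mk]
  · intro hf c hc
    obtain ⟨h, a, e⟩ := Quotient.exact hc
    simp only [Prod.mk.injEq, smul_smul] at e
    obtain ⟨e₁, e₂⟩ := e
    have := hf h (a⁻¹ * c) a (by rw [eq_comm]; simpa [Prod.one_eq_mk] using e₁)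
      (by rw [eq_comm]; simpa [Prod.one_eq_mk] using e₂)
    simpa [mul_comm, mul_assoc] using this

/-- The tensor product `X ⊗_{AH} Y`: the `(H × A)`-orbits on `X × Y` that are `A`-free. -/
def tensor (X : FiberedSet A (G × H)) (Y : FiberedSet A (H × K)) : FiberedSet A (G × K) where
  carrier := {q : PreTensor X Y // ∀ a : A, ((1 : G × K), a) • q = q → a = 1}
  action :=
    { smul := fun m q => ⟨m • q.1, fun a h => q.2 a (by
        rw [smul_smul, show ((1 : G × K), a) * m = m * (1, a) by ext <;> simp [mul_comm],
          mul_smul] at h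
        exact smul_left_cancel m h)⟩
      one_smul := fun q => Subtype.ext (one_smul _ q.1)
      mul_smul := fun m n q => Subtype.ext (mul_smul m n q.1) }
  free a q h := q.2 a (congrArg Subtype.val h)
  finite_orbits := by
    obtain ⟨S, hS, h⟩ := X.finite_orbits
    obtain ⟨T, hT, h'⟩ := Y.finite_orbits
    refine ⟨{q | ∃ p ∈ S ×ˢ T, q.1 = preMk p}, ?_, ?_⟩
    · refine Set.Finite.of_finite_image (f := Subtype.val) ?_ Subtype.val_injective.injOn
      refine ((hS.prod hT).image preMk).subset ?_
      rintro _ ⟨q, ⟨p, hp, e⟩, rfl⟩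
      exact ⟨p, hp, e.symm⟩
    · rintro ⟨⟨x, y⟩, hq⟩
      obtain ⟨s, hs, a, rfl⟩ := h x
      obtain ⟨t, ht, b, rfl⟩ := h' y
      have e : preMk (((1 : G × H), a) • s, ((1 : H × K), b) • t) =
          ((1 : G × K), a * b) • preMk (s, t) :=
        Quotient.sound ⟨1, b⁻¹, by ext <;> simp [smul_smul, mul_comm, ← Prod.one_eq_mk]⟩
      have hq' : ∀ c : A, ((1 : G × K), c) • preMk (s, t) =
          preMk (s, t) → c = 1 := fun c hc => hq c (by
        change ((1 : G × K), c) • preMk (((1 : G × H), a) • s, ((1 : H × K), b) • t) = preMk (((1 : G × H), a) • s, ((1 : H × K), b) • t)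
        rw [e, smul_smul, show ((1 : G × K), c) * (1, a * b) = (1, a * b) * (1, c) by
          simp [mul_comm], mul_smul, hc])
      exact ⟨⟨preMk (s, t), hq'⟩, ⟨_, ⟨hs, ht⟩, rfl⟩, a * b, Subtype.ext e⟩

section tensor

variable {X X' : FiberedSet A (G × H)} {Y Y' : FiberedSet A (H × K)} {Z : FiberedSet A (K × L)}

/-- The element `x ⊗ y`. -/
def tmk (x : X) (y : Y) (h : TFree x y) : X.tensor Y := ⟨preMk (x, y), (tfree_iff x y).2 h⟩

theorem exists_tmk (t : X.tensor Y) : ∃ x y, ∃ h : TFree x y, t = tmk x y h := by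
  obtain ⟨⟨x, y⟩, h⟩ := t
  exact ⟨x, y, (tfree_iff x y).1 h, rfl⟩

theorem tmk_eq_iff {x x' : X} {y y' : Y} {h : TFree x y} {h' : TFree x' y'} :
    tmk x y h = tmk x' y' h' ↔
      ∃ (k : H) (a : A), x' = (((1 : G), k), a⁻¹) • x ∧ y' = ((k, (1 : K)), a) • y := by
  constructor
  · intro e
    obtain ⟨k, a, e⟩ := Quotient.exact (congrArg Subtype.val e)
    exact ⟨k, a, congrArg Prod.fst e, congrArg Prod.snd e⟩
  · rintro ⟨k, a, rfl, rfl⟩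
    exact Subtype.ext (Quotient.sound ⟨k, a, rfl⟩)

theorem TFree.smul {x : X} {y : Y} (h : TFree x y) (g : G) (k : K) (a b : A) :
    TFree (((g, (1 : H)), a) • x) ((((1 : H), k), b) • y) := by
  intro l c d hx hy
  refine h l c d (smul_left_cancel ((g, (1 : H)), a) ?_)
    (smul_left_cancel (((1 : H), k), b) ?_)
  · rw [smul_smul] at hx ⊢
    refine Eq.trans ?_ hx
    simp [mul_comm]
  · rw [smul_smul] at hy ⊢
    refine Eq.trans ?_ hy
    simp [mul_comm]

theorem smul_tmk {x : X} {y : Y} (h : TFree x y) (m : (G × K) × A) :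
    m • tmk x y h = tmk (((m.1.1, (1 : H)), m.2) • x) ((((1 : H), m.1.2), (1 : A)) • y)
      (h.smul _ _ _ _) := rfl

theorem tmk_smul_eq {x : X} {y : Y} (k : H) (a : A)
    (h : TFree ((((1 : G), k), a⁻¹) • x) (((k, (1 : K)), a) • y)) (h' : TFree x y) :
    tmk ((((1 : G), k), a⁻¹) • x) (((k, (1 : K)), a) • y) h = tmk x y h' :=
  (tmk_eq_iff.2 ⟨k, a, rfl, rfl⟩).symm

/-- The stabilizing pair of `x ⊗ y` is the product of those of `x` and `y`. -/
theorem TFree.starCompat {x : X} {y : Y} (h : TFree x y) :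
    MonPair.StarCompat (X.pair x) (Y.pair y) := by
  intro k h₁ h₂
  have e₁ := (X.stabChar_eq_iff x ⟨_, h₁⟩ _).1 rfl
  have e₂ := (Y.stabChar_eq_iff y ⟨_, h₂⟩ _).1 rfl
  have := h k _ _ e₁ e₂
  rwa [mul_inv_eq_one] at this

theorem tfree_of_starCompat {x : X} {y : Y} (h : MonPair.StarCompat (X.pair x) (Y.pair y)) :
    TFree x y := by
  intro k a b hx hy
  have h₁ : ((1 : G), k) ∈ X.stab x := mem_stab'.2 ⟨a, hx⟩
  have h₂ : (k, (1 : K)) ∈ Y.stab y := mem_stab'.2 ⟨b, hy⟩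
  have e₁ := (X.stabChar_eq_iff x ⟨_, h₁⟩ a⁻¹).2 (by simpa using hx)
  have e₂ := (Y.stabChar_eq_iff y ⟨_, h₂⟩ b⁻¹).2 (by simpa using hy)
  have := h k h₁ h₂
  change (X.stabChar x ⟨_, h₁⟩)⁻¹ = Y.stabChar y ⟨_, h₂⟩ at this
  rw [e₁, e₂, inv_inv] at this
  rw [this, inv_mul_cancel]

theorem pair_tmk {x : X} {y : Y} (h : TFree x y) :
    (X.tensor Y).pair (tmk x y h) = (X.pair x).star (Y.pair y) h.starCompat := by
  apply pair_eq_of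
  · rintro ⟨g, k⟩ hg
    obtain ⟨a, ha⟩ := mem_stab'.1 hg
    rw [smul_tmk, tmk_eq_iff] at ha
    obtain ⟨l, b, e₁, e₂⟩ := ha
    refine ⟨l, mem_stab'.2 ⟨b⁻¹ * a, ?_⟩, mem_stab'.2 ⟨b, ?_⟩⟩
    · rw [eq_comm, smul_smul] at e₁; simpa using e₁
    · rw [eq_comm, smul_smul] at e₂; simpa using e₂
  · rintro ⟨g, k⟩ hg
    obtain ⟨l, h₁, h₂⟩ := id hg
    rw [MonPair.star_char h.starCompat h₁ h₂, smul_tmk, tmk_eq_iff]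
    have e₁ := (X.stabChar_eq_iff x ⟨_, h₁⟩ _).1 rfl
    have e₂ := (Y.stabChar_eq_iff y ⟨_, h₂⟩ _).1 rfl
    change (_, ((X.pair x).char ⟨_, h₁⟩)⁻¹) • x = x at e₁
    change (_, ((Y.pair y).char ⟨_, h₂⟩)⁻¹) • y = y at e₂
    generalize (X.pair x).char ⟨_, h₁⟩ = a at e₁
    generalize (Y.pair y).char ⟨_, h₂⟩ = b at e₂
    refine ⟨l, b⁻¹, ?_, ?_⟩
    · rw [smul_smul]; rw [eq_comm] at e₁; simpa using e₁
    · rw [smul_smul]; rw [eq_comm] at e₂; simpa using e₂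

theorem tensor_congr (hX : Isomorphic X X') (hY : Isomorphic Y Y') :
    Isomorphic (X.tensor Y) (X'.tensor Y') := by
  obtain ⟨e, he⟩ := hX
  obtain ⟨f, hf⟩ := hY
  have key : ∀ x y, TFree x y ↔ TFree (e x) (f y) := fun x y => by
    simp only [TFree, ← he, ← hf, e.apply_eq_iff_eq, f.apply_eq_iff_eq]
  refine isomorphic_of_rel (fun s t => ∃ x y h h', s = tmk x y h ∧ t = tmk (e x) (f y) h')
    ?_ ?_ ?_ ?_
  · intro s
    obtain ⟨x, y, h, rfl⟩ := exists_tmk s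
    exact ⟨_, x, y, h, (key _ _).1 h, rfl, rfl⟩
  · intro t
    obtain ⟨x, y, h, rfl⟩ := exists_tmk t
    obtain ⟨x, rfl⟩ := e.surjective x
    obtain ⟨y, rfl⟩ := f.surjective y
    exact ⟨_, x, y, (key _ _).2 h, h, rfl, rfl⟩
  · rintro _ _ _ _ ⟨x, y, h, h', rfl, rfl⟩ ⟨x₂, y₂, h₂, h₂', rfl, rfl⟩
    simp only [tmk_eq_iff, ← he, ← hf, e.apply_eq_iff_eq, f.apply_eq_iff_eq]
  · rintro m _ _ ⟨x, y, h, h', rfl, rfl⟩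
    refine ⟨_, _, h.smul _ _ _ _, ?_, smul_tmk _ _, ?_⟩
    · rw [he, hf]; exact h'.smul _ _ _ _
    · simp only [he, hf]; exact smul_tmk _ _

theorem sum_tensor (X X' : FiberedSet A (G × H)) (Y : FiberedSet A (H × K)) :
    Isomorphic ((X.sum X').tensor Y) ((X.tensor Y).sum (X'.tensor Y)) := by
  have kl : ∀ (x : X) (y : Y), TFree (X := X.sum X') (Y := Y) (sumInl x) y ↔ TFree x y := fun x y => by
    simp only [TFree, smul_sumInl, sumInl_inj]
  have kr : ∀ (x : X') (y : Y), TFree (X := X.sum X') (Y := Y) (sumInr x) y ↔ TFree x y := fun x y => by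
    simp only [TFree, smul_sumInr, sumInr_inj]
  refine isomorphic_of_rel (fun s t =>
    (∃ x y, ∃ h : TFree x y, s = tmk (X := X.sum X') (Y := Y) (sumInl x) y ((kl x y).2 h) ∧
      t = sumInl (tmk x y h)) ∨
    (∃ x y, ∃ h : TFree x y, s = tmk (X := X.sum X') (Y := Y) (sumInr x) y ((kr x y).2 h) ∧
      t = sumInr (tmk x y h))) ?_ ?_ ?_ ?_
  · intro s
    obtain ⟨x, y, h, rfl⟩ := exists_tmk s
    obtain ⟨x, rfl⟩ | ⟨x, rfl⟩ := sum_cases x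
    · exact ⟨_, Or.inl ⟨x, y, (kl x y).1 h, rfl, rfl⟩⟩
    · exact ⟨_, Or.inr ⟨x, y, (kr x y).1 h, rfl, rfl⟩⟩
  · intro t
    obtain ⟨t, rfl⟩ | ⟨t, rfl⟩ := sum_cases t
    · obtain ⟨x, y, h, rfl⟩ := exists_tmk t
      exact ⟨_, Or.inl ⟨x, y, h, rfl, rfl⟩⟩
    · obtain ⟨x, y, h, rfl⟩ := exists_tmk t
      exact ⟨_, Or.inr ⟨x, y, h, rfl, rfl⟩⟩
  · rintro _ _ _ _ (⟨x, y, h, rfl, rfl⟩ | ⟨x, y, h, rfl, rfl⟩)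
      (⟨x', y', h', rfl, rfl⟩ | ⟨x', y', h', rfl, rfl⟩) <;>
    simp [tmk_eq_iff, smul_sumInl, smul_sumInr, sumInl_inj, sumInr_inj, sumInl_ne, sumInr_ne]
  · rintro m _ _ (⟨x, y, h, rfl, rfl⟩ | ⟨x, y, h, rfl, rfl⟩)
    · exact Or.inl ⟨_, _, h.smul _ _ _ _, rfl, rfl⟩
    · exact Or.inr ⟨_, _, h.smul _ _ _ _, rfl, rfl⟩

theorem tensor_sum (X : FiberedSet A (G × H)) (Y Y' : FiberedSet A (H × K)) :
    Isomorphic (X.tensor (Y.sum Y')) ((X.tensor Y).sum (X.tensor Y')) := by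
  have kl : ∀ (x : X) (y : Y), TFree (X := X) (Y := Y.sum Y') x (sumInl y) ↔ TFree x y := fun x y => by
    simp only [TFree, smul_sumInl, sumInl_inj]
  have kr : ∀ (x : X) (y : Y'), TFree (X := X) (Y := Y.sum Y') x (sumInr y) ↔ TFree x y := fun x y => by
    simp only [TFree, smul_sumInr, sumInr_inj]
  refine isomorphic_of_rel (fun s t =>
    (∃ x y, ∃ h : TFree x y, s = tmk (X := X) (Y := Y.sum Y') x (sumInl y) ((kl x y).2 h) ∧
      t = sumInl (tmk x y h)) ∨
    (∃ x y, ∃ h : TFree x y, s = tmk (X := X) (Y := Y.sum Y') x (sumInr y) ((kr x y).2 h) ∧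
      t = sumInr (tmk x y h))) ?_ ?_ ?_ ?_
  · intro s
    obtain ⟨x, y, h, rfl⟩ := exists_tmk s
    obtain ⟨y, rfl⟩ | ⟨y, rfl⟩ := sum_cases y
    · exact ⟨_, Or.inl ⟨x, y, (kl x y).1 h, rfl, rfl⟩⟩
    · exact ⟨_, Or.inr ⟨x, y, (kr x y).1 h, rfl, rfl⟩⟩
  · intro t
    obtain ⟨t, rfl⟩ | ⟨t, rfl⟩ := sum_cases t
    · obtain ⟨x, y, h, rfl⟩ := exists_tmk t
      exact ⟨_, Or.inl ⟨x, y, h, rfl, rfl⟩⟩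
    · obtain ⟨x, y, h, rfl⟩ := exists_tmk t
      exact ⟨_, Or.inr ⟨x, y, h, rfl, rfl⟩⟩
  · rintro _ _ _ _ (⟨x, y, h, rfl, rfl⟩ | ⟨x, y, h, rfl, rfl⟩)
      (⟨x', y', h', rfl, rfl⟩ | ⟨x', y', h', rfl, rfl⟩) <;>
    simp [tmk_eq_iff, smul_sumInl, smul_sumInr, sumInl_inj, sumInr_inj, sumInl_ne, sumInr_ne]
  · rintro m _ _ (⟨x, y, h, rfl, rfl⟩ | ⟨x, y, h, rfl, rfl⟩)
    · exact Or.inl ⟨_, _, h.smul _ _ _ _, rfl, rfl⟩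
    · exact Or.inr ⟨_, _, h.smul _ _ _ _, rfl, rfl⟩

/-- The orbit of `(x, y, z)` is `A`-free. -/
def TFree₃ (x : X) (y : Y) (z : Z) : Prop :=
  ∀ (h : H) (k : K) (a b c : A), (((1 : G), h), a) • x = x → ((h, k), b) • y = y →
    ((k, (1 : L)), c) • z = z → a * b * c = 1

theorem tfree₃_left {x : X} {y : Y} {z : Z} :
    (∃ h : TFree x y, TFree (X := X.tensor Y) (tmk x y h) z) ↔ TFree₃ x y z := by
  constructor
  · rintro ⟨h, h'⟩ l k a b c hx hy hz
    refine h' k (a * b) c ?_ hz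
    rw [smul_tmk, tmk_eq_iff]
    refine ⟨l, b, ?_, ?_⟩
    · rw [smul_smul]; rw [eq_comm] at hx; simpa [← Prod.one_eq_mk, mul_comm] using hx
    · rw [smul_smul]; rw [eq_comm] at hy; simpa using hy
  · intro h
    have h₀ : TFree x y := fun l a b hx hy => by
      have := h l 1 a b 1 hx hy (one_smul _ z)
      simpa using this
    refine ⟨h₀, fun k a c hxy hz => ?_⟩
    · rw [smul_tmk, tmk_eq_iff] at hxy
      obtain ⟨l, b, e₁, e₂⟩ := hxy
      rw [smul_smul, eq_comm] at e₁ e₂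
      have := h l k (b⁻¹ * a) b c (by simpa [Prod.one_eq_mk] using e₁) (by simpa using e₂) hz
      simpa [mul_comm, mul_assoc] using this

theorem tfree₃_right {x : X} {y : Y} {z : Z} :
    (∃ h : TFree y z, TFree (Y := Y.tensor Z) x (tmk y z h)) ↔ TFree₃ x y z := by
  constructor
  · rintro ⟨h, h'⟩ l k a b c hx hy hz
    rw [mul_assoc]
    refine h' l a (b * c) hx ?_
    rw [smul_tmk, tmk_eq_iff]
    refine ⟨k, c, ?_, ?_⟩
    · rw [smul_smul]; rw [eq_comm] at hy; simpa [mul_comm] using hy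
    · rw [smul_smul]; rw [eq_comm] at hz; simpa [← Prod.one_eq_mk] using hz
  · intro h
    have h₀ : TFree y z := fun k b c hy hz => by
      have := h 1 k 1 b c (one_smul _ x) hy hz
      simpa using this
    refine ⟨h₀, fun l a c hx hyz => ?_⟩
    · rw [smul_tmk, tmk_eq_iff] at hyz
      obtain ⟨k, b, e₁, e₂⟩ := hyz
      rw [smul_smul, eq_comm] at e₁ e₂
      have := h l k a (b⁻¹ * c) b hx (by simpa using e₁) (by simpa [Prod.one_eq_mk] using e₂)
      simpa [mul_comm, mul_assoc, mul_left_comm] using this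

theorem tensor_assoc (X : FiberedSet A (G × H)) (Y : FiberedSet A (H × K))
    (Z : FiberedSet A (K × L)) :
    Isomorphic ((X.tensor Y).tensor Z) (X.tensor (Y.tensor Z)) := by
  refine isomorphic_of_rel (fun s t => ∃ x y z, ∃ (h₁ : TFree x y)
    (h₂ : TFree (X := X.tensor Y) (tmk x y h₁) z) (h₃ : TFree y z)
    (h₄ : TFree (Y := Y.tensor Z) x (tmk y z h₃)),
    s = tmk (X := X.tensor Y) (tmk x y h₁) z h₂ ∧
    t = tmk (Y := Y.tensor Z) x (tmk y z h₃) h₄) ?_ ?_ ?_ ?_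
  · intro s
    obtain ⟨xy, z, h, rfl⟩ := exists_tmk s
    obtain ⟨x, y, h', rfl⟩ := exists_tmk xy
    obtain ⟨h₃, h₄⟩ := tfree₃_right.2 (tfree₃_left.1 ⟨h', h⟩)
    exact ⟨_, x, y, z, h', h, h₃, h₄, rfl, rfl⟩
  · intro t
    obtain ⟨x, yz, h, rfl⟩ := exists_tmk t
    obtain ⟨y, z, h', rfl⟩ := exists_tmk yz
    obtain ⟨h₃, h₄⟩ := tfree₃_left.2 (tfree₃_right.1 ⟨h', h⟩)
    exact ⟨_, x, y, z, h₃, h₄, h', h, rfl, rfl⟩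
  · rintro _ _ _ _ ⟨x, y, z, h₁, h₂, h₃, h₄, rfl, rfl⟩ ⟨x', y', z', h₁', h₂', h₃', h₄', rfl, rfl⟩
    have e₁ : tmk (X := X.tensor Y) (tmk x y h₁) z h₂ =
        tmk (X := X.tensor Y) (tmk x' y' h₁') z' h₂' ↔
        ∃ (h : H) (k : K) (a b : A), x' = (((1 : G), h), a⁻¹) • x ∧
          y' = ((h, k), a * b⁻¹) • y ∧ z' = ((k, (1 : L)), b) • z := by
      rw [tmk_eq_iff]
      constructor
      · rintro ⟨k, b, e, hz⟩
        rw [smul_tmk, eq_comm, tmk_eq_iff] at e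
        obtain ⟨h, a, hx, hy⟩ := e
        rw [smul_smul] at hx hy
        exact ⟨h, k, a * b, b, by simpa [mul_comm] using hx, by simpa using hy, hz⟩
      · rintro ⟨h, k, a, b, hx, hy, hz⟩
        refine ⟨k, b, ?_, hz⟩
        rw [smul_tmk, eq_comm, tmk_eq_iff]
        refine ⟨h, a * b⁻¹, ?_, ?_⟩
        · rw [smul_smul]; simpa using hx
        · rw [smul_smul]; simpa using hy
    have e₂ : tmk (Y := Y.tensor Z) x (tmk y z h₃) h₄ =
        tmk (Y := Y.tensor Z) x' (tmk y' z' h₃') h₄' ↔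
        ∃ (h : H) (k : K) (a b : A), x' = (((1 : G), h), a⁻¹) • x ∧
          y' = ((h, k), a * b⁻¹) • y ∧ z' = ((k, (1 : L)), b) • z := by
      rw [tmk_eq_iff]
      constructor
      · rintro ⟨h, a, hx, e⟩
        rw [smul_tmk, eq_comm, tmk_eq_iff] at e
        obtain ⟨k, b, hy, hz⟩ := e
        rw [smul_smul] at hy hz
        exact ⟨h, k, a, b, hx, by simpa [mul_comm] using hy, by simpa using hz⟩
      · rintro ⟨h, k, a, b, hx, hy, hz⟩
        refine ⟨h, a, hx, ?_⟩
        rw [smul_tmk, eq_comm, tmk_eq_iff]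
        refine ⟨k, b, ?_, ?_⟩
        · rw [smul_smul]; simpa [mul_comm] using hy
        · rw [smul_smul]; simpa using hz
    rw [e₁, e₂]
  · rintro ⟨⟨g, l⟩, a⟩ _ _ ⟨x, y, z, h₁, h₂, h₃, h₄, rfl, rfl⟩
    have f₁ := h₁.smul g (1 : K) a 1
    have f₃ := h₃.smul (1 : H) l 1 1
    have e₁ : ((((g, (1 : K)), a) : (G × K) × A) • tmk x y h₁ : X.tensor Y) = tmk _ _ f₁ := rfl
    have e₃ : ((((1 : H), l), (1 : A)) • tmk y z h₃ : Y.tensor Z) = tmk _ _ f₃ := rfl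
    have f₂ := h₂.smul g l a 1
    have f₄ := h₄.smul g l a 1
    have y₁ : (((1 : H), (1 : K)), (1 : A)) • y = y := one_smul _ y
    refine ⟨((g, (1 : H)), a) • x, y, (((1 : K), l), (1 : A)) • z, ?_, ?_, ?_, ?_, ?_, ?_⟩
    · simpa only [y₁] using f₁
    · simpa only [e₁, y₁] using f₂
    · simpa only [y₁] using f₃
    · simpa only [e₃, y₁] using f₄
    · rw [smul_tmk]; simp only [e₁, y₁]
    · rw [smul_tmk]; simp only [e₃, y₁]

end tensor

end FiberedSet
end Fibered
namespace Fibered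
namespace FiberedSet

variable {A G H K L : Type u} [CommGroup A] [Group G] [Group H] [Group K] [Group L]

section graph

variable [Finite G] [Finite H]

/-- The biset `(G × H) / (Γ, 1)` for the graph `Γ = {(g, f g)}` of a homomorphism `f : G → H`. -/
def graph (A : Type u) [CommGroup A] (f : G →* H) : FiberedSet A (G × H) :=
  trans (MonPair.triv f.graph)

/-- The base point of `graph A f`. -/
def gBase (f : G →* H) : graph A f := transBase _

theorem gBase_stab {f : G →* H} {g : G} {h : H} {a : A} :
    ((g, h), a) • (gBase f : graph A f) = gBase f ↔ f g = h ∧ a = 1 := by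
  refine (smul_transBase_eq_self_iff _ _).trans ?_
  constructor
  · rintro ⟨h₁, h₂⟩
    exact ⟨MonoidHom.mem_graph.1 h₁, h₂.trans inv_one⟩
  · rintro ⟨h₁, h₂⟩
    exact ⟨MonoidHom.mem_graph.2 h₁, h₂.trans inv_one.symm⟩

theorem exists_gBase (f : G →* H) (x : graph A f) :
    ∃ (h : H) (a : A), x = (((1 : G), h), a) • gBase f := by
  obtain ⟨⟨⟨g, h⟩, a⟩, rfl⟩ := exists_smul_transBase _ x
  refine ⟨h * (f g)⁻¹, a, ?_⟩
  have : ((g, f g), (1 : A)) • (gBase f : graph A f) = gBase f := gBase_stab.2 ⟨rfl, rfl⟩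
  change ((g, h), a) • gBase f = _
  conv_rhs => rw [← this, smul_smul]
  simp
  rfl

theorem tfree_gBase_left (f : G →* H) {Y : FiberedSet A (H × K)} (y : Y) :
    TFree (gBase f : graph A f) y := by
  intro h a b h₁ h₂
  obtain ⟨h₃, rfl⟩ := gBase_stab.1 h₁
  obtain rfl : h = 1 := by rw [← h₃, map_one]
  rw [one_mul]
  exact Y.free b y h₂

theorem exists_tmk_gBase (f : G →* H) {Y : FiberedSet A (H × K)} (t : (graph A f).tensor Y) :
    ∃ y, t = tmk (gBase f) y (tfree_gBase_left f y) := by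
  obtain ⟨x, y, h, rfl⟩ := exists_tmk t
  obtain ⟨k, a, rfl⟩ := exists_gBase f x
  refine ⟨((k⁻¹, (1 : K)), a) • y, tmk_eq_iff.2 ⟨k⁻¹, a, ?_, rfl⟩⟩
  rw [smul_smul]; simp [← Prod.one_eq_mk]

theorem one_tensor (Y : FiberedSet A (G × K)) :
    Isomorphic ((graph A (MonoidHom.id G)).tensor Y) Y := by
  refine isomorphic_of_rel (fun t y => t = tmk (gBase _) y (tfree_gBase_left _ y)) ?_ ?_ ?_ ?_
  · exact exists_tmk_gBase _
  · exact fun y => ⟨_, rfl⟩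
  · rintro _ _ y y' rfl rfl
    rw [tmk_eq_iff]
    constructor
    · rintro ⟨g, a, h₁, h₂⟩
      obtain ⟨e, e'⟩ := gBase_stab.1 h₁.symm
      obtain rfl : 1 = g := by simpa using e
      obtain rfl : a = 1 := by simpa using e'
      rw [h₂]; exact (one_smul _ y).symm
    · rintro rfl
      exact ⟨1, 1, by simp [← Prod.one_eq_mk], (one_smul _ y).symm⟩
  · rintro ⟨⟨g, k⟩, a⟩ _ y rfl
    rw [smul_tmk, eq_comm, tmk_eq_iff]
    have e : ∀ g : G, ((g, g), (1 : A)) • (gBase (MonoidHom.id G) : graph A _) = gBase _ :=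
      fun g => gBase_stab.2 ⟨rfl, rfl⟩
    refine ⟨g⁻¹, a⁻¹, ?_, ?_⟩
    · conv_lhs => rw [← e g⁻¹]
      rw [smul_smul]; simp
    · rw [smul_smul]; simp

theorem tensor_one (X : FiberedSet A (K × G)) :
    Isomorphic (X.tensor (graph A (MonoidHom.id G))) X := by
  have hf : ∀ x : X, TFree x (gBase (MonoidHom.id G) : graph A _) := by
    intro x h a b h₁ h₂
    obtain ⟨h₃, rfl⟩ := gBase_stab.1 h₂
    obtain rfl : h = 1 := h₃
    rw [mul_one]
    exact X.free a x h₁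
  have e : ∀ g : G, ((g, g), (1 : A)) • (gBase (MonoidHom.id G) : graph A _) = gBase _ :=
    fun g => gBase_stab.2 ⟨rfl, rfl⟩
  refine isomorphic_of_rel (fun t x => t = tmk x (gBase _) (hf x)) ?_ ?_ ?_ ?_
  · intro t
    obtain ⟨x, y, h, rfl⟩ := exists_tmk t
    obtain ⟨g, a, rfl⟩ := exists_gBase _ y
    refine ⟨(((1 : K), g), a) • x, tmk_eq_iff.2 ⟨g, a⁻¹, by simp, ?_⟩⟩
    conv_lhs => rw [← e g]
    rw [smul_smul]; simp
  · exact fun y => ⟨_, rfl⟩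
  · rintro _ _ x x' rfl rfl
    rw [tmk_eq_iff]
    constructor
    · rintro ⟨g, a, h₁, h₂⟩
      obtain ⟨e, rfl⟩ := gBase_stab.1 h₂.symm
      obtain rfl : g = 1 := e
      rw [h₁]; simp [← Prod.one_eq_mk]
    · rintro rfl
      exact ⟨1, 1, by simp [← Prod.one_eq_mk], (one_smul _ _).symm⟩
  · rintro ⟨⟨k, g⟩, a⟩ _ x rfl
    rw [smul_tmk, tmk_eq_iff]
    refine ⟨g, 1, ?_, ?_⟩
    · rw [smul_smul]; simp
    · conv_lhs => rw [← e g]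
      rw [smul_smul]; simp

theorem graph_tensor_graph [Finite K] (f : G →* H) (f' : H →* K) :
    Isomorphic ((graph A f).tensor (graph A f')) (graph A (f'.comp f)) := by
  have key := isomorphic_trans (X := (graph A f).tensor (graph A f'))
    (tmk (gBase f) (gBase f') (tfree_gBase_left f _)) (by
      intro t
      obtain ⟨y, rfl⟩ := exists_tmk_gBase f t
      obtain ⟨k, a, rfl⟩ := exists_gBase f' y
      refine ⟨((1, k), a), ?_⟩
      rw [smul_tmk, tmk_eq_iff]
      refine ⟨1, a⁻¹, by simp, ?_⟩
      rw [smul_smul]; simp)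
  rw [pair_tmk] at key
  have : ((graph A f).pair (gBase f)).star ((graph A f').pair (gBase f'))
      (tfree_gBase_left f _).starCompat = MonPair.triv (f'.comp f).graph := by
    refine MonPair.ext' ?_ fun g h₁ h₂ => ?_
    · ext ⟨g, k⟩
      constructor
      · rintro ⟨h, h₁, h₂⟩
        obtain ⟨a, h₁⟩ := mem_stab'.1 h₁
        obtain ⟨b, h₂⟩ := mem_stab'.1 h₂
        obtain ⟨rfl, -⟩ := gBase_stab.1 h₁
        exact (gBase_stab.1 h₂).1
      · intro h
        obtain rfl : f' (f g) = k := h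
        exact ⟨f g, mem_stab'.2 ⟨1, gBase_stab.2 ⟨rfl, rfl⟩⟩,
          mem_stab'.2 ⟨1, gBase_stab.2 ⟨rfl, rfl⟩⟩⟩
    · obtain ⟨g, k⟩ := g
      obtain ⟨h, e₁, e₂⟩ := id h₁
      rw [MonPair.star_char _ e₁ e₂]
      have a₁ := gBase_stab.1 ((stabChar_eq_iff _ _ ⟨_, e₁⟩ _).1 rfl)
      have a₂ := gBase_stab.1 ((stabChar_eq_iff _ _ ⟨_, e₂⟩ _).1 rfl)
      have b₁ := inv_eq_one.1 a₁.2
      have b₂ := inv_eq_one.1 a₂.2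
      exact (congrArg₂ (· * ·) b₁ b₂).trans (mul_one _)
  rw [this] at key
  exact key

end graph

/-- The sub-`A`-fibered `G`-set cut out by an invariant predicate. -/
def restrict (X : FiberedSet A G) (P : X → Prop) (hP : ∀ (m : G × A) x, P (m • x) ↔ P x) :
    FiberedSet A G where
  carrier := {x // P x}
  action :=
    { smul := fun m x => ⟨m • x.1, (hP m x.1).2 x.2⟩
      one_smul := fun x => Subtype.ext (one_smul _ x.1)
      mul_smul := fun m n x => Subtype.ext (mul_smul m n x.1) }
  free a x h := X.free a x.1 (congrArg Subtype.val h)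
  finite_orbits := by
    obtain ⟨T, hT, h⟩ := X.finite_orbits
    refine ⟨Subtype.val ⁻¹' T, hT.preimage Subtype.val_injective.injOn, ?_⟩
    rintro ⟨x, hx⟩
    obtain ⟨t, ht, a, rfl⟩ := h x
    exact ⟨⟨t, (hP _ _).1 hx⟩, ht, a, rfl⟩

theorem pair_restrict (X : FiberedSet A G) (P : X → Prop)
    (hP : ∀ (m : G × A) x, P (m • x) ↔ P x) (x : X.restrict P hP) :
    (X.restrict P hP).pair x = X.pair x.1 := by
  apply pair_eq_of
  · intro g hg
    obtain ⟨a, ha⟩ := mem_stab'.1 hg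
    exact mem_stab'.2 ⟨a, congrArg Subtype.val ha⟩
  · intro g hg
    exact Subtype.ext ((X.stabChar_eq_iff x.1 ⟨g, hg⟩ _).1 rfl)

theorem isomorphic_restrict_sum (X : FiberedSet A G) (P : X → Prop)
    (hP : ∀ (m : G × A) x, P (m • x) ↔ P x) :
    Isomorphic ((X.restrict P hP).sum (X.restrict (fun x => ¬ P x) fun m x => not_congr (hP m x)))
      X := by
  classical
  refine ⟨Equiv.sumCompl P, ?_⟩
  rintro m (x | x) <;> rfl

theorem sum_congr {X X' Y Y' : FiberedSet A G} (hX : Isomorphic X X') (hY : Isomorphic Y Y') :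
    Isomorphic (X.sum Y) (X'.sum Y') := by
  obtain ⟨e, he⟩ := hX
  obtain ⟨f, hf⟩ := hY
  refine ⟨Equiv.sumCongr e f, ?_⟩
  rintro m (x | y)
  · exact congrArg Sum.inl (he m x)
  · exact congrArg Sum.inr (hf m y)

end FiberedSet

open FiberedSet

variable {A G H K L : Type u} [CommGroup A] [Group G] [Group H] [Group K] [Group L]

instance isoSetoid (A G : Type u) [CommGroup A] [Group G] : Setoid (FiberedSet A G) where
  r := Isomorphic
  iseqv := ⟨Isomorphic.refl, Isomorphic.symm, Isomorphic.trans⟩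

/-- Isomorphism classes of `A`-fibered `G`-sets. -/
def IsoClass (A G : Type u) [CommGroup A] [Group G] : Type (u + 1) := Quotient (isoSetoid A G)

/-- The isomorphism class of `X`. -/
def IsoClass.mk (X : FiberedSet A G) : IsoClass A G := Quotient.mk _ X

instance : Add (IsoClass A G) :=
  ⟨Quotient.map₂ FiberedSet.sum fun _ _ h _ _ h' => sum_congr h h'⟩

instance : Zero (IsoClass A G) := ⟨IsoClass.mk FiberedSet.empty⟩

/-- Isomorphism classes form a commutative monoid under disjoint union. -/
instance : AddCommMonoid (IsoClass A G) where
  nsmul := nsmulRec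
  add_assoc := by
    rintro ⟨X⟩ ⟨Y⟩ ⟨Z⟩
    exact Quotient.sound ⟨Equiv.sumAssoc _ _ _, by rintro m ((x | y) | z) <;> rfl⟩
  zero_add := by
    rintro ⟨X⟩
    exact Quotient.sound ⟨Equiv.emptySum PEmpty _, by rintro m (⟨⟨⟩⟩ | x); rfl⟩
  add_zero := by
    rintro ⟨X⟩
    exact Quotient.sound ⟨Equiv.sumEmpty _ PEmpty, by rintro m (x | ⟨⟨⟩⟩); rfl⟩
  add_comm := by
    rintro ⟨X⟩ ⟨Y⟩
    exact Quotient.sound ⟨Equiv.sumComm _ _, by rintro m (x | y) <;> rfl⟩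

theorem IsoClass.mk_add (X Y : FiberedSet A G) :
    IsoClass.mk X + IsoClass.mk Y = IsoClass.mk (X.sum Y) := rfl

theorem IsoClass.sound {X Y : FiberedSet A G} (h : Isomorphic X Y) :
    IsoClass.mk X = IsoClass.mk Y := Quotient.sound h

theorem IsoClass.ind {P : IsoClass A G → Prop} (h : ∀ X, P (IsoClass.mk X)) (x) : P x :=
  Quotient.ind h x

/-- The tensor product of isomorphism classes. -/
def IsoClass.tensor (x : IsoClass A (G × H)) (y : IsoClass A (H × K)) : IsoClass A (G × K) :=
  Quotient.map₂ FiberedSet.tensor (fun _ _ h _ _ h' => tensor_congr h h') x y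

/-- The tensor product of isomorphism classes as a biadditive map. -/
def IsoClass.tensorHom : IsoClass A (G × H) →+ IsoClass A (H × K) →+ IsoClass A (G × K) where
  toFun x :=
    { toFun := fun y => x.tensor y
      map_zero' := by
        revert x; rintro ⟨X⟩
        refine IsoClass.sound (isomorphic_of_rel (fun _ _ => False) ?_ nofun nofun nofun)
        intro t
        obtain ⟨x, y, h, rfl⟩ := exists_tmk t
        exact y.elim
      map_add' := by
        revert x; rintro ⟨X⟩ ⟨Y⟩ ⟨Y'⟩
        exact IsoClass.sound (tensor_sum X Y Y') }
  map_zero' := by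
    ext y
    revert y; rintro ⟨Y⟩
    refine IsoClass.sound (isomorphic_of_rel (fun _ _ => False) ?_ nofun nofun nofun)
    intro t
    obtain ⟨x, y, h, rfl⟩ := exists_tmk t
    exact x.elim
  map_add' := by
    rintro ⟨X⟩ ⟨X'⟩
    ext y
    revert y; rintro ⟨Y⟩
    exact IsoClass.sound (sum_tensor X X' Y)

/-- The Grothendieck group `B^A(G)` of `A`-fibered `G`-sets. -/
abbrev Burnside (A G : Type u) [CommGroup A] [Group G] : Type (u + 1) :=
  Algebra.GrothendieckAddGroup (IsoClass A G)

theorem lift_of {M : Type u} {N : Type v} [AddCommMonoid M] [AddCommGroup N] (f : M →+ N) (m : M) :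
    Algebra.GrothendieckAddGroup.lift f (Algebra.GrothendieckAddGroup.of m) = f m :=
  DFunLike.congr_fun (Algebra.GrothendieckAddGroup.lift.symm_apply_apply f) m

theorem groth_ext {M : Type u} {N : Type v} [AddCommMonoid M] [AddCommGroup N]
    {f g : Algebra.GrothendieckAddGroup M →+ N}
    (h : ∀ m, f (Algebra.GrothendieckAddGroup.of m) = g (Algebra.GrothendieckAddGroup.of m)) :
    f = g :=
  Algebra.GrothendieckAddGroup.lift.symm.injective (AddMonoidHom.ext h)

/-- The tensor product `B^A(G, H) × B^A(H, K) → B^A(G, K)`. -/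
noncomputable def Burnside.tensorHom :
    Burnside A (G × H) →+ Burnside A (H × K) →+ Burnside A (G × K) :=
  Algebra.GrothendieckAddGroup.lift
    { toFun := fun x => Algebra.GrothendieckAddGroup.lift
        (Algebra.GrothendieckAddGroup.of.comp (IsoClass.tensorHom x))
      map_zero' := groth_ext fun m => by
        rw [lift_of, map_zero, AddMonoidHom.comp_zero]; rfl
      map_add' := fun x y => groth_ext fun m => by
        rw [AddMonoidHom.add_apply, lift_of, lift_of, lift_of, map_add, AddMonoidHom.comp_add]
        rfl }

theorem Burnside.tensorHom_of (x : IsoClass A (G × H)) (y : IsoClass A (H × K)) :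
    Burnside.tensorHom (Algebra.GrothendieckAddGroup.of x) (Algebra.GrothendieckAddGroup.of y) =
      Algebra.GrothendieckAddGroup.of (x.tensor y) := by
  rw [Burnside.tensorHom, lift_of]
  exact lift_of _ y

variable (R : Type v) [CommRing R]

/-- `B^A_R(G) = R ⊗ B^A(G)`. -/
abbrev BurnsideR (R : Type v) [CommRing R] (A G : Type u) [CommGroup A] [Group G] :
    Type (max v (u + 1)) := R ⊗[ℤ] Burnside A G

/-- The class `[X] = 1 ⊗ [X]` in `B^A_R(G)`. -/
noncomputable def cls (X : FiberedSet A G) : BurnsideR R A G :=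
  1 ⊗ₜ[ℤ] Algebra.GrothendieckAddGroup.of (IsoClass.mk X)

variable {R}

theorem cls_congr {X Y : FiberedSet A G} (h : Isomorphic X Y) : cls R X = cls R Y := by
  rw [cls, cls, IsoClass.sound h]

theorem cls_sum (X Y : FiberedSet A G) : cls R (X.sum Y) = cls R X + cls R Y := by
  rw [cls, cls, cls, ← TensorProduct.tmul_add, ← map_add, IsoClass.mk_add]

theorem span_cls : Submodule.span R (Set.range (cls R : FiberedSet A G → _)) = ⊤ := by
  rw [eq_top_iff]
  rintro x -
  induction x using TensorProduct.induction_on with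
  | zero => exact Submodule.zero_mem _
  | add x y hx hy => exact Submodule.add_mem _ hx hy
  | tmul r b =>
    have key : ∀ x : IsoClass A G, r ⊗ₜ[ℤ] Algebra.GrothendieckAddGroup.of x ∈
        Submodule.span R (Set.range (cls R : FiberedSet A G → _)) := by
      rintro ⟨X⟩
      have : r ⊗ₜ[ℤ] Algebra.GrothendieckAddGroup.of (IsoClass.mk X) = r • cls R X := by
        rw [cls, TensorProduct.smul_tmul', smul_eq_mul, mul_one]
      exact this ▸ Submodule.smul_mem _ _ (Submodule.subset_span ⟨X, rfl⟩)
    induction b using AddLocalization.ind with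
    | _ p =>
    obtain ⟨x, y⟩ := p
    have : (AddLocalization.mk x y : Burnside A G) =
        Algebra.GrothendieckAddGroup.of x - Algebra.GrothendieckAddGroup.of y.1 := by
      rw [eq_sub_iff_add_eq]
      change AddLocalization.mk x y + AddLocalization.mk y.1 0 = AddLocalization.mk x 0
      rw [AddLocalization.mk_add, AddLocalization.mk_eq_mk_iff, AddLocalization.r_iff_exists]
      exact ⟨0, by simp [add_comm]⟩
    rw [this, TensorProduct.tmul_sub]
    exact Submodule.sub_mem _ (key _) (key _)

theorem mem_span_cls (x : BurnsideR R A G) :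
    x ∈ Submodule.span R (Set.range (cls R : FiberedSet A G → BurnsideR R A G)) := by
  rw [span_cls]; exact Submodule.mem_top

/-- The composition `B^A_R(G, H) × B^A_R(H, K) → B^A_R(G, K)` induced by `⊗_{AH}`. -/
noncomputable def BurnsideR.comp :
    BurnsideR R A (G × H) →ₗ[R] BurnsideR R A (H × K) →ₗ[R] BurnsideR R A (G × K) :=
  LinearMap.mk₂ R
    (fun x y => TensorProduct.map₂ (LinearMap.mul ℤ R)
      (LinearMap.mk₂ ℤ (fun b c => Burnside.tensorHom b c) (fun b b' c => by simp)
        (fun n b c => by simp) (fun b c c' => by simp) (fun n b c => by simp)) x y)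
    (fun x x' y => by simp)
    (fun r x y => by
      induction x using TensorProduct.induction_on with
      | zero => simp
      | add x x' hx hx' => simp [smul_add, hx, hx']
      | tmul s b =>
        induction y using TensorProduct.induction_on with
        | zero => simp
        | add y y' hy hy' => simp only [smul_add, map_add, hy, hy']
        | tmul t c => simp [TensorProduct.smul_tmul', mul_assoc])
    (fun x y y' => by simp)
    (fun r x y => by
      induction x using TensorProduct.induction_on with
      | zero => simp
      | add x x' hx hx' => simp [smul_add, hx, hx']
      | tmul s b =>
        induction y using TensorProduct.induction_on with
        | zero => simp
        | add y y' hy hy' => simp only [smul_add, map_add, hy, hy']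
        | tmul t c => simp [TensorProduct.smul_tmul', mul_left_comm])

theorem comp_cls (X : FiberedSet A (G × H)) (Y : FiberedSet A (H × K)) :
    BurnsideR.comp (cls R X) (cls R Y) = cls R (X.tensor Y) := by
  rw [BurnsideR.comp, LinearMap.mk₂_apply, cls, cls, TensorProduct.map₂_apply_tmul, TensorProduct.map_tmul,
    LinearMap.mk₂_apply, Burnside.tensorHom_of, LinearMap.mul_apply', mul_one]
  rfl

theorem comp_assoc (x : BurnsideR R A (G × H)) (y : BurnsideR R A (H × K))
    (z : BurnsideR R A (K × L)) :
    BurnsideR.comp (BurnsideR.comp x y) z = BurnsideR.comp x (BurnsideR.comp y z) := by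
  have hx := mem_span_cls x
  have hy := mem_span_cls y
  have hz := mem_span_cls z
  induction hx using Submodule.span_induction with
  | zero => simp
  | add x x' _ _ h h' => simp [h, h']
  | smul r x _ h => simp [h]
  | mem x hx =>
  obtain ⟨X, rfl⟩ := hx
  induction hy using Submodule.span_induction with
  | zero => simp
  | add x x' _ _ h h' => simp [h, h']
  | smul r x _ h => simp [h]
  | mem y hy =>
  obtain ⟨Y, rfl⟩ := hy
  induction hz using Submodule.span_induction with
  | zero => simp
  | add x x' _ _ h h' => simp [h, h']
  | smul r x _ h => simp [h]
  | mem z hz =>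
  obtain ⟨Z, rfl⟩ := hz
  simp only [comp_cls]
  exact cls_congr (tensor_assoc X Y Z)

theorem one_comp [Finite G] (x : BurnsideR R A (G × K)) :
    BurnsideR.comp (cls R (graph A (MonoidHom.id G))) x = x := by
  have hx := mem_span_cls x
  induction hx using Submodule.span_induction with
  | zero => simp
  | add x x' _ _ h h' => simp [h, h']
  | smul r x _ h => simp [h]
  | mem x hx =>
  obtain ⟨X, rfl⟩ := hx
  rw [comp_cls]
  exact cls_congr (one_tensor X)

theorem comp_one [Finite G] (x : BurnsideR R A (K × G)) :
    BurnsideR.comp x (cls R (graph A (MonoidHom.id G))) = x := by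
  have hx := mem_span_cls x
  induction hx using Submodule.span_induction with
  | zero => simp
  | add x x' _ _ h h' => simp [h, h']
  | smul r x _ h => simp [h]
  | mem x hx =>
  obtain ⟨X, rfl⟩ := hx
  rw [comp_cls]
  exact cls_congr (tensor_one X)

/-- If all stabilizing pairs of `X` lie in `S`, then `[X]` is a sum of classes of transitive
`A`-fibered sets with pairs in `S`. -/
theorem cls_mem_span [Finite G] (S : Set (MonPair A G)) (X : FiberedSet A G)
    (hX : ∀ x, X.pair x ∈ S) :
    cls R X ∈ Submodule.span R {y | ∃ p ∈ S, y = cls R (FiberedSet.trans p)} := by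
  classical
  have key : ∀ (n : ℕ) (X : FiberedSet A G) (T : Finset X), T.card = n →
      (∀ x, ∃ t ∈ T, ∃ a : A, x = ((1 : G), a) • t) → (∀ x, X.pair x ∈ S) →
      cls R X ∈ Submodule.span R {y | ∃ p ∈ S, y = cls R (FiberedSet.trans p)} := by
    intro n
    induction n using Nat.strong_induction_on with
    | _ n ih =>
    intro X T hT hc hX
    obtain rfl | ⟨t, ht⟩ := T.eq_empty_or_nonempty
    · have : Isomorphic (X.sum X) X :=
        isomorphic_of_rel (fun _ _ => False)
          (fun z => by obtain ⟨x, -⟩ | ⟨x, -⟩ := sum_cases z <;> simpa using hc x)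
          (fun x => by simpa using hc x) nofun nofun
      have := cls_congr (R := R) this
      rw [cls_sum, add_eq_left] at this
      rw [this]; exact Submodule.zero_mem _
    · have hP : ∀ (m : G × A) x, (∃ n : G × A, m • x = n • t) ↔ ∃ n : G × A, x = n • t := by
        refine fun m x => ⟨fun ⟨n, hn⟩ => ⟨m⁻¹ * n, ?_⟩, fun ⟨n, hn⟩ => ⟨m * n, ?_⟩⟩
        · rw [mul_smul, ← hn, inv_smul_smul]
        · rw [mul_smul, hn]
      rw [← cls_congr (isomorphic_restrict_sum X (fun x => ∃ n : G × A, x = n • t) hP), cls_sum]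
      refine Submodule.add_mem _ (Submodule.subset_span ⟨X.pair t, hX t, ?_⟩) ?_
      · refine cls_congr ?_
        have := isomorphic_trans (X := X.restrict (fun x => ∃ n : G × A, x = n • t) hP)
          ⟨t, 1, (one_smul _ t).symm⟩ (fun y => by
            obtain ⟨y, n, rfl⟩ := y
            exact ⟨n, rfl⟩)
        have e := pair_restrict X (fun x => ∃ n : G × A, x = n • t) hP ⟨t, 1, (one_smul _ t).symm⟩
        rw [e] at this
        exact this
      · refine ih _ ?_ _ (T.subtype fun x => ¬ ∃ n : G × A, x = n • t) rfl ?_ ?_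
        · refine lt_of_eq_of_lt (Finset.card_subtype _ _) ?_
          rw [← hT]
          exact Finset.card_lt_card (Finset.filter_ssubset.2 ⟨t, ht, fun h =>
            h ⟨1, (one_smul _ t).symm⟩⟩)
        · rintro ⟨x, hx⟩
          obtain ⟨s, hs, a, rfl⟩ := hc x
          exact ⟨⟨s, fun h => hx ((hP _ _).2 h)⟩, Finset.mem_subtype.2 hs, a, rfl⟩
        · intro x
          rw [pair_restrict]
          exact hX _
  obtain ⟨T, hT, h⟩ := X.finite_orbits
  exact key _ X hT.toFinset rfl (by simpa using h) hX

end Fibered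
namespace Fibered

open FiberedSet

/-- A class `𝒢` of finite groups (the predicate `mem`) and a family of sets
`S(G, H) ⊆ M(G × H)` for `G, H ∈ 𝒢`, satisfying the axioms (i)-(iv), (vi), (vii), (viii).
A subgroup of a subgroup `K ≤ G` is regarded as a subgroup of `G`; axiom (vi) for a group of
the form `K ≤ G` is therefore written out for subgroups `H ≤ K` of `G`. -/
structure FiberedData (A : Type u) [CommGroup A] where
  mem : ∀ (G : Type u) [Group G] [Finite G], Prop
  S : ∀ (G H : Type u) [Group G] [Group H], Set (MonPair A (G × H))
  /-- Axiom (i): `(Δ(G), 1) ∈ S(G, G)`. -/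
  ax_one : ∀ (G : Type u) [Group G] [Finite G], mem G →
    MonPair.triv (MonoidHom.id G).graph ∈ S G G
  /-- Axiom (ii): `S(G, H)` is closed under `(G × H)`-conjugation. -/
  ax_conj : ∀ (G H : Type u) [Group G] [Group H] [Finite G] [Finite H], mem G → mem H →
    ∀ p ∈ S G H, ∀ x : G × H, p.conj x ∈ S G H
  /-- Axiom (iii): closure under `*`. -/
  ax_star : ∀ (G H K : Type u) [Group G] [Group H] [Group K] [Finite G] [Finite H] [Finite K],
    mem G → mem H → mem K → ∀ p ∈ S G H, ∀ q ∈ S H K, ∀ hc : MonPair.StarCompat p q,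
      p.star q hc ∈ S G K
  /-- Axiom (iv): `D * K ∈ 𝒢` and `(D, φ) * (Δ(K), 1) ∈ S(D * K, K)` for `K ≤ H`, `K ∈ 𝒢`. -/
  ax_four : ∀ (G H : Type u) [Group G] [Group H] [Finite G] [Finite H], mem G → mem H →
    ∀ p ∈ S G H, ∀ K : Subgroup H, mem K →
      mem (MonPair.starRight p.sub K) ∧
        p.restr (MonPair.starRight p.sub K) K ∈ S (MonPair.starRight p.sub K) K
  /-- Axiom (vi): `(Δ(H), 1) ∈ S(H, G)` for `H ≤ G`, `H ∈ 𝒢`. -/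
  ax_res : ∀ (G : Type u) [Group G] [Finite G], mem G → ∀ H : Subgroup G, mem H →
    MonPair.triv H.subtype.graph ∈ S H G ∧
      ∀ K : Subgroup G, mem K → ∀ h : H ≤ K, MonPair.triv (Subgroup.inclusion h).graph ∈ S H K
  /-- Axiom (vii): `p₂(D) ∈ 𝒢`, and `D * K ∈ 𝒢` and `(D, φ) * (Δ(K), 1) ∈ S(D * K, K)` for
  `K ≤ p₂(D)`, `K ∈ 𝒢`. -/
  ax_seven : ∀ (G H : Type u) [Group G] [Group H] [Finite G] [Finite H], mem G → mem H →
    ∀ p ∈ S G H, mem (p.sub.map (MonoidHom.snd G H)) ∧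
      ∀ K : Subgroup H, mem K → K ≤ p.sub.map (MonoidHom.snd G H) →
        mem (MonPair.starRight p.sub K) ∧
          p.restr (MonPair.starRight p.sub K) K ∈ S (MonPair.starRight p.sub K) K
  /-- Axiom (viii): `p₁(D) ∈ 𝒢`, and `K * D ∈ 𝒢` and `(Δ(K), 1) * (D, φ) ∈ S(K, K * D)` for
  `K ≤ p₁(D)`, `K ∈ 𝒢`. -/
  ax_eight : ∀ (G H : Type u) [Group G] [Group H] [Finite G] [Finite H], mem G → mem H →
    ∀ p ∈ S G H, mem (p.sub.map (MonoidHom.fst G H)) ∧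
      ∀ K : Subgroup G, mem K → K ≤ p.sub.map (MonoidHom.fst G H) →
        mem (MonPair.starLeft K p.sub) ∧
          p.restr K (MonPair.starLeft K p.sub) ∈ S K (MonPair.starLeft K p.sub)

namespace FiberedData

variable {A : Type u} [CommGroup A] (𝓓 : FiberedData A) (R : Type v) [CommRing R]

/-- `R ⊗ ⟨[(G × H)/(U, φ)] : (U, φ) ∈ S(G, H)⟩ ⊆ B^A_R(G, H)`. -/
noncomputable def homS (G H : Type u) [Group G] [Group H] [Finite G] [Finite H] :
    Submodule R (BurnsideR R A (G × H)) :=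
  Submodule.span R {y | ∃ p ∈ 𝓓.S G H, y = cls R (FiberedSet.trans p)}

/-- The objects of the category `𝒟 = C^A(𝒢, S)`: the groups in `𝒢`. -/
structure Obj (R : Type v) [CommRing R] : Type (u + 1) where
  carrier : Type u
  [group : Group carrier]
  [finite : Finite carrier]
  mem : 𝓓.mem carrier

attribute [instance] Obj.group Obj.finite

variable {𝓓 R}

theorem cls_mem_homS {G H : Type u} [Group G] [Group H] [Finite G] [Finite H]
    {p : MonPair A (G × H)} (h : p ∈ 𝓓.S G H) : cls R (FiberedSet.trans p) ∈ 𝓓.homS R G H :=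
  Submodule.subset_span ⟨p, h, rfl⟩

theorem comp_mem {G H K : Type u} [Group G] [Group H] [Group K] [Finite G] [Finite H] [Finite K]
    (hG : 𝓓.mem G) (hH : 𝓓.mem H) (hK : 𝓓.mem K) {x : BurnsideR R A (G × H)}
    {y : BurnsideR R A (H × K)} (hx : x ∈ 𝓓.homS R G H) (hy : y ∈ 𝓓.homS R H K) :
    BurnsideR.comp x y ∈ 𝓓.homS R G K := by
  induction hx using Submodule.span_induction with
  | zero => simp
  | add x x' _ _ h h' => simpa using Submodule.add_mem _ h h'
  | smul r x _ h => simpa using Submodule.smul_mem _ r h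
  | mem x hx =>
  obtain ⟨p, hp, rfl⟩ := hx
  induction hy using Submodule.span_induction with
  | zero => simp
  | add x x' _ _ h h' => simpa using Submodule.add_mem _ h h'
  | smul r x _ h => simpa using Submodule.smul_mem _ r h
  | mem y hy =>
  obtain ⟨q, hq, rfl⟩ := hy
  rw [comp_cls]
  refine cls_mem_span _ _ fun t => ?_
  obtain ⟨s, t, h, rfl⟩ := exists_tmk t
  obtain ⟨m, rfl⟩ := exists_smul_transBase _ s
  obtain ⟨n, rfl⟩ := exists_smul_transBase _ t
  rw [pair_tmk]
  have hp' : (FiberedSet.trans p).pair (m • transBase p) ∈ 𝓓.S G H := by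
    rw [pair_smul, pair_transBase]
    exact 𝓓.ax_conj G H hG hH p hp _
  have hq' : (FiberedSet.trans q).pair (n • transBase q) ∈ 𝓓.S H K := by
    rw [pair_smul, pair_transBase]
    exact 𝓓.ax_conj H K hH hK q hq _
  exact 𝓓.ax_star G H K hG hH hK _ hp' _ hq' _

/-- The category `𝒟`, with `Hom(H, G) ⊆ B^A_R(G, H)` and composition given by `⊗_{AH}`. -/
noncomputable instance : Category (𝓓.Obj R) where
  Hom X Y := 𝓓.homS R Y.carrier X.carrier
  id X := ⟨cls R (graph A (MonoidHom.id X.carrier)), cls_mem_homS (𝓓.ax_one _ X.mem)⟩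
  comp {X Y Z} f g := ⟨BurnsideR.comp g.1 f.1, comp_mem Z.mem Y.mem X.mem g.2 f.2⟩
  id_comp f := Subtype.ext (comp_one f.1)
  comp_id f := Subtype.ext (one_comp f.1)
  assoc f g h := Subtype.ext (comp_assoc h.1 g.1 f.1).symm

noncomputable instance : Preadditive (𝓓.Obj R) where
  homGroup X Y := inferInstanceAs (AddCommGroup (𝓓.homS R Y.carrier X.carrier))
  add_comp _ _ _ f f' g := Subtype.ext (map_add (BurnsideR.comp g.1) f.1 f'.1)
  comp_add _ _ _ f g g' := Subtype.ext (LinearMap.map_add₂ BurnsideR.comp g.1 g'.1 f.1)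

noncomputable instance : Linear R (𝓓.Obj R) where
  homModule X Y := inferInstanceAs (Module R (𝓓.homS R Y.carrier X.carrier))
  smul_comp _ _ _ r f g := Subtype.ext (map_smul (BurnsideR.comp g.1) r f.1)
  comp_smul _ _ _ f r g := Subtype.ext (LinearMap.map_smul₂ BurnsideR.comp r g.1 f.1)

theorem hom_ext {X Y : 𝓓.Obj R} {f g : X ⟶ Y} (h : f.1 = g.1) : f = g := Subtype.ext h

section subgroups

variable {G : Type u} [Group G] [Finite G]

variable (R) in
/-- A subgroup of `G` that lies in `𝒢`, as an object of `𝒟`. -/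
def ob (H : Subgroup G) (h : 𝓓.mem H) : 𝓓.Obj R := ⟨H, h⟩

/-- Restriction `Res^K_L = [(L × K)/(Δ(L), 1)]`, for `L ≤ K ≤ G`. -/
noncomputable def res (hG : 𝓓.mem G) {L K : Subgroup G} (hL : 𝓓.mem L) (hK : 𝓓.mem K)
    (h : L ≤ K) : ob R K hK ⟶ ob R L hL :=
  ⟨cls R (graph A (Subgroup.inclusion h)), cls_mem_homS ((𝓓.ax_res G hG L hL).2 K hK h)⟩

theorem conj_mem (hG : 𝓓.mem G) (g : G) {H : Subgroup G} (hH : 𝓓.mem H) :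
    𝓓.mem (MonPair.conjSub g H) ∧
    MonPair.triv (MonPair.conjHom g (H := H) (K := MonPair.conjSub g H)
      fun _ h => MonPair.mem_conjSub.1 h).graph ∈ 𝓓.S (MonPair.conjSub g H) H := by
  have h₁ := 𝓓.ax_conj G G hG hG _ (𝓓.ax_one G hG) (g, 1)
  have h₂ := 𝓓.ax_four G G hG hG _ h₁ H hH
  have hm : ∀ x y : G, (x, y) ∈ ((MonPair.triv (A := A) (MonoidHom.id G).graph).conj (g, 1)).sub ↔
      g⁻¹ * x * g = y := by
    intro x y
    refine MonPair.mem_conjSub.trans ?_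
    refine MonoidHom.mem_graph.trans ?_
    simp
  have e : MonPair.starRight ((MonPair.triv (A := A) (MonoidHom.id G).graph).conj (g, 1)).sub H =
      MonPair.conjSub g H := by
    ext x
    rw [MonPair.mem_conjSub]
    constructor
    · rintro ⟨⟨x, y⟩, ⟨h, h'⟩, rfl⟩
      have := (hm x y).1 h
      change g⁻¹ * x * g ∈ H
      rw [this]
      exact h'
    · intro h
      exact ⟨(x, g⁻¹ * x * g), ⟨(hm _ _).2 rfl, h⟩, rfl⟩
  rw [e] at h₂
  refine ⟨h₂.1, ?_⟩
  convert h₂.2 using 1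
  refine MonPair.ext' ?_ fun _ _ _ => rfl
  ext ⟨x, y⟩
  refine MonoidHom.mem_graph.trans ?_
  refine Iff.trans ?_ (hm x y).symm
  exact Subtype.ext_iff

/-- Conjugation `iso(c_g) = [(ᵍH × H)/({(c_g h, h)}, 1)] : H → ᵍH`, with `K = ᵍH`; the graph is
written as `{(k, g⁻¹ k g) : k ∈ K}`. -/
noncomputable def conj (hG : 𝓓.mem G) (g : G) {H K : Subgroup G} (hH : 𝓓.mem H) (hK : 𝓓.mem K)
    (e : K = MonPair.conjSub g H) : ob R H hH ⟶ ob R K hK :=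
  ⟨cls R (graph A (MonPair.conjHom g fun _ h => MonPair.mem_conjSub.1 (e ▸ h))),
    cls_mem_homS (by subst e; exact (conj_mem hG g hH).2)⟩

variable (hG : 𝓓.mem G)

theorem graph_comp_graph {H K L : Subgroup G} (f : H →* K) (f' : K →* L) :
    BurnsideR.comp (cls R (graph A f)) (cls R (graph A f')) = cls R (graph A (f'.comp f)) := by
  rw [comp_cls]; exact cls_congr (graph_tensor_graph f f')

theorem eqToHom_eq_res {H K : Subgroup G} (hH : 𝓓.mem H) (hK : 𝓓.mem K) (e : H = K) :
    eqToHom (by subst e; rfl : ob R H hH = ob R K hK) = res hG hK hH e.ge := by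
  subst e
  rfl

theorem res_res {H K L : Subgroup G} (hH : 𝓓.mem H) (hK : 𝓓.mem K) (hL : 𝓓.mem L) (h : L ≤ K)
    (h' : K ≤ H) : res (R := R) hG hK hH h' ≫ res hG hL hK h = res hG hL hH (h.trans h') :=
  hom_ext (graph_comp_graph _ _)

theorem conj_conj {H K L : Subgroup G} (hH : 𝓓.mem H) (hK : 𝓓.mem K) (hL : 𝓓.mem L) (g k : G)
    (e : K = MonPair.conjSub g H) (e' : L = MonPair.conjSub k K)
    (e'' : L = MonPair.conjSub (k * g) H) :
    conj (R := R) hG g hH hK e ≫ conj hG k hK hL e' = conj hG (k * g) hH hL e'' := by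
  refine hom_ext ((graph_comp_graph _ _).trans ?_)
  refine congrArg (fun f => cls R (graph A f)) ?_
  ext x
  simp [MonPair.conjHom, mul_assoc]

theorem res_conj {H K L M : Subgroup G} (hH : 𝓓.mem H) (hK : 𝓓.mem K) (hL : 𝓓.mem L)
    (hM : 𝓓.mem M) (g : G) (h : K ≤ H) (e : L = MonPair.conjSub g K) (h' : L ≤ M)
    (e' : M = MonPair.conjSub g H) :
    res (R := R) hG hK hH h ≫ conj hG g hK hL e = conj hG g hH hM e' ≫ res hG hL hM h' := by
  refine hom_ext ((graph_comp_graph _ _).trans (Eq.trans ?_ (graph_comp_graph _ _).symm))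
  refine congrArg (fun f => cls R (graph A f)) ?_
  ext x
  simp [MonPair.conjHom]

/-- Conjugation by an element of `H` is the identity on `H`. -/
theorem conj_self {H K : Subgroup G} (hH : 𝓓.mem H) (hK : 𝓓.mem K) (g : G) (hg : g ∈ H)
    (e : K = MonPair.conjSub g H) (e' : K = H) :
    conj (R := R) hG g hH hK e = res hG hK hH e'.le := by
  subst e'
  refine hom_ext (cls_congr (R := R) ?_)
  have h := isomorphic_trans (X := graph A (Subgroup.inclusion (le_refl K)))
    ((((⟨g, hg⟩ : K), (1 : K)), (1 : A)) • gBase _) (fun y => by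
      obtain ⟨m, rfl⟩ := exists_smul_transBase _ y
      exact ⟨m * ((((⟨g, hg⟩ : K), (1 : K)), (1 : A)))⁻¹, by rw [smul_smul, inv_mul_cancel_right]; rfl⟩)
  refine Isomorphic.trans ?_ h.symm
  rw [pair_smul]
  have : ((graph A (Subgroup.inclusion (le_refl K))).pair (gBase _)).conj ((⟨g, hg⟩ : K), (1 : K)) =
      MonPair.triv (MonPair.conjHom g (H := K) (K := K)
        fun _ h => MonPair.mem_conjSub.1 (e ▸ h)).graph := by
    rw [show (graph A (Subgroup.inclusion (le_refl K))).pair (gBase _) = _ from pair_transBase _]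
    refine MonPair.ext' ?_ fun _ _ _ => rfl
    ext ⟨x, y⟩
    refine MonPair.mem_conjSub.trans ?_
    refine MonoidHom.mem_graph.trans (Iff.trans ?_ MonoidHom.mem_graph.symm)
    rw [Subtype.ext_iff, Subtype.ext_iff]
    simp [MonPair.conjHom]
  rw [this]
  exact Isomorphic.refl _

end subgroups

end FiberedData

end Fibered
namespace Fibered

open FiberedSet

namespace FiberedData

variable {A : Type u} [CommGroup A] {𝓓 : FiberedData A} {R : Type v} [CommRing R]
  {G : Type u} [Group G] [Finite G] (hG : 𝓓.mem G) (F : 𝓓.Obj R ⥤ ModuleCat.{w} R)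

/-- `F(Res^K_L) : F(K) → F(L)` for `L ≤ K ≤ G`. -/
noncomputable def FRes {L K : Subgroup G} (hL : 𝓓.mem L) (hK : 𝓓.mem K) (h : L ≤ K) :
    F.obj (ob R K hK) →ₗ[R] F.obj (ob R L hL) :=
  (F.map (res hG hL hK h)).hom

/-- `F(iso(c_g)) : F(H) → F(ᵍH)`, written `x ↦ ᵍx`. -/
noncomputable def FConj (g : G) {H K : Subgroup G} (hH : 𝓓.mem H) (hK : 𝓓.mem K)
    (e : K = MonPair.conjSub g H) : F.obj (ob R H hH) →ₗ[R] F.obj (ob R K hK) :=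
  (F.map (conj hG g hH hK e)).hom

/-- The identification `F(H) = F(K)` for equal subgroups `H = K`. -/
noncomputable def FEq {H K : Subgroup G} (hH : 𝓓.mem H) (hK : 𝓓.mem K) (e : H = K) :
    F.obj (ob R H hH) →ₗ[R] F.obj (ob R K hK) :=
  (F.map (eqToHom (by subst e; rfl))).hom

section lemmas

variable {H K L M : Subgroup G} (hH : 𝓓.mem H) (hK : 𝓓.mem K) (hL : 𝓓.mem L) (hM : 𝓓.mem M)

theorem FEq_eq (e : H = K) : FEq F hH hK e = FRes hG F hK hH e.ge := by
  rw [FEq, FRes, ← eqToHom_eq_res hG hH hK e]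

theorem FRes_self (x : F.obj (ob R H hH)) : FRes hG F hH hH le_rfl x = x := by
  rw [← FEq_eq hG F hH hH rfl, FEq]
  simp

theorem FRes_FRes (h : L ≤ K) (h' : K ≤ H) (x : F.obj (ob R H hH)) :
    FRes hG F hL hK h (FRes hG F hK hH h' x) = FRes hG F hL hH (h.trans h') x := by
  simp only [FRes, ← res_res hG hH hK hL h h', F.map_comp]
  rfl

theorem FConj_FConj (g k : G) (e : K = MonPair.conjSub g H) (e' : L = MonPair.conjSub k K)
    (e'' : L = MonPair.conjSub (k * g) H) (x : F.obj (ob R H hH)) :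
    FConj hG F k hK hL e' (FConj hG F g hH hK e x) = FConj hG F (k * g) hH hL e'' x := by
  simp only [FConj, ← conj_conj hG hH hK hL g k e e' e'', F.map_comp]
  rfl

theorem FConj_FRes (g : G) (h : K ≤ H) (e : L = MonPair.conjSub g K) (h' : L ≤ M)
    (e' : M = MonPair.conjSub g H) (x : F.obj (ob R H hH)) :
    FConj hG F g hK hL e (FRes hG F hK hH h x) = FRes hG F hL hM h' (FConj hG F g hH hM e' x) := by
  have := congrArg F.map (res_conj hG hH hK hL hM g h e h' e')
  rw [F.map_comp, F.map_comp] at this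
  exact congrArg (fun f => f.hom x) this

theorem FConj_self (g : G) (hg : g ∈ H) (e : K = MonPair.conjSub g H) (e' : K = H)
    (x : F.obj (ob R H hH)) : FConj hG F g hH hK e x = FRes hG F hK hH e'.le x := by
  simp only [FConj, FRes, conj_self hG hH hK g hg e e']

end lemmas

/-- The `R`-module of `(G, A)`-invariant sections of `F` over `X`: the functions `s` with
`s(x) ∈ F(G_x)` and `s(g a x) = ᵍs(x)`. -/
noncomputable def sections (X : FiberedSet A G) (hX : ∀ x, 𝓓.mem (X.stab x)) :
    Submodule R (∀ x : X, F.obj (ob R (X.stab x) (hX x))) where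
  carrier := {s | ∀ (g : G) (a : A) (x : X),
    FConj hG F g (hX x) (hX ((g, a) • x)) (X.stab_smul x g a) (s x) = s ((g, a) • x)}
  zero_mem' g a x := map_zero _
  add_mem' hs ht g a x := (map_add _ _ _).trans (congrArg₂ (· + ·) (hs g a x) (ht g a x))
  smul_mem' r s hs g a x := (map_smul _ _ _).trans (congrArg (r • ·) (hs g a x))

/-- The objects `(X, s)` of `Γ_F(G)`. -/
structure Gamma where
  X : FiberedSet A G
  mem : ∀ x, 𝓓.mem (X.stab x)
  s : sections hG F X mem

namespace Gamma

variable {hG F}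

/-- Isomorphism in `Γ_F(G)`: an isomorphism `α : X → Y` of `A`-fibered `G`-sets with
`G_x = G_{α(x)}` and `t(α(x)) = s(x)`. -/
def Isomorphic (P Q : Gamma hG F) : Prop :=
  ∃ e : P.X ≃ Q.X, (∀ (m : G × A) (x : P.X), e (m • x) = m • e x) ∧
    ∀ x, ∃ h : P.X.stab x = Q.X.stab (e x),
      Q.s.1 (e x) = FEq F (P.mem x) (Q.mem (e x)) h (P.s.1 x)

theorem Isomorphic.refl (P : Gamma hG F) : Isomorphic P P :=
  ⟨Equiv.refl _, fun _ _ => rfl, fun x => ⟨rfl, by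
    change P.s.1 x = FEq F (P.mem x) (P.mem x) rfl (P.s.1 x)
    rw [FEq_eq hG]; exact (FRes_self hG F _ _).symm⟩⟩

theorem Isomorphic.symm {P Q : Gamma hG F} : Isomorphic P Q → Isomorphic Q P := by
  rintro ⟨e, he, hs⟩
  refine ⟨e.symm, fun m x => e.injective (by rw [he]; simp), fun y => ?_⟩
  obtain ⟨x, rfl⟩ := e.surjective y
  have key : ∀ z, z = x → ∃ h : Q.X.stab (e x) = P.X.stab z,
      P.s.1 z = FEq F (Q.mem (e x)) (P.mem z) h (Q.s.1 (e x)) := by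
    rintro z rfl
    obtain ⟨h, h'⟩ := hs z
    refine ⟨h.symm, ?_⟩
    rw [h', FEq_eq hG, FEq_eq hG, FRes_FRes, FRes_self]
  exact key _ (e.symm_apply_apply x)

theorem Isomorphic.trans {P Q W : Gamma hG F} :
    Isomorphic P Q → Isomorphic Q W → Isomorphic P W := by
  rintro ⟨e, he, hs⟩ ⟨f, hf, ht⟩
  refine ⟨e.trans f, fun m x => by simp [he, hf], fun x => ?_⟩
  obtain ⟨h, h'⟩ := hs x
  obtain ⟨k, k'⟩ := ht (e x)
  refine ⟨h.trans k, ?_⟩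
  change W.s.1 (f (e x)) = FEq F (P.mem x) (W.mem (f (e x))) (h.trans k) (P.s.1 x)
  rw [k', h', FEq_eq hG, FEq_eq hG, FEq_eq hG, FRes_FRes]

variable (hG F) in
instance setoid : Setoid (Gamma hG F) where
  r := Isomorphic
  iseqv := ⟨Isomorphic.refl, Isomorphic.symm, Isomorphic.trans⟩

end Gamma

theorem stab_sumInl {X Y : FiberedSet A G} (x : X) : (X.sum Y).stab (sumInl x) = X.stab x := by
  ext g
  simp only [mem_stab, smul_sumInl, sumInl_inj]

theorem stab_sumInr {X Y : FiberedSet A G} (y : Y) : (X.sum Y).stab (sumInr y) = Y.stab y := by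
  ext g
  simp only [mem_stab, smul_sumInr, sumInr_inj]

theorem pair_sumInl {X Y : FiberedSet A G} (x : X) : (X.sum Y).pair (sumInl x) = X.pair x :=
  pair_eq_of (fun g hg => (stab_sumInl x).le hg) fun g h => by
    rw [smul_sumInl, sumInl_inj]; exact (X.stabChar_eq_iff x ⟨g, h⟩ _).1 rfl

theorem pair_sumInr {X Y : FiberedSet A G} (y : Y) : (X.sum Y).pair (sumInr y) = Y.pair y :=
  pair_eq_of (fun g hg => (stab_sumInr y).le hg) fun g h => by
    rw [smul_sumInr, sumInr_inj]; exact (Y.stabChar_eq_iff y ⟨g, h⟩ _).1 rfl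

theorem mem_stab_sum {X Y : FiberedSet A G} (hX : ∀ x, 𝓓.mem (X.stab x))
    (hY : ∀ x, 𝓓.mem (Y.stab x)) : ∀ z, 𝓓.mem ((X.sum Y).stab z)
  | Sum.inl x => by
    have := hX x
    rwa [← stab_sumInl (Y := Y) x] at this
  | Sum.inr y => by
    have := hY y
    rwa [← stab_sumInr (X := X) y] at this

variable {F} in
/-- The function on `X ⊔ Y` given by `s` on `X` and by `t` on `Y`. -/
noncomputable def sumSec {X Y : FiberedSet A G} (hX : ∀ x, 𝓓.mem (X.stab x))
    (hY : ∀ x, 𝓓.mem (Y.stab x)) (s : ∀ x : X, F.obj (ob R (X.stab x) (hX x)))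
    (t : ∀ y : Y, F.obj (ob R (Y.stab y) (hY y))) :
    ∀ z : X.sum Y, F.obj (ob R ((X.sum Y).stab z) (mem_stab_sum hX hY z))
  | Sum.inl x => FEq F (hX x) (mem_stab_sum hX hY (sumInl x)) (stab_sumInl x).symm (s x)
  | Sum.inr y => FEq F (hY y) (mem_stab_sum hX hY (sumInr y)) (stab_sumInr y).symm (t y)

theorem sumSec_inl {X Y : FiberedSet A G} (hX : ∀ x, 𝓓.mem (X.stab x))
    (hY : ∀ x, 𝓓.mem (Y.stab x)) (s : ∀ x : X, F.obj (ob R (X.stab x) (hX x)))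
    (t : ∀ y : Y, F.obj (ob R (Y.stab y) (hY y))) (x : X) :
    sumSec hX hY s t (sumInl x) =
      FEq F (hX x) (mem_stab_sum hX hY (sumInl x)) (stab_sumInl x).symm (s x) := rfl

theorem sumSec_inr {X Y : FiberedSet A G} (hX : ∀ x, 𝓓.mem (X.stab x))
    (hY : ∀ x, 𝓓.mem (Y.stab x)) (s : ∀ x : X, F.obj (ob R (X.stab x) (hX x)))
    (t : ∀ y : Y, F.obj (ob R (Y.stab y) (hY y))) (y : Y) :
    sumSec hX hY s t (sumInr y) =
      FEq F (hY y) (mem_stab_sum hX hY (sumInr y)) (stab_sumInr y).symm (t y) := rfl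

variable {hG F} in
/-- The coproduct `(X ⊔ Y, s ⊔ t)`. -/
noncomputable def Gamma.sum (P Q : Gamma hG F) : Gamma hG F where
  X := P.X.sum Q.X
  mem := mem_stab_sum P.mem Q.mem
  s := ⟨sumSec P.mem Q.mem P.s.1 Q.s.1, by
    intro g a z
    obtain ⟨x, rfl⟩ | ⟨y, rfl⟩ := sum_cases z
    · have h := P.s.2 g a x
      rw [sumSec_inl, FEq_eq hG]
      refine Eq.trans ?_ (sumSec_inl F P.mem Q.mem P.s.1 Q.s.1 ((g, a) • x)).symm
      rw [← h, FEq_eq hG]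
      refine FConj_FRes hG F _ _ _ _ _ _ _ _ _ _
    · have h := Q.s.2 g a y
      rw [sumSec_inr, FEq_eq hG]
      refine Eq.trans ?_ (sumSec_inr F P.mem Q.mem P.s.1 Q.s.1 ((g, a) • y)).symm
      rw [← h, FEq_eq hG]
      refine FConj_FRes hG F _ _ _ _ _ _ _ _ _ _⟩

/-- The defining relations of `F_+(G)`. -/
def lowerRel : Set (FreeAbelianGroup (Quotient (Gamma.setoid hG F))) :=
  {y | (∃ P Q : Gamma hG F, y = FreeAbelianGroup.of (Quotient.mk _ (P.sum Q)) -
      FreeAbelianGroup.of (Quotient.mk _ P) - FreeAbelianGroup.of (Quotient.mk _ Q)) ∨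
    ∃ (X : FiberedSet A G) (hX : ∀ x, 𝓓.mem (X.stab x)) (s t : sections hG F X hX),
      y = FreeAbelianGroup.of (Quotient.mk _ ⟨X, hX, s + t⟩) -
        FreeAbelianGroup.of (Quotient.mk _ ⟨X, hX, s⟩) -
        FreeAbelianGroup.of (Quotient.mk _ ⟨X, hX, t⟩)}

/-- The group `F_+(G)`: the free abelian group on the isomorphism classes `{X, s}` of objects of
`Γ_F(G)`, modulo `{X ⊔ Y, s ⊔ t} - {X, s} - {Y, t}` and `{X, s + t} - {X, s} - {X, t}`. -/
def Lower : Type (max (u + 1) w) :=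
  FreeAbelianGroup (Quotient (Gamma.setoid hG F)) ⧸ AddSubgroup.closure (lowerRel hG F)

noncomputable instance : AddCommGroup (Lower hG F) :=
  inferInstanceAs (AddCommGroup (_ ⧸ AddSubgroup.closure (lowerRel hG F)))

namespace Lower

variable {hG F}

/-- The class `[X, s]` in `F_+(G)`. -/
def mk (P : Gamma hG F) : Lower hG F :=
  QuotientAddGroup.mk (FreeAbelianGroup.of (Quotient.mk _ P))

theorem mk_congr {P Q : Gamma hG F} (h : P.Isomorphic Q) : mk P = mk Q := by
  rw [mk, mk, Quotient.sound (s := Gamma.setoid hG F) h]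

theorem mk_sum (P Q : Gamma hG F) : mk (P.sum Q) = mk P + mk Q := by
  have : (QuotientAddGroup.mk (FreeAbelianGroup.of (Quotient.mk _ (P.sum Q)) -
      FreeAbelianGroup.of (Quotient.mk _ P) - FreeAbelianGroup.of (Quotient.mk _ Q)) :
      FreeAbelianGroup (Quotient (Gamma.setoid hG F)) ⧸
        AddSubgroup.closure (lowerRel hG F)) = 0 :=
    (QuotientAddGroup.eq_zero_iff _).2 (AddSubgroup.subset_closure (Or.inl ⟨P, Q, rfl⟩))
  have h : mk (P.sum Q) - mk P - mk Q = 0 := this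
  rw [sub_sub, sub_eq_zero] at h
  exact h

theorem mk_add (X : FiberedSet A G) (hX : ∀ x, 𝓓.mem (X.stab x)) (s t : sections hG F X hX) :
    mk ⟨X, hX, s + t⟩ = mk ⟨X, hX, s⟩ + mk ⟨X, hX, t⟩ := by
  have : (QuotientAddGroup.mk (FreeAbelianGroup.of (Quotient.mk _ ⟨X, hX, s + t⟩) -
      FreeAbelianGroup.of (Quotient.mk _ ⟨X, hX, s⟩) -
      FreeAbelianGroup.of (Quotient.mk _ ⟨X, hX, t⟩)) :
      FreeAbelianGroup (Quotient (Gamma.setoid hG F)) ⧸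
        AddSubgroup.closure (lowerRel hG F)) = 0 :=
    (QuotientAddGroup.eq_zero_iff _).2 (AddSubgroup.subset_closure (Or.inr ⟨X, hX, s, t, rfl⟩))
  have h : mk ⟨X, hX, s + t⟩ - mk ⟨X, hX, s⟩ - mk ⟨X, hX, t⟩ = 0 := this
  rw [sub_sub, sub_eq_zero] at h
  exact h

/-- The universal property of `F_+(G)`. -/
noncomputable def lift {M : Type*} [AddCommGroup M] (f : Gamma hG F → M)
    (h₁ : ∀ P Q, P.Isomorphic Q → f P = f Q) (h₂ : ∀ P Q, f (P.sum Q) = f P + f Q)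
    (h₃ : ∀ X hX s t, f ⟨X, hX, s + t⟩ = f ⟨X, hX, s⟩ + f ⟨X, hX, t⟩) : Lower hG F →+ M :=
  QuotientAddGroup.lift _ (FreeAbelianGroup.lift (Quotient.lift f h₁)) (by
    refine (AddSubgroup.closure_le (K := (FreeAbelianGroup.lift (Quotient.lift f h₁)).ker)).2 ?_
    rintro _ (⟨P, Q, rfl⟩ | ⟨X, hX, s, t, rfl⟩) <;>
      simp only [SetLike.mem_coe, AddMonoidHom.mem_ker, map_sub, FreeAbelianGroup.lift_apply_of,
        Quotient.lift_mk, h₂, h₃] <;> abel)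

theorem lift_mk {M : Type*} [AddCommGroup M] (f : Gamma hG F → M) (h₁ h₂ h₃) (P : Gamma hG F) :
    lift f h₁ h₂ h₃ (mk P) = f P :=
  FreeAbelianGroup.lift_apply_of _ _

theorem induction {p : Lower hG F → Prop} (h : p 0) (h₀ : ∀ P, p (mk P))
    (h₁ : ∀ x y, p x → p y → p (x + y)) (h₂ : ∀ x, p x → p (-x)) (x : Lower hG F) : p x := by
  obtain ⟨y, rfl⟩ := QuotientAddGroup.mk_surjective x
  induction y using FreeAbelianGroup.induction_on with
  | zero => exact h
  | of q => induction q using Quotient.ind; exact h₀ _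
  | neg q _ => induction q using Quotient.ind; exact h₂ _ (h₀ _)
  | add x y hx hy => exact h₁ _ _ hx hy

theorem hom_ext {M : Type*} [AddCommGroup M] {f g : Lower hG F →+ M}
    (h : ∀ P, f (mk P) = g (mk P)) : f = g :=
  AddMonoidHom.ext fun x => by
    induction x using Lower.induction with
    | h => simp
    | h₀ P => exact h P
    | h₁ x y hx hy => rw [map_add, map_add, hx, hy]
    | h₂ x hx => rw [map_neg, map_neg, hx]

theorem smulRel (r : R) {P Q : Gamma hG F} (h : P.Isomorphic Q) :
    Gamma.Isomorphic (⟨P.X, P.mem, r • P.s⟩ : Gamma hG F) ⟨Q.X, Q.mem, r • Q.s⟩ := by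
  obtain ⟨e, he, hs⟩ := h
  refine ⟨e, he, fun x => ⟨(hs x).1, ?_⟩⟩
  change r • Q.s.1 (e x) = FEq F (P.mem x) (Q.mem (e x)) (hs x).1 (r • P.s.1 x)
  rw [map_smul, (hs x).2]

/-- Scalar multiplication `[X, s] ↦ [X, r s]` on `F_+(G)`. -/
noncomputable def smulHom (r : R) : Lower hG F →+ Lower hG F :=
  lift (fun P => mk ⟨P.X, P.mem, r • P.s⟩) (fun _ _ h => mk_congr (smulRel r h))
    (fun P Q => by
      rw [← mk_sum]
      refine congrArg (fun s => mk (⟨P.X.sum Q.X, _, s⟩ : Gamma hG F)) (Subtype.ext ?_)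
      funext z
      obtain ⟨x, rfl⟩ | ⟨y, rfl⟩ := sum_cases z
      · exact (map_smul (FEq F (P.mem x) _ (stab_sumInl x).symm) r (P.s.1 x)).symm
      · exact (map_smul (FEq F (Q.mem y) _ (stab_sumInr y).symm) r (Q.s.1 y)).symm)
    (fun X hX s t => by rw [← mk_add, smul_add])

noncomputable instance : Module R (Lower hG F) where
  smul r x := smulHom r x
  one_smul := DFunLike.congr_fun (f := smulHom 1) (g := AddMonoidHom.id _) <| hom_ext fun P => by
    simp [smulHom, lift_mk]
  mul_smul r r' := DFunLike.congr_fun (f := smulHom (r * r'))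
    (g := (smulHom r).comp (smulHom r')) <| hom_ext fun P => by
    simp [smulHom, lift_mk, mul_smul]
  smul_zero r := map_zero _
  smul_add r := map_add _
  add_smul r r' := DFunLike.congr_fun (f := smulHom (r + r'))
    (g := smulHom r + smulHom r') <| hom_ext fun P => by
    simp [smulHom, lift_mk, add_smul, mk_add]
  zero_smul := DFunLike.congr_fun (f := smulHom 0) (g := 0) <| hom_ext fun P => by
    have := mk_add P.X P.mem (0 : sections hG F P.X P.mem) 0
    rw [add_zero, left_eq_add] at this
    simp [smulHom, lift_mk, this]

theorem smul_mk (r : R) (P : Gamma hG F) : r • mk P = mk ⟨P.X, P.mem, r • P.s⟩ :=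
  lift_mk _ _ _ _ P

end Lower

end FiberedData

end Fibered
namespace Fibered

open FiberedSet

namespace MonPair

variable {A G : Type u} [CommGroup A] [Group G]

theorem conj_le_conj (g : G) {p q : MonPair A G} (h : p ≤ q) : p.conj g ≤ q.conj g := by
  obtain ⟨h, e⟩ := h
  exact ⟨Subgroup.map_mono h, fun x => e ⟨g⁻¹ * x * g, mem_conjSub.1 x.2⟩⟩

theorem sub_eq_conjSub {g : G} {p q : MonPair A G} (e : q = p.conj g) :
    q.sub = conjSub g p.sub := congrArg MonPair.sub e

theorem conj_one (p : MonPair A G) : p.conj 1 = p :=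
  ext' (by ext; simp [conj, mem_conjSub]) fun g h₁ h₂ =>
    congrArg p.char (Subtype.ext (by simp [conjHom]))

theorem conj_conj' (g h : G) (p : MonPair A G) : (p.conj g).conj h = p.conj (h * g) :=
  ext' (by ext; simp [conj, mem_conjSub, mul_assoc]) fun x h₁ h₂ =>
    congrArg p.char (Subtype.ext (by simp [conjHom, mul_assoc]))

theorem conj_le_conj_iff (g : G) {p q : MonPair A G} : p.conj g ≤ q.conj g ↔ p ≤ q := by
  refine ⟨fun h => ?_, conj_le_conj g⟩
  have := conj_le_conj g⁻¹ h
  rwa [conj_conj', conj_conj', inv_mul_cancel, conj_one, conj_one] at this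

theorem finite_Iic [Finite G] (q : MonPair A G) : {p : MonPair A G | p ≤ q}.Finite := by
  refine Set.Finite.of_injOn (f := MonPair.sub) (t := Set.univ) (fun _ _ => trivial) ?_
    Set.finite_univ
  rintro p ⟨h, e⟩ p' ⟨h', e'⟩ hp
  exact ext' hp fun g h₁ h₂ => (e ⟨g, h₁⟩).trans (e' ⟨g, h₂⟩).symm

end MonPair

namespace FiberedSet

variable {A G : Type u} [CommGroup A] [Group G]

noncomputable instance (X : FiberedSet A G) : Fintype X.Orbits := Fintype.ofFinite _

/-- The class of `x` in `X/A`. -/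
def orb {X : FiberedSet A G} (x : X) : X.Orbits := Quotient.mk X.orbitSetoid x

theorem orb_eq_iff {X : FiberedSet A G} {x y : X} :
    orb x = orb y ↔ ∃ a : A, ((1 : G), a) • x = y := Quotient.eq (r := X.orbitSetoid)

theorem le_stab {X : FiberedSet A G} {x : X} {p : MonPair A G} (h : p ≤ X.pair x) :
    p.sub ≤ X.stab x := h.fst

theorem stab_transBase [Finite G] (p : MonPair A G) : p.sub = (trans p).stab (transBase p) :=
  (congrArg MonPair.sub (pair_transBase p)).symm

theorem orb_surjective {X : FiberedSet A G} (o : X.Orbits) : ∃ x, o = orb x := by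
  induction o using Quotient.ind with
  | _ x => exact ⟨x, rfl⟩

theorem bijective_orb_map {X Y : FiberedSet A G} (e : X ≃ Y)
    (he : ∀ (a : A) (x : X), e (((1 : G), a) • x) = ((1 : G), a) • e x) :
    ∃ f : X.Orbits ≃ Y.Orbits, ∀ x, f (orb x) = orb (e x) := by
  refine ⟨Quotient.congr e fun x y => ?_, fun x => rfl⟩
  refine exists_congr fun a => ?_
  rw [← he, e.apply_eq_iff_eq]

theorem bijective_orb_sum (X Y : FiberedSet A G) :
    ∃ f : X.Orbits ⊕ Y.Orbits ≃ (X.sum Y).Orbits,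
      (∀ x, f (Sum.inl (orb x)) = orb (sumInl x)) ∧ ∀ y, f (Sum.inr (orb y)) = orb (sumInr y) := by
  let f : X.Orbits ⊕ Y.Orbits → (X.sum Y).Orbits := Sum.elim
    (Quotient.lift (fun x => orb (sumInl x)) fun x y ⟨a, h⟩ => orb_eq_iff.2 ⟨a, by
      rw [smul_sumInl, h]⟩)
    (Quotient.lift (fun x => orb (sumInr x)) fun x y ⟨a, h⟩ => orb_eq_iff.2 ⟨a, by
      rw [smul_sumInr, h]⟩)
  have h₁ : ∀ x, f (Sum.inl (orb x)) = orb (sumInl x) := fun x => rfl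
  have h₂ : ∀ x, f (Sum.inr (orb x)) = orb (sumInr x) := fun x => rfl
  refine ⟨Equiv.ofBijective f ⟨?_, ?_⟩, h₁, h₂⟩
  · rintro (o | o) (o' | o') h <;> obtain ⟨x, rfl⟩ := orb_surjective o <;>
      obtain ⟨y, rfl⟩ := orb_surjective o' <;>
      simp only [h₁, h₂, orb_eq_iff, smul_sumInl, smul_sumInr, sumInl_inj, sumInr_inj,
        sumInl_ne, sumInr_ne, exists_false] at h
    · rw [orb_eq_iff.2 h]
    · rw [orb_eq_iff.2 h]
  · intro o
    obtain ⟨z, rfl⟩ := orb_surjective o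
    obtain ⟨x, rfl⟩ | ⟨y, rfl⟩ := sum_cases z
    · exact ⟨_, h₁ x⟩
    · exact ⟨_, h₂ y⟩

end FiberedSet

namespace FiberedData

variable {A : Type u} [CommGroup A]

/-- The poset `M'(G)` of all `(K, λ) ∈ M(G)` with `K ∈ 𝒢`. -/
abbrev MonIn (𝓓 : FiberedData A) (G : Type u) [Group G] [Finite G] : Type u :=
  {p : MonPair A G // 𝓓.mem p.sub}

variable {𝓓 : FiberedData A} {R : Type v} [CommRing R]
  {G : Type u} [Group G] [Finite G] (hG : 𝓓.mem G) (F : 𝓓.Obj R ⥤ ModuleCat.{w} R)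

theorem MonIn.finite_Iic (q : MonIn 𝓓 G) : {p : MonIn 𝓓 G | p ≤ q}.Finite :=
  Set.Finite.preimage Subtype.val_injective.injOn (MonPair.finite_Iic q.1)

noncomputable instance : LocallyFiniteOrder (MonIn 𝓓 G) :=
  LocallyFiniteOrder.ofFiniteIcc fun _ q => (MonIn.finite_Iic q).subset fun _ h => h.2

/-- `ᵍ(K, λ)` for `(K, λ) ∈ M'(G)`. -/
def conjM (g : G) (p : MonIn 𝓓 G) : MonIn 𝓓 G :=
  ⟨p.1.conj g, (conj_mem hG g p.2).1⟩

/-- The `R`-module `F^+(G)`: the `G`-fixed points of the direct sum of the modules `F(K)`, for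
`(K, λ) ∈ M'(G)`, i.e. the finitely supported families with `ᵍx_{(K, λ)} = x_{ᵍ(K, λ)}`. -/
noncomputable def Upper : Submodule R (∀ p : MonIn 𝓓 G, F.obj (ob R p.1.sub p.2)) where
  carrier := {x | {p | x p ≠ 0}.Finite ∧
    ∀ (g : G) (p : MonIn 𝓓 G), FConj hG F g p.2 (conjM hG g p).2 rfl (x p) = x (conjM hG g p)}
  zero_mem' := ⟨by simp, fun _ _ => map_zero _⟩
  add_mem' := fun {x y} hx hy => ⟨(hx.1.union hy.1).subset fun p h => by
    by_contra h'
    simp only [Set.mem_union, Set.mem_ofPred_eq, not_or, not_not] at h'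
    exact h (by rw [Pi.add_apply, h'.1, h'.2, add_zero]),
    fun g p => (map_add _ _ _).trans (congrArg₂ (· + ·) (hx.2 g p) (hy.2 g p))⟩
  smul_mem' := fun r x hx => ⟨hx.1.subset fun p h h' => h (by rw [Pi.smul_apply, h', smul_zero]),
    fun g p => (map_smul _ _ _).trans (congrArg (r • ·) (hx.2 g p))⟩

section mark

variable {hG F}

open Classical in
/-- The summand `F(Res^{G_x}_K)(s(x))` if `(K, λ) ≤ (G_x, φ_x)`, and `0` otherwise. -/
noncomputable def markTerm (P : Gamma hG F) (p : MonIn 𝓓 G) (x : P.X) :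
    F.obj (ob R p.1.sub p.2) :=
  if h : p.1 ≤ P.X.pair x then FRes hG F p.2 (P.mem x) (le_stab h) (P.s.1 x) else 0

theorem markTerm_pos {P : Gamma hG F} {p : MonIn 𝓓 G} {x : P.X} (h : p.1 ≤ P.X.pair x) :
    markTerm P p x = FRes hG F p.2 (P.mem x) (le_stab h) (P.s.1 x) := dif_pos h

theorem markTerm_neg {P : Gamma hG F} {p : MonIn 𝓓 G} {x : P.X} (h : ¬ p.1 ≤ P.X.pair x) :
    markTerm P p x = 0 := dif_neg h

theorem markTerm_smul (P : Gamma hG F) (p q : MonIn 𝓓 G) (g : G) (a : A) (x : P.X)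
    (e : q.1 = p.1.conj g) : markTerm P q ((g, a) • x) =
      FConj hG F g p.2 q.2 (MonPair.sub_eq_conjSub e) (markTerm P p x) := by
  have hiff : q.1 ≤ P.X.pair ((g, a) • x) ↔ p.1 ≤ P.X.pair x := by
    rw [e, pair_smul, MonPair.conj_le_conj_iff]
  by_cases h : p.1 ≤ P.X.pair x
  · rw [markTerm_pos h, markTerm_pos (hiff.2 h), ← P.s.2 g a x]
    exact (FConj_FRes hG F _ _ _ _ _ _ _ _ _ _).symm
  · rw [markTerm_neg h, markTerm_neg (mt hiff.1 h), map_zero]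

theorem markTerm_orb (P : Gamma hG F) (p : MonIn 𝓓 G) (a : A) (x : P.X) :
    markTerm P p (((1 : G), a) • x) = markTerm P p x := by
  rw [markTerm_smul P p p 1 a x (MonPair.conj_one _).symm,
    FConj_self hG F _ _ _ (one_mem _) _ rfl, FRes_self]

/-- The summand attached to an `A`-orbit. -/
noncomputable def markOrb (P : Gamma hG F) (p : MonIn 𝓓 G) :
    P.X.Orbits → F.obj (ob R p.1.sub p.2) :=
  Quotient.lift (markTerm P p) fun x _ ⟨a, h⟩ => by rw [← h, markTerm_orb]

theorem markOrb_orb (P : Gamma hG F) (p : MonIn 𝓓 G) (x : P.X) :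
    markOrb P p (orb x) = markTerm P p x := rfl

/-- The coordinate of `m_{F,G}([X, s])` at `(K, λ) ∈ M'(G)`: the sum of `F(Res^{G_x}_K)(s(x))`
over those `x ∈ [X/A]` with `(K, λ) ≤ (G_x, φ_x)`. -/
noncomputable def markFun (P : Gamma hG F) (p : MonIn 𝓓 G) : F.obj (ob R p.1.sub p.2) :=
  ∑ o : P.X.Orbits, markOrb P p o

theorem markFun_mem (P : Gamma hG F) : markFun P ∈ Upper hG F := by
  constructor
  · refine Set.Finite.subset (s := ⋃ o : P.X.Orbits,
      {p : MonIn 𝓓 G | p.1 ≤ P.X.pair (Quotient.out o)}) (Set.finite_iUnion fun o =>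
        Set.Finite.preimage Subtype.val_injective.injOn (MonPair.finite_Iic _)) fun p hp => ?_
    obtain ⟨o, -, ho⟩ := Finset.exists_ne_zero_of_sum_ne_zero hp
    refine Set.mem_iUnion.2 ⟨o, ?_⟩
    by_contra h
    refine ho ?_
    rw [← Quotient.out_eq o]
    exact dif_neg h
  · intro g p
    obtain ⟨f, hf⟩ := bijective_orb_map (X := P.X) (Y := P.X)
      (MulAction.toPerm ((g, 1) : G × A)) fun a x => by
        simp [smul_smul]
    rw [markFun, markFun, map_sum]
    refine Eq.trans ?_ (f.sum_comp _)
    refine Finset.sum_congr rfl fun o _ => ?_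
    obtain ⟨x, rfl⟩ := orb_surjective o
    rw [hf]
    exact (markTerm_smul P p (conjM hG g p) g 1 x rfl).symm

theorem markFun_congr {P Q : Gamma hG F} (h : P.Isomorphic Q) : markFun P = markFun Q := by
  obtain ⟨e, he, hs⟩ := h
  funext p
  obtain ⟨f, hf⟩ := bijective_orb_map e fun a x => he _ x
  rw [markFun, markFun, ← f.sum_comp]
  refine Finset.sum_congr rfl fun o _ => ?_
  obtain ⟨x, rfl⟩ := orb_surjective o
  rw [hf, markOrb_orb, markOrb_orb]
  obtain ⟨hx, hx'⟩ := hs x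
  by_cases h : p.1 ≤ P.X.pair x
  · have h' : p.1 ≤ Q.X.pair (e x) := by rwa [pair_congr e he]
    rw [markTerm_pos h, markTerm_pos h', hx', FEq_eq hG, FRes_FRes]
  · have h' : ¬ p.1 ≤ Q.X.pair (e x) := by rwa [pair_congr e he]
    rw [markTerm_neg h, markTerm_neg h']

theorem markFun_sum (P Q : Gamma hG F) : markFun (P.sum Q) = markFun P + markFun Q := by
  funext p
  obtain ⟨f, hf, hf'⟩ := bijective_orb_sum P.X Q.X
  rw [Pi.add_apply, markFun, markFun, markFun]
  refine (f.sum_comp _).symm.trans ?_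
  rw [Fintype.sum_sum_type]
  refine congrArg₂ (· + ·) (Finset.sum_congr rfl fun o _ => ?_)
    (Finset.sum_congr rfl fun o _ => ?_)
  · obtain ⟨x, rfl⟩ := orb_surjective o
    rw [hf, markOrb_orb]
    refine Eq.trans (markOrb_orb (P.sum Q) p (sumInl x)) ?_
    by_cases h : p.1 ≤ P.X.pair x
    · have h' : p.1 ≤ (P.X.sum Q.X).pair (sumInl x) := by rwa [pair_sumInl]
      rw [markTerm_pos h]
      refine (markTerm_pos (P := P.sum Q) (x := sumInl x) h').trans ?_
      refine (congrArg _ (sumSec_inl F P.mem Q.mem P.s.1 Q.s.1 x)).trans ?_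
      rw [FEq_eq hG]
      exact FRes_FRes hG F _ _ _ _ _ _
    · have h' : ¬ p.1 ≤ (P.X.sum Q.X).pair (sumInl x) := by rwa [pair_sumInl]
      rw [markTerm_neg h]
      exact markTerm_neg (P := P.sum Q) (x := sumInl x) h'
  · obtain ⟨x, rfl⟩ := orb_surjective o
    rw [hf', markOrb_orb]
    refine Eq.trans (markOrb_orb (P.sum Q) p (sumInr x)) ?_
    by_cases h : p.1 ≤ Q.X.pair x
    · have h' : p.1 ≤ (P.X.sum Q.X).pair (sumInr x) := by rwa [pair_sumInr]
      rw [markTerm_pos h]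
      refine (markTerm_pos (P := P.sum Q) (x := sumInr x) h').trans ?_
      refine (congrArg _ (sumSec_inr F P.mem Q.mem P.s.1 Q.s.1 x)).trans ?_
      rw [FEq_eq hG]
      exact FRes_FRes hG F _ _ _ _ _ _
    · have h' : ¬ p.1 ≤ (P.X.sum Q.X).pair (sumInr x) := by rwa [pair_sumInr]
      rw [markTerm_neg h]
      exact markTerm_neg (P := P.sum Q) (x := sumInr x) h'

theorem markFun_add (X : FiberedSet A G) (hX : ∀ x, 𝓓.mem (X.stab x)) (s t : sections hG F X hX) :
    markFun (⟨X, hX, s + t⟩ : Gamma hG F) = markFun ⟨X, hX, s⟩ + markFun ⟨X, hX, t⟩ := by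
  funext p
  rw [Pi.add_apply, markFun, markFun, markFun]
  refine Eq.trans ?_ Finset.sum_add_distrib
  refine Finset.sum_congr rfl fun o _ => ?_
  obtain ⟨x, rfl⟩ := orb_surjective (X := X) o
  change markTerm (⟨X, hX, s + t⟩ : Gamma hG F) p x =
    markTerm (⟨X, hX, s⟩ : Gamma hG F) p x + markTerm (⟨X, hX, t⟩ : Gamma hG F) p x
  by_cases h : p.1 ≤ X.pair x
  · refine (markTerm_pos h).trans (Eq.trans ?_
      (congrArg₂ (· + ·) (markTerm_pos h) (markTerm_pos h)).symm)
    exact map_add _ _ _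
  · refine (markTerm_neg h).trans (Eq.trans ?_
      (congrArg₂ (· + ·) (markTerm_neg h) (markTerm_neg h)).symm)
    exact (add_zero _).symm

theorem markFun_smul (r : R) (P : Gamma hG F) :
    markFun (⟨P.X, P.mem, r • P.s⟩ : Gamma hG F) = r • markFun P := by
  funext p
  rw [Pi.smul_apply, markFun, markFun, Finset.smul_sum]
  refine Finset.sum_congr rfl fun o _ => ?_
  obtain ⟨x, rfl⟩ := orb_surjective (X := P.X) o
  change markTerm (⟨P.X, P.mem, r • P.s⟩ : Gamma hG F) p x = r • markTerm P p x
  by_cases h : p.1 ≤ P.X.pair x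
  · refine (markTerm_pos (P := ⟨P.X, P.mem, r • P.s⟩) h).trans (Eq.trans ?_ (congrArg (r • ·) (markTerm_pos h)).symm)
    exact map_smul _ _ _
  · refine (markTerm_neg (P := ⟨P.X, P.mem, r • P.s⟩) h).trans (Eq.trans ?_ (congrArg (r • ·) (markTerm_neg h)).symm)
    exact (smul_zero _).symm

variable (hG F) in
/-- The additive map underlying `m_{F,G}`. -/
noncomputable def markHom : Lower hG F →+ Upper hG F :=
  Lower.lift (fun P => ⟨markFun P, markFun_mem P⟩)
    (fun _ _ h => Subtype.ext (markFun_congr h)) (fun P Q => Subtype.ext (markFun_sum P Q))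
    fun X hX s t => Subtype.ext (markFun_add X hX s t)

theorem markHom_mk (P : Gamma hG F) : markHom hG F (Lower.mk P) = ⟨markFun P, markFun_mem P⟩ :=
  Lower.lift_mk _ _ _ _ P

variable (hG F) in
/-- The mark morphism `m_{F,G} : F_+(G) → F^+(G)`. -/
noncomputable def mark : Lower hG F →ₗ[R] Upper hG F where
  __ := markHom hG F
  map_smul' r := DFunLike.congr_fun (f := (markHom hG F).comp (DistribSMul.toAddMonoidHom _ r))
    (g := (DistribSMul.toAddMonoidHom _ r).comp (markHom hG F)) <| Lower.hom_ext fun P => by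
      simp only [AddMonoidHom.comp_apply, DistribSMul.toAddMonoidHom_apply, Lower.smul_mk,
        markHom_mk]
      exact Subtype.ext (markFun_smul r P)

theorem mark_mk (P : Gamma hG F) : mark hG F (Lower.mk P) = ⟨markFun P, markFun_mem P⟩ :=
  markHom_mk P

end mark

section bracket

theorem mem_stab_trans (hG : 𝓓.mem G) (p : MonIn 𝓓 G) (x : trans p.1) :
    𝓓.mem ((trans p.1).stab x) := by
  obtain ⟨m, rfl⟩ := exists_smul_transBase _ x
  have h : (trans p.1).stab (m • transBase p.1) = MonPair.conjSub m.1 p.1.sub :=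
    ((trans p.1).stab_smul _ m.1 m.2).trans
      (congrArg (MonPair.conjSub m.1) (congrArg MonPair.sub (pair_transBase p.1)))
  rw [h]
  exact (conj_mem hG m.1 p.2).1

theorem stab_smul_transBase (p : MonPair A G) (x : trans p) (m : G × A) (h : x = m • transBase p) :
    (trans p).stab x = MonPair.conjSub m.1 p.sub := by
  rw [h]
  exact ((trans p).stab_smul _ m.1 m.2).trans
    (congrArg (MonPair.conjSub m.1) (congrArg MonPair.sub (pair_transBase p)))

/-- The section `s_a` on the transitive `A`-fibered `G`-set `X` attached to `(K, λ)`: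
`s_a(m x₀) = ᵍa` for `m = (g, b)`, with `x₀` the base point. -/
noncomputable def trFun (p : MonIn 𝓓 G) (a : F.obj (ob R p.1.sub p.2)) (x : trans p.1) :
    F.obj (ob R ((trans p.1).stab x) (mem_stab_trans hG p x)) :=
  FConj hG F (exists_smul_transBase _ x).choose.1 p.2 (mem_stab_trans hG p x)
    (stab_smul_transBase _ _ _ (exists_smul_transBase _ x).choose_spec) a

theorem trFun_eq (p : MonIn 𝓓 G) (a : F.obj (ob R p.1.sub p.2)) (x : trans p.1) (m : G × A)
    (h : x = m • transBase p.1) : trFun hG F p a x =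
      FConj hG F m.1 p.2 (mem_stab_trans hG p x) (stab_smul_transBase _ _ _ h) a := by
  have h₁ := (exists_smul_transBase _ x).choose_spec
  rw [trFun]
  have e₀ := stab_smul_transBase _ _ _ h₁
  change FConj hG F _ _ _ e₀ a = _
  generalize (exists_smul_transBase _ x).choose = n at h₁ e₀
  obtain ⟨hu, -⟩ := (smul_transBase_eq_iff p.1 m n).1 (h.symm.trans h₁)
  have hc : p.1.sub = MonPair.conjSub (m⁻¹ * n).1 p.1.sub := by
    ext y
    rw [MonPair.mem_conjSub]
    constructor
    · intro hy
      exact mul_mem (mul_mem (inv_mem hu) hy) hu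
    · intro hy
      have := mul_mem (mul_mem hu hy) (inv_mem hu)
      simpa [mul_assoc] using this
  have hn : n.1 = m.1 * (m⁻¹ * n).1 := by simp
  have := FConj_FConj hG F p.2 p.2 (mem_stab_trans hG p x) (m⁻¹ * n).1 m.1 hc
    (stab_smul_transBase _ _ _ h) (by rw [← hn]; exact e₀) a
  rw [FConj_self hG F _ _ _ hu hc rfl, FRes_self] at this
  rw [this]
  congr 2

theorem trFun_transBase (p : MonIn 𝓓 G) (a : F.obj (ob R p.1.sub p.2)) :
    trFun hG F p a (transBase p.1) = FEq F p.2 (mem_stab_trans hG p _)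
      (stab_transBase p.1) a := by
  rw [trFun_eq hG F p a _ 1 (one_smul _ _).symm, FEq_eq hG]
  exact FConj_self hG F _ _ _ (one_mem _) _ (stab_transBase p.1).symm a

/-- `a ↦ s_a`, as a linear map. -/
noncomputable def trSec (p : MonIn 𝓓 G) :
    F.obj (ob R p.1.sub p.2) →ₗ[R] sections hG F (trans p.1) (mem_stab_trans hG p) where
  toFun a := ⟨trFun hG F p a, fun g b x => by
    obtain ⟨m, hm⟩ := exists_smul_transBase _ x
    rw [trFun_eq hG F p a x m hm, trFun_eq hG F p a ((g, b) • x) ((g, b) * m)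
      (by rw [mul_smul, ← hm])]
    exact FConj_FConj hG F _ _ _ _ _ _ _ _ a⟩
  map_add' a b := Subtype.ext (funext fun _ => map_add _ a b)
  map_smul' r a := Subtype.ext (funext fun _ => map_smul _ r a)

/-- `a ↦ [K, λ, a]_G`, the class in `F_+(G)` of the transitive `A`-fibered `G`-set attached to
`(K, λ)` with the section `s_a`. -/
noncomputable def bracket (p : MonIn 𝓓 G) : F.obj (ob R p.1.sub p.2) →ₗ[R] Lower hG F where
  toFun a := Lower.mk ⟨trans p.1, mem_stab_trans hG p, trSec hG F p a⟩
  map_add' a b := by rw [map_add, Lower.mk_add]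
  map_smul' r a := by rw [map_smul, RingHom.id_apply, Lower.smul_mk]

end bracket

open Classical in
/-- The summand `|L| μ((L, ψ), (K, λ)) [L, ψ, F(Res^K_L)(x_{(K, λ)})]_G` of `n_{F,G}(x)`, for
`(L, ψ) ≤ (K, λ)`, with `μ` the Möbius function of `M'(G)`. -/
noncomputable def nTerm (z : {z : MonIn 𝓓 G × MonIn 𝓓 G // z.1 ≤ z.2}) :
    Upper hG F →ₗ[R] Lower hG F :=
  ((Nat.card z.1.1.1.sub : ℤ) * IncidenceAlgebra.mu ℤ z.1.1 z.1.2) •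
    (bracket hG F z.1.1 ∘ₗ FRes hG F z.1.1.2 z.1.2.2 z.2.fst ∘ₗ LinearMap.proj z.1.2 ∘ₗ
      (Upper hG F).subtype)

theorem finite_nTerm (x : Upper hG F) : {z | nTerm hG F z x ≠ 0}.Finite := by
  have h : (⋃ q ∈ {q | x.1 q ≠ 0}, (fun p => (p, q)) '' {p : MonIn 𝓓 G | p ≤ q}).Finite :=
    x.2.1.biUnion fun q _ => (MonIn.finite_Iic q).image _
  refine (h.preimage (f := Subtype.val) Subtype.val_injective.injOn).subset fun z hz => ?_
  refine Set.mem_biUnion (x := z.1.2) (fun h0 => hz ?_) ⟨z.1.1, z.2, rfl⟩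
  simp [nTerm, h0]

/-- The map `n_{F,G} : F^+(G) → F_+(G)`,
`x ↦ ∑_{(L, ψ) ≤ (K, λ)} |L| μ((L, ψ), (K, λ)) [L, ψ, F(Res^K_L)(x_{(K, λ)})]_G`. -/
noncomputable def nMap : Upper hG F →ₗ[R] Lower hG F where
  toFun x := ∑ᶠ z, nTerm hG F z x
  map_add' x y := by
    simp only [map_add]
    exact finsum_add_distrib (finite_nTerm hG F x) (finite_nTerm hG F y)
  map_smul' r x := by
    simp only [map_smul, RingHom.id_apply]
    exact (smul_finsum' r (finite_nTerm hG F x)).symm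

end FiberedData

end Fibered

/-! Both composites are computed by Möbius inversion in $\mathcal M'(G)$, once in each variable of
$\mu$, combined with the orbit-stabilizer count on a transitive fibered set. The factor $|L|$ in
$n_{F,G}$ is what makes that count come out as $|G|$ in both cases.

For $n\circ m$, additivity and the splitting of $X$ into $(G\times A)$-orbits reduce to a transitive
$X$ (`Lower.hom_ext_transitive`). The coordinates of $m([X,s])$ are sums over $A$-orbits, so the
orbit of each $x$ contributes separately: it gives the sum of
$|L|\,\mu((L,\psi),(K,\lambda))\,[L,\psi,\mathrm{Res}^{G_x}_L s(x)]$ over all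
$(L,\psi)\le(K,\lambda)\le(G_x,\varphi_x)$, because the two restrictions compose to one that no
longer involves $K$. Summing $\mu$ over $(K,\lambda)$ kills every term except
$(L,\psi)=(G_x,\varphi_x)$, which leaves $|G_x|[G_x,\varphi_x,s(x)]$ (`finsum_bracket_markTerm`). As
$X$ is transitive, this is $|G_x|[X,s]$ (`bracket_pair`), the order $|G_x|$ is the same at every
point, and $|G_x|\cdot|X/A|=|G|$.

For $m\circ n$, fix a coordinate $q$. The factor $|L|$ replaces the sum over the $A$-orbits of
$(G\times A)/(L,\psi)$ by a sum over $g\in G$ (`sum_orb_smul`, `card_smul_mark_bracket`). For fixed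
$g$, the pair $(L,\psi)\le(K,\lambda)$ contributes only if ${}^{g^{-1}}q\le(L,\psi)$. Conjugation
commutes with restriction and $x$ is invariant, so the contribution is $\mu$ times the restriction
of $x_{{}^g(K,\lambda)}$ to $q$, which does not depend on $(L,\psi)$. Summing $\mu$ over $(L,\psi)$
leaves only $(K,\lambda)={}^{g^{-1}}q$, that is $x_q$ (`finsum_mu_smul_conj`), and there are $|G|$
choices of $g$.

When $A$ is infinite, $\mathcal M'(G)$ can be infinite. The sums over pairs are therefore `finsum`s,
and each interchange of sums needs a finiteness argument: principal down-sets are finite in the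
first computation, and $x$ has finite support in the second. The remaining two claims follow
formally from the identities. -/

/-! ### Möbius inversion as a sum over comparable pairs -/

namespace IncidenceAlgebra

variable {T M : Type*} [PartialOrder T] [LocallyFiniteOrder T] [DecidableEq T] [AddCommGroup M]

open Classical in
-- A nonzero term has both entries in the down-set of `q`, which is finite by assumption. This
-- permits exchanging the `finsum` below with a finite sum over $A$-orbits.
theorem support_finite_mu_smul_fst {q : T} (hq : {p | p ≤ q}.Finite) (f : T → M) :
    (Function.support fun z : {z : T × T // z.1 ≤ z.2} =>
      if z.1.2 ≤ q then mu ℤ z.1.1 z.1.2 • f z.1.1 else 0).Finite := by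
  refine ((hq.prod hq).preimage (f := Subtype.val) Subtype.val_injective.injOn).subset
    fun z hz => ?_
  have h : z.1.2 ≤ q := by
    by_contra h
    exact hz (if_neg h)
  exact ⟨z.2.trans h, h⟩

open Classical in
/-- Möbius inversion: `∑_{p ≤ r ≤ q} μ(p, r) f(p) = f(q)`. -/
theorem finsum_mu_smul_fst {q : T} (hq : {p | p ≤ q}.Finite) (f : T → M) :
    ∑ᶠ z : {z : T × T // z.1 ≤ z.2},
      (if z.1.2 ≤ q then mu ℤ z.1.1 z.1.2 • f z.1.1 else 0) = f q := by
  have hmem : ∀ p, p ∈ hq.toFinset ↔ p ≤ q := fun p => hq.mem_toFinset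
  refine (finsum_subtype_eq_finsum_cond
    (f := fun z : T × T => if z.2 ≤ q then mu ℤ z.1 z.2 • f z.1 else 0)
    fun z : T × T => z.1 ≤ z.2).trans ?_
  -- The square of the down-set of `q` contains every relevant pair: a nonzero term has second entry
  -- below `q`, hence first entry too.
  rw [finsum_cond_eq_sum_of_cond_iff (p := fun z : T × T => z.1 ≤ z.2) _
    (t := {z ∈ hq.toFinset ×ˢ hq.toFinset | z.1 ≤ z.2}),
    Finset.sum_filter, Finset.sum_product]
  · refine (Finset.sum_eq_single q (fun p hp hpq => ?_)
      fun h => absurd ((hmem q).2 le_rfl) h).trans ?_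
    -- For fixed `p ≠ q` the value `f p` is a common factor, and $\sum_{p\le r\le q}\mu(p,r)=0$.
    · have : ∑ r ∈ Finset.Icc p q, mu ℤ p r • f p = 0 := by
        rw [← Finset.sum_smul, sum_Icc_mu_right, if_neg hpq, zero_smul]
      refine Eq.trans ?_ this
      rw [← Finset.sum_filter]
      refine Finset.sum_congr ?_ fun r hr => if_pos (Finset.mem_Icc.1 hr).2
      ext r
      simp only [Finset.mem_filter, hmem, Finset.mem_Icc, and_comm]
    -- In the row `p = q`, an `r` with `q ≤ r ≤ q` can only be `q`, and $\mu(q,q)=1$.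
    · rw [Finset.sum_eq_single q]
      · simp
      · intro r hr hrq
        exact if_neg fun h => hrq (le_antisymm ((hmem r).1 hr) h)
      · exact fun h => absurd ((hmem q).2 le_rfl) h
  · intro z h'
    have h₂ : z.2 ≤ q := by
      by_contra h₂
      exact h' (if_neg h₂)
    simp only [Finset.mem_filter, Finset.mem_product, hmem]
    exact ⟨fun h => ⟨⟨h.trans h₂, h₂⟩, h⟩, fun h => h.2⟩

open Classical in
-- Down-sets play no role here: the second entry lies in the finite support of `f`, and for each
-- such `q` the first entry lies in the interval from `a` to `q`, finite by local finiteness.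
theorem support_finite_mu_smul_snd (a : T) {f : T → M} (hf : f.support.Finite) :
    (Function.support fun z : {z : T × T // z.1 ≤ z.2} =>
      if a ≤ z.1.1 then mu ℤ z.1.1 z.1.2 • f z.1.2 else 0).Finite := by
  refine (Set.Finite.preimage (f := Subtype.val) Subtype.val_injective.injOn
    (hf.biUnion fun q _ => ((Set.finite_Icc a q).prod (Set.finite_singleton q)))).subset
    fun z hz => ?_
  have h : a ≤ z.1.1 := by
    by_contra h
    exact hz (if_neg h)
  refine Set.mem_biUnion (x := z.1.2) (fun h0 => hz ?_) ⟨⟨h, z.2⟩, rfl⟩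
  simp [h0]

open Classical in
/-- Möbius inversion: `∑_{a ≤ p ≤ q} μ(p, q) f(q) = f(a)`. -/
theorem finsum_mu_smul_snd (a : T) {f : T → M} (hf : f.support.Finite) :
    ∑ᶠ z : {z : T × T // z.1 ≤ z.2},
      (if a ≤ z.1.1 then mu ℤ z.1.1 z.1.2 • f z.1.2 else 0) = f a := by
  have hmem : ∀ p, p ∈ hf.toFinset ↔ f p ≠ 0 := fun p => hf.mem_toFinset
  refine (finsum_subtype_eq_finsum_cond
    (f := fun z : T × T => if a ≤ z.1 then mu ℤ z.1 z.2 • f z.2 else 0)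
    fun z : T × T => z.1 ≤ z.2).trans ?_
  -- To get a product of finite sets, the first entries range over the union of all intervals from
  -- `a` to points of the support. Points of this union that do not lie below a given `q` are
  -- discarded by the filter.
  rw [finsum_cond_eq_sum_of_cond_iff (p := fun z : T × T => z.1 ≤ z.2) _
    (t := {z ∈ (hf.toFinset.biUnion fun q => Finset.Icc a q) ×ˢ hf.toFinset | z.1 ≤ z.2}),
    Finset.sum_filter, Finset.sum_product_right]
  -- For fixed `q`, the two conditions cut the union of intervals down to exactly the interval from
  -- `a` to `q`, over which $\mu(\cdot,q)$ sums to $\delta_{a,q}$.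
  · have key : ∀ q ∈ hf.toFinset, (∑ p ∈ hf.toFinset.biUnion fun q => Finset.Icc a q,
        if p ≤ q then (if a ≤ p then mu ℤ p q • f q else 0) else 0) = if a = q then f q else 0 := by
      intro q hq
      have : ∑ p ∈ Finset.Icc a q, mu ℤ p q • f q = if a = q then f q else 0 := by
        rw [← Finset.sum_smul, sum_Icc_mu_left, ite_smul, one_smul, zero_smul]
      rw [← this, ← Finset.sum_filter, ← Finset.sum_filter]
      refine Finset.sum_congr ?_ fun _ _ => rfl
      ext p
      simp only [Finset.mem_filter, Finset.mem_biUnion, Finset.mem_Icc]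
      exact ⟨fun h => ⟨h.2, h.1.2⟩, fun h => ⟨⟨⟨q, hq, h⟩, h.2⟩, h.1⟩⟩
    rw [Finset.sum_congr rfl key, Finset.sum_ite_eq]
    -- If `a` lies outside the support, no term survives, and correctly so, since then `f a = 0`.
    split_ifs with h
    · rfl
    · rw [hmem, not_not] at h
      exact h.symm
  · intro z h'
    have h₁ : a ≤ z.1 := by
      by_contra h₁
      exact h' (if_neg h₁)
    have h₂ : f z.2 ≠ 0 := fun h₂ => h' (by simp [h₂])
    simp only [Finset.mem_filter, Finset.mem_product, hmem, Finset.mem_biUnion, Finset.mem_Icc]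
    exact ⟨fun h => ⟨⟨⟨_, h₂, h₁, h⟩, h₂⟩, h⟩, fun h => h.2⟩

end IncidenceAlgebra

/-! ### Counting $A$-orbits in a transitive fibered set -/

namespace Fibered

open FiberedSet

namespace FiberedSet

variable {A G : Type u} [CommGroup A] [Group G]

/-- In a transitive `A`-fibered `G`-set, summing over `g ∈ G` the value at the `A`-orbit of `g x`
counts every `A`-orbit `|G_x|` times. -/
theorem sum_orb_smul [Fintype G] {M : Type*} [AddCommMonoid M] {X : FiberedSet A G} (x : X)
    (hx : ∀ y : X, ∃ m : G × A, y = m • x) (t : X.Orbits → M) :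
    ∑ g : G, t (orb ((g, (1 : A)) • x)) = Nat.card (X.stab x) • ∑ o : X.Orbits, t o := by
  classical
  rw [← Finset.sum_fiberwise_of_maps_to (s := Finset.univ) (t := Finset.univ)
    (g := fun g : G => orb ((g, (1 : A)) • x)) fun _ _ => Finset.mem_univ _, Finset.smul_sum]
  refine Finset.sum_congr rfl fun o _ => ?_
  -- The sum over $G$ is grouped by the $A$-orbit that is hit. On each group the summand is
  -- constant, so only the size of the group has to be found.
  rw [Finset.sum_congr rfl (g := fun _ => t o) fun g hg => by rw [(Finset.mem_filter.1 hg).2],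
    Finset.sum_const]
  congr 1
  obtain ⟨y, rfl⟩ := orb_surjective o
  obtain ⟨⟨h, b⟩, rfl⟩ := hx y
  rw [← Fintype.card_subtype, ← Nat.card_eq_fintype_card]
  -- The $g$ that send $x$ into the $A$-orbit of $(h,b)x$ form the coset $hG_x$, so left
  -- multiplication by $h^{-1}$ carries them onto $G_x$. The fiber coordinate $b$ only changes the
  -- scalar in $A$ that witnesses membership.
  refine Nat.card_congr ((Equiv.mulLeft h⁻¹).subtypeEquiv fun g => ?_)
  rw [eq_comm, orb_eq_iff, Equiv.coe_mulLeft, mem_stab]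
  constructor
  · rintro ⟨a, e⟩
    refine ⟨a * b, smul_left_cancel ((h, (1 : A)) : G × A) ?_⟩
    rw [smul_smul] at e
    rw [smul_smul, smul_smul]
    simpa using e.symm
  · rintro ⟨a, e⟩
    refine ⟨a * b⁻¹, ?_⟩
    have := congrArg (((h, (1 : A)) : G × A) • ·) e
    simp only [smul_smul] at this
    rw [smul_smul]
    simpa using this.symm

end FiberedSet

/-! ### Transitive objects are classes $[L,\psi,a]$ -/

namespace FiberedData

variable {A : Type u} [CommGroup A] {𝓓 : FiberedData A} {R : Type v} [CommRing R]
  {G : Type u} [Group G] [Finite G] {hG : 𝓓.mem G} {F : 𝓓.Obj R ⥤ ModuleCat.{w} R}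

/-- The target of `FConj` may be any subgroup with a proof that it is the conjugate, so a transport
along an equality of targets is absorbed into that proof. -/
theorem FEq_FConj {H K L : Subgroup G} (hH : 𝓓.mem H) (hK : 𝓓.mem K) (hL : 𝓓.mem L) (g : G)
    (e : K = MonPair.conjSub g H) (e' : K = L) (x : F.obj (ob R H hH)) :
    FEq F hK hL e' (FConj hG F g hH hK e x) = FConj hG F g hH hL (e'.symm.trans e) x := by
  subst e'
  simp [FEq]

/-- The equivariance of the section, stated for a point `z` merely equal to `m • x`. The module that
contains the value depends on the point, so this form avoids rewriting inside a dependent type. -/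
theorem Gamma.smul_eq (P : Gamma hG F) {x z : P.X} (m : G × A) (h : z = m • x)
    (e : P.X.stab z = MonPair.conjSub m.1 (P.X.stab x)) :
    FConj hG F m.1 (P.mem x) (P.mem z) e (P.s.1 x) = P.s.1 z := by
  subst h
  exact P.s.2 m.1 m.2 x

/-- The class of `(X, s)` with `X` transitive is `[G_x, φ_x, s(x)]`. -/
theorem bracket_pair (P : Gamma hG F) (x : P.X) (hx : ∀ y : P.X, ∃ m : G × A, y = m • x) :
    bracket hG F ⟨P.X.pair x, P.mem x⟩ (P.s.1 x) = Lower.mk P := by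
  refine Lower.mk_congr ?_
  -- The base point of the model and `x` have the same stabilizer in $G\times A$. This makes
  -- $m\cdot\text{base}\mapsto m x$ both well defined and injective.
  have key : ∀ m n : G × A, m • transBase (P.X.pair x) = n • transBase (P.X.pair x) ↔
      m • x = n • x := fun m n => by
    rw [smul_transBase_eq_iff, mem_transSub_pair_iff, mul_smul, inv_smul_eq_iff, eq_comm]
  -- The map is realized by an arbitrary choice of an element `r y` carrying the base point to `y`;
  -- `hr'` says that the choice does not affect the image.
  choose r hr using exists_smul_transBase (P.X.pair x)
  have hr' : ∀ m : G × A, r (m • transBase (P.X.pair x)) • x = m • x := fun m =>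
    (key _ _).1 (hr _).symm
  let e : FiberedSet.trans (P.X.pair x) ≃ P.X := Equiv.ofBijective (fun y => r y • x) ⟨by
    intro y z h
    rw [hr y, hr z]
    exact (key _ _).2 h, fun y => by
    obtain ⟨m, rfl⟩ := hx y
    exact ⟨_, hr' m⟩⟩
  have he : ∀ (m : G × A) y, e (m • y) = m • e y := by
    intro m y
    change r (m • y) • x = m • r y • x
    conv_lhs => rw [hr y]
    rw [smul_smul, hr', mul_smul]
  refine ⟨e, he, fun y => ?_⟩
  have hst : (FiberedSet.trans (P.X.pair x)).stab y = P.X.stab (e y) :=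
    (congrArg MonPair.sub (pair_congr e he y)).symm
  refine ⟨hst, ?_⟩
  change P.s.1 (e y) = FEq F _ _ _ (trFun hG F ⟨P.X.pair x, P.mem x⟩ (P.s.1 x) y)
  have hc := stab_smul_transBase (P.X.pair x) y (r y) (hr y)
  -- With `g` the $G$-component of `r y`, the model section at `y` is ${}^gs(x)$ and the given
  -- section at `e y = r y • x` is also ${}^gs(x)$. They differ only by the identification of the
  -- two equal stabilizers.
  rw [trFun_eq hG F ⟨P.X.pair x, P.mem x⟩ (P.s.1 x) y (r y) (hr y),
    ← P.smul_eq (x := x) (z := e y) (r y) rfl (hst.symm.trans hc)]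
  exact (FEq_FConj (P.mem x) _ _ _ _ _ _).symm

end FiberedData

/-! ### Splitting classes in $F_+(G)$ into transitive ones -/

theorem MonPair.card_conjSub {G : Type u} [Group G] (g : G) (U : Subgroup G) :
    Nat.card (MonPair.conjSub g U) = Nat.card U :=
  (Nat.card_congr (U.equivMapOfInjective _ (MulAut.conj g).injective).toEquiv).symm

theorem FiberedSet.stab_restrict {A G : Type u} [CommGroup A] [Group G]
    (X : FiberedSet A G) (p : X → Prop)
    (hp : ∀ (m : G × A) x, p (m • x) ↔ p x) (x : X.restrict p hp) :
    (X.restrict p hp).stab x = X.stab x.1 := congrArg MonPair.sub (X.pair_restrict p hp x)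

namespace FiberedData

variable {A : Type u} [CommGroup A] {𝓓 : FiberedData A} {R : Type v} [CommRing R]
  {G : Type u} [Group G] [Finite G] {hG : 𝓓.mem G} {F : 𝓓.Obj R ⥤ ModuleCat.{w} R}

/-- Conjugation respects identifications of equal subgroups. This gives the equivariance of a
section restricted to an invariant part, where stabilizers agree with the original ones only
propositionally. -/
theorem FConj_FEq {H K L M : Subgroup G} (hH : 𝓓.mem H) (hK : 𝓓.mem K) (hL : 𝓓.mem L)
    (hM : 𝓓.mem M) (g : G) (e : H = K) (e₁ : L = MonPair.conjSub g K)
    (e₂ : M = MonPair.conjSub g H) (e₃ : M = L) (x : F.obj (ob R H hH)) :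
    FConj hG F g hK hL e₁ (FEq F hH hK e x) = FEq F hM hL e₃ (FConj hG F g hH hM e₂ x) := by
  subst e e₃
  simp [FEq]

/-- A closed loop of identifications is the identity. The loop that occurs runs from the stabilizer
in $X$ to that in a part of $X$, on to that in the disjoint union of the two parts, and back to $X$.
-/
theorem FEq_FEq_FEq_self {H K L : Subgroup G} (hH : 𝓓.mem H) (hK : 𝓓.mem K) (hL : 𝓓.mem L)
    (e : H = K) (e₁ : K = L) (e₂ : L = H) (x : F.obj (ob R H hH)) :
    FEq F hL hH e₂ (FEq F hK hL e₁ (FEq F hH hK e x)) = x := by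
  subst e e₁
  simp [FEq]

/-- The restriction of `(X, s)` to the part of `X` cut out by an invariant predicate. -/
noncomputable def Gamma.restrict (P : Gamma hG F) (p : P.X → Prop)
    (hp : ∀ (m : G × A) x, p (m • x) ↔ p x) : Gamma hG F where
  X := P.X.restrict p hp
  mem x := (stab_restrict P.X p hp x).symm ▸ P.mem x.1
  s := ⟨fun x => FEq F (P.mem x.1) _ (stab_restrict P.X p hp x).symm (P.s.1 x.1), fun g a x => by
    have h := P.s.2 g a x.1
    exact (FConj_FEq (P.mem x.1) _ _ (P.mem ((g, a) • x.1)) g _ _ (P.X.stab_smul x.1 g a)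
      (stab_restrict P.X p hp ((g, a) • x)).symm (P.s.1 x.1)).trans (congrArg _ h)⟩

/-- An invariant predicate and its negation split $X$ into two fibered subsets whose disjoint union
is $X$. The sections match, so the coproduct relation of $F_+(G)$ applies. -/
theorem Lower.mk_restrict_add (P : Gamma hG F) (p : P.X → Prop)
    (hp : ∀ (m : G × A) x, p (m • x) ↔ p x) :
    Lower.mk (P.restrict p hp) + Lower.mk (P.restrict (fun x => ¬ p x) fun m x => not_congr (hp m x))
      = Lower.mk P := by
  classical
  rw [← Lower.mk_sum]
  refine Lower.mk_congr ⟨Equiv.sumCompl p, ?_, fun z => ?_⟩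
  · rintro m (x | x) <;> rfl
  · obtain ⟨x, rfl⟩ | ⟨x, rfl⟩ := sum_cases z
    · refine ⟨(stab_sumInl x).trans (stab_restrict P.X p hp x), ?_⟩
      exact (FEq_FEq_FEq_self (P.mem x.1) _ _ _ _ _ (P.s.1 x.1)).symm
    · refine ⟨(stab_sumInr x).trans (stab_restrict P.X _ (fun m x => not_congr (hp m x)) x), ?_⟩
      exact (FEq_FEq_FEq_self (P.mem x.1) _ _ _ _ _ (P.s.1 x.1)).symm

/-- On the empty set all sections coincide, so $s+s=s$ and the additivity relation gives
$[X,s]=[X,s]+[X,s]$. -/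
theorem Lower.mk_eq_zero (P : Gamma hG F) (h : P.X → False) : Lower.mk P = 0 := by
  have := Lower.mk_add P.X P.mem P.s P.s
  rwa [show P.s + P.s = P.s from Subtype.ext (funext fun x => (h x).elim), left_eq_add] at this

/-- Additive maps on `F_+(G)` agree if they agree on the classes `[X, s]` with `X` transitive. -/
theorem Lower.hom_ext_transitive {M : Type*} [AddCommGroup M] {f f' : Lower hG F →+ M}
    (h : ∀ (P : Gamma hG F) (x : P.X), (∀ y : P.X, ∃ m : G × A, y = m • x) →
      f (Lower.mk P) = f' (Lower.mk P)) : f = f' := by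
  classical
  -- Induction on the size of a finite set `T` meeting every $A$-orbit. `T` need not be a minimal
  -- set of representatives, so its part outside a given $(G\times A)$-orbit can serve for the
  -- complement.
  have key : ∀ (n : ℕ) (P : Gamma hG F) (T : Finset P.X), T.card = n →
      (∀ x, ∃ t ∈ T, ∃ a : A, x = ((1 : G), a) • t) → f (Lower.mk P) = f' (Lower.mk P) := by
    intro n
    induction n using Nat.strong_induction_on with
    | _ n ih =>
    intro P T hT hc
    obtain rfl | ⟨t, ht⟩ := T.eq_empty_or_nonempty
    · rw [Lower.mk_eq_zero P fun x => by simpa using hc x, map_zero, map_zero]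
    · have hp : ∀ (m : G × A) x, (∃ n : G × A, m • x = n • t) ↔ ∃ n : G × A, x = n • t := by
        refine fun m x => ⟨fun ⟨n, hn⟩ => ⟨m⁻¹ * n, ?_⟩, fun ⟨n, hn⟩ => ⟨m * n, ?_⟩⟩
        · rw [mul_smul, ← hn, inv_smul_smul]
        · rw [mul_smul, hn]
      rw [← Lower.mk_restrict_add P (fun x => ∃ n : G × A, x = n • t) hp, map_add, map_add]
      -- The $(G\times A)$-orbit of `t` is transitive and falls under the assumption; its complement
      -- falls under the induction hypothesis.
      refine congrArg₂ (· + ·) (h _ ⟨t, 1, (one_smul _ t).symm⟩ ?_) (ih _ ?_ _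
        (T.subtype fun x => ¬ ∃ n : G × A, x = n • t) rfl ?_)
      · rintro ⟨y, n, rfl⟩
        exact ⟨n, rfl⟩
      -- The set gets strictly smaller because `t` lies in its own orbit and is removed.
      · refine lt_of_eq_of_lt (Finset.card_subtype _ _) ?_
        rw [← hT]
        exact Finset.card_lt_card (Finset.filter_ssubset.2 ⟨t, ht, fun h =>
          h ⟨1, (one_smul _ t).symm⟩⟩)
      · rintro ⟨x, hx⟩
        obtain ⟨s, hs, a, rfl⟩ := hc x
        exact ⟨⟨s, fun h => hx ((hp _ _).2 h)⟩, Finset.mem_subtype.2 hs, a, rfl⟩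
  refine Lower.hom_ext fun P => ?_
  obtain ⟨T, hT, hc⟩ := P.X.finite_orbits
  exact key _ P hT.toFinset rfl (by simpa using hc)

/-! ### The composite $n_{F,G}\circ m_{F,G}$ -/

open Classical in
/-- The contribution of a point `x` to `n_{F,G}(m_{F,G}([X, s]))` is `|G_x| [G_x, φ_x, s(x)]`. -/
theorem finsum_bracket_markTerm (P : Gamma hG F) (x : P.X) :
    Function.HasFiniteSupport (fun z : {z : MonIn 𝓓 G × MonIn 𝓓 G // z.1 ≤ z.2} =>
      ((Nat.card z.1.1.1.sub : ℤ) * IncidenceAlgebra.mu ℤ z.1.1 z.1.2) •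
        bracket hG F z.1.1 (FRes hG F z.1.1.2 z.1.2.2 z.2.fst (markTerm P z.1.2 x))) ∧
    ∑ᶠ z : {z : MonIn 𝓓 G × MonIn 𝓓 G // z.1 ≤ z.2},
      ((Nat.card z.1.1.1.sub : ℤ) * IncidenceAlgebra.mu ℤ z.1.1 z.1.2) •
        bracket hG F z.1.1 (FRes hG F z.1.1.2 z.1.2.2 z.2.fst (markTerm P z.1.2 x)) =
      Nat.card (P.X.stab x) • bracket hG F ⟨P.X.pair x, P.mem x⟩ (P.s.1 x) := by
  let Q : MonIn 𝓓 G := ⟨P.X.pair x, P.mem x⟩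
  -- The factor $|L|$ is put into `f`, so that what remains in front is $\mu$ alone. The value 0 off
  -- the down-set of `Q` is immaterial: only pairs below `Q` enter the inversion.
  let f : MonIn 𝓓 G → Lower hG F := fun p =>
    if h : p ≤ Q then (Nat.card p.1.sub : ℤ) • bracket hG F p
      (FRes hG F p.2 (P.mem x) h.fst (P.s.1 x)) else 0
  have hf : f Q = Nat.card (P.X.stab x) • bracket hG F Q (P.s.1 x) := by
    refine (dif_pos le_rfl).trans ?_
    rw [natCast_zsmul]
    exact congrArg (fun y => Nat.card (P.X.stab x) • bracket hG F Q y) (FRes_self hG F _ _)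
  have key : ∀ z : {z : MonIn 𝓓 G × MonIn 𝓓 G // z.1 ≤ z.2},
      ((Nat.card z.1.1.1.sub : ℤ) * IncidenceAlgebra.mu ℤ z.1.1 z.1.2) •
        bracket hG F z.1.1 (FRes hG F z.1.1.2 z.1.2.2 z.2.fst (markTerm P z.1.2 x)) =
      if z.1.2 ≤ Q then IncidenceAlgebra.mu ℤ z.1.1 z.1.2 • f z.1.1 else 0 := by
    intro z
    by_cases h : z.1.2 ≤ Q
    -- Restricting from $G_x$ to $K$ and then to $L$ is restricting from $G_x$ to $L$. The summand
    -- therefore depends on $(K,\lambda)$ only through $\mu$ and the condition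
    -- $(K,\lambda)\le(G_x,\varphi_x)$.
    · rw [if_pos h, markTerm_pos h, FRes_FRes, mul_comm, mul_smul]
      have := (dif_pos (z.2.trans h) : f z.1.1 = _)
      exact congrArg (IncidenceAlgebra.mu ℤ z.1.1 z.1.2 • ·) this.symm
    · rw [if_neg h, markTerm_neg h, map_zero, map_zero, smul_zero]
  rw [← hf, ← IncidenceAlgebra.finsum_mu_smul_fst (MonIn.finite_Iic Q) f]
  have h₁ := IncidenceAlgebra.support_finite_mu_smul_fst (MonIn.finite_Iic Q) f
  constructor
  · rw [funext key]
    exact h₁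
  · exact finsum_congr key

/-- Each $A$-orbit contributes the order of its stabilizer times $[X,s]$. By transitivity the
stabilizers are conjugate, so these orders agree and the orbit count turns their sum into $|G|$. -/
theorem nMap_mark_of_transitive (P : Gamma hG F) (x : P.X)
    (hx : ∀ y : P.X, ∃ m : G × A, y = m • x) :
    nMap hG F (mark hG F (Lower.mk P)) = Nat.card G • Lower.mk P := by
  classical
  have := Fintype.ofFinite G
  have h₁ : nMap hG F (mark hG F (Lower.mk P)) =
      ∑ᶠ z : {z : MonIn 𝓓 G × MonIn 𝓓 G // z.1 ≤ z.2}, ∑ o : P.X.Orbits,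
        ((Nat.card z.1.1.1.sub : ℤ) * IncidenceAlgebra.mu ℤ z.1.1 z.1.2) •
          bracket hG F z.1.1 (FRes hG F z.1.1.2 z.1.2.2 z.2.fst (markOrb P z.1.2 o)) := by
    rw [mark_mk]
    refine finsum_congr fun z => ?_
    rw [← Finset.smul_sum, ← map_sum, ← map_sum]
    rfl
  have h₂ : ∀ o : P.X.Orbits, ∃ y : P.X, o = orb y := orb_surjective
  -- The sum over the finitely many $A$-orbits is moved outside; this needs, for each orbit, finite
  -- support in the pairs.
  rw [h₁, finsum_sum_comm]
  -- For a constant function the orbit count is the orbit-stabilizer formula $|G|=|G_x|\cdot|X/A|$,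
  -- multiplied by $[X,s]$.
  · have h₃ := sum_orb_smul x hx fun _ => Lower.mk P
    rw [Finset.sum_const, Finset.card_univ, ← Nat.card_eq_fintype_card] at h₃
    rw [h₃, Finset.smul_sum]
    refine Finset.sum_congr rfl fun o _ => ?_
    obtain ⟨y, rfl⟩ := h₂ o
    refine (finsum_bracket_markTerm P y).2.trans ?_
    -- The identification with $[G_y,\varphi_y,s(y)]$ is needed at every orbit representative, so
    -- transitivity is restated from `y`.
    have hy : ∀ y' : P.X, ∃ m : G × A, y' = m • y := fun y' => by
      obtain ⟨m, rfl⟩ := hx y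
      obtain ⟨n, rfl⟩ := hx y'
      exact ⟨n * m⁻¹, by rw [smul_smul, inv_mul_cancel_right]⟩
    rw [bracket_pair P y hy]
    obtain ⟨⟨g, a⟩, rfl⟩ := hx y
    rw [stab_smul, MonPair.card_conjSub]
  · intro o _
    obtain ⟨y, rfl⟩ := h₂ o
    exact (finsum_bracket_markTerm P y).1

theorem nMap_comp_mark :
    nMap hG F ∘ₗ mark hG F = Nat.card G • LinearMap.id := by
  have : (nMap hG F ∘ₗ mark hG F).toAddMonoidHom =
      (Nat.card G • LinearMap.id : Lower hG F →ₗ[R] Lower hG F).toAddMonoidHom :=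
    Lower.hom_ext_transitive nMap_mark_of_transitive
  exact LinearMap.ext fun x => DFunLike.congr_fun this x

end FiberedData

/-! ### The composite $m_{F,G}\circ n_{F,G}$ -/

namespace FiberedData

variable {A : Type u} [CommGroup A] {𝓓 : FiberedData A} {R : Type v} [CommRing R]
  {G : Type u} [Group G] [Finite G] {hG : 𝓓.mem G} {F : 𝓓.Obj R ⥤ ModuleCat.{w} R}

/-- The stabilizer of $g$ times the base point and the subgroup of the conjugated pair are both the
same conjugate, but not definitionally. This switches between the two before restricting. -/
theorem FRes_FConj_congr {H K K' L : Subgroup G} (hH : 𝓓.mem H) (hK : 𝓓.mem K) (hK' : 𝓓.mem K')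
    (hL : 𝓓.mem L) (g : G) (e : K = MonPair.conjSub g H) (e' : K' = MonPair.conjSub g H)
    (h : L ≤ K) (h' : L ≤ K') (x : F.obj (ob R H hH)) :
    FRes hG F hL hK h (FConj hG F g hH hK e x) =
      FRes hG F hL hK' h' (FConj hG F g hH hK' e' x) := by
  obtain rfl : K = K' := e.trans e'.symm
  rfl

/-- The transitive object `((G × A)/(K, λ), s_a)`. -/
noncomputable def Gamma.trans (p : MonIn 𝓓 G) (y : F.obj (ob R p.1.sub p.2)) : Gamma hG F :=
  ⟨FiberedSet.trans p.1, mem_stab_trans hG p, trSec hG F p y⟩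

open Classical in
-- At $g$ times the base point the stabilizing pair is ${}^gp$ and the section takes the value
-- ${}^gy$, so the mark summand is expressed through conjugates of $p$ and $y$ alone.
theorem markTerm_trans (p q : MonIn 𝓓 G) (y : F.obj (ob R p.1.sub p.2)) (g : G) :
    markTerm (Gamma.trans (hG := hG) p y) q ((g, (1 : A)) • transBase p.1) =
      if h : q ≤ conjM hG g p then FRes hG F q.2 (conjM hG g p).2 h.fst
        (FConj hG F g p.2 (conjM hG g p).2 rfl y) else 0 := by
  have e : (FiberedSet.trans p.1).pair ((g, (1 : A)) • transBase p.1) = (conjM hG g p).1 := by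
    rw [pair_smul, pair_transBase]
    rfl
  by_cases h : q ≤ conjM hG g p
  · have h' : q.1 ≤ (FiberedSet.trans p.1).pair ((g, (1 : A)) • transBase p.1) := e.symm ▸ h
    rw [dif_pos h]
    refine (markTerm_pos (P := Gamma.trans (hG := hG) p y)
      (x := (g, (1 : A)) • transBase p.1) h').trans ?_
    refine (congrArg _ (trFun_eq hG F p y _ (g, (1 : A)) rfl)).trans ?_
    exact FRes_FConj_congr _ _ _ _ _ _ _ _ _ _
  · have h' : ¬ q.1 ≤ (FiberedSet.trans p.1).pair ((g, (1 : A)) • transBase p.1) :=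
      fun h' => h (e ▸ h' : q.1 ≤ (conjM hG g p).1)
    rw [dif_neg h]
    exact markTerm_neg (P := Gamma.trans (hG := hG) p y) (x := (g, (1 : A)) • transBase p.1) h'

open Classical in
/-- The coordinate of `|K| m_{F,G}([K, λ, a])` at `q`. -/
theorem card_smul_mark_bracket [Fintype G] (p q : MonIn 𝓓 G) (y : F.obj (ob R p.1.sub p.2)) :
    Nat.card p.1.sub • (mark hG F (bracket hG F p y)).1 q = ∑ g : G,
      if h : q ≤ conjM hG g p then FRes hG F q.2 (conjM hG g p).2 h.fst
        (FConj hG F g p.2 (conjM hG g p).2 rfl y) else 0 := by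
  have h₁ : (mark hG F (bracket hG F p y)).1 q = markFun (Gamma.trans (hG := hG) p y) q :=
    congrArg (fun z => z.1 q) (mark_mk (Gamma.trans (hG := hG) p y))
  -- The stabilizer of the base point is the subgroup of `p`, so its order is exactly the
  -- multiplicity with which a sum over $G$ counts each $A$-orbit.
  have h₂ := sum_orb_smul (transBase p.1) (exists_smul_transBase p.1)
    (markOrb (Gamma.trans (hG := hG) p y) q)
  rw [← stab_transBase] at h₂
  rw [h₁]
  refine h₂.symm.trans (Finset.sum_congr rfl fun g _ => ?_)
  exact (markOrb_orb (Gamma.trans (hG := hG) p y) q ((g, (1 : A)) • transBase p.1)).trans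
    (markTerm_trans p q y g)

theorem conjM_conjM_inv (hG : 𝓓.mem G) (g : G) (q : MonIn 𝓓 G) :
    conjM hG g (conjM hG g⁻¹ q) = q :=
  Subtype.ext (by
    change (q.1.conj g⁻¹).conj g = q.1
    rw [MonPair.conj_conj', mul_inv_cancel, MonPair.conj_one])

/-- Conjugation is an order automorphism. Moving $g$ to the side of $q$ makes the condition a lower
bound on $(L,\psi)$, the form required by the inversion. -/
theorem conjM_inv_le_iff (hG : 𝓓.mem G) (g : G) (p q : MonIn 𝓓 G) :
    conjM hG g⁻¹ q ≤ p ↔ q ≤ conjM hG g p := by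
  have : conjM hG g (conjM hG g⁻¹ q) ≤ conjM hG g p ↔ conjM hG g⁻¹ q ≤ p :=
    MonPair.conj_le_conj_iff g
  rw [← this, conjM_conjM_inv]

open Classical in
/-- The contribution of `g ∈ G` to the coordinate of `m_{F,G}(n_{F,G}(x))` at `q` is `x_q`. -/
theorem finsum_mu_smul_conj (x : Upper hG F) (q : MonIn 𝓓 G) (g : G) :
    Function.HasFiniteSupport (fun z : {z : MonIn 𝓓 G × MonIn 𝓓 G // z.1 ≤ z.2} =>
      IncidenceAlgebra.mu ℤ z.1.1 z.1.2 • if h : q ≤ conjM hG g z.1.1 then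
        FRes hG F q.2 (conjM hG g z.1.1).2 h.fst (FConj hG F g z.1.1.2 (conjM hG g z.1.1).2 rfl
          (FRes hG F z.1.1.2 z.1.2.2 z.2.fst (x.1 z.1.2))) else 0) ∧
    ∑ᶠ z : {z : MonIn 𝓓 G × MonIn 𝓓 G // z.1 ≤ z.2},
      (IncidenceAlgebra.mu ℤ z.1.1 z.1.2 • if h : q ≤ conjM hG g z.1.1 then
        FRes hG F q.2 (conjM hG g z.1.1).2 h.fst (FConj hG F g z.1.1.2 (conjM hG g z.1.1).2 rfl
          (FRes hG F z.1.1.2 z.1.2.2 z.2.fst (x.1 z.1.2))) else 0) = x.1 q := by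
  -- The common value of the summands with upper pair `p`: the coordinate of `x` at ${}^gp$,
  -- restricted to `q`.
  let f : MonIn 𝓓 G → F.obj (ob R q.1.sub q.2) := fun p =>
    if h : q ≤ conjM hG g p then FRes hG F q.2 (conjM hG g p).2 h.fst (x.1 (conjM hG g p)) else 0
  have hf : f (conjM hG g⁻¹ q) = x.1 q := by
    -- The pair ${}^g({}^{g^{-1}}q)$ equals `q` only propositionally and occurs in the types, so the
    -- claim is generalized to a variable `r` before substituting.
    have : ∀ r, r = q →
        (if h : q ≤ r then FRes hG F q.2 r.2 h.fst (x.1 r) else 0) = x.1 q := by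
      rintro r rfl
      rw [dif_pos le_rfl]
      exact FRes_self hG F _ _
    exact this _ (conjM_conjM_inv hG g q)
  have hs : f.support.Finite := by
    refine x.2.1.subset fun p hp h0 => hp ?_
    change dite _ _ _ = _
    split_ifs with h
    -- By invariance $x_{{}^gp}={}^gx_p$, so `f` vanishes wherever `x` does and inherits its finite
    -- support.
    · rw [← x.2.2, h0, map_zero, map_zero]
    · rfl
  have key : ∀ z : {z : MonIn 𝓓 G × MonIn 𝓓 G // z.1 ≤ z.2},
      (IncidenceAlgebra.mu ℤ z.1.1 z.1.2 • if h : q ≤ conjM hG g z.1.1 then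
        FRes hG F q.2 (conjM hG g z.1.1).2 h.fst (FConj hG F g z.1.1.2 (conjM hG g z.1.1).2 rfl
          (FRes hG F z.1.1.2 z.1.2.2 z.2.fst (x.1 z.1.2))) else 0) =
      if conjM hG g⁻¹ q ≤ z.1.1 then IncidenceAlgebra.mu ℤ z.1.1 z.1.2 • f z.1.2 else 0 := by
    intro z
    by_cases h : q ≤ conjM hG g z.1.1
    · have hz : conjM hG g z.1.1 ≤ conjM hG g z.1.2 := MonPair.conj_le_conj g z.2
      -- Conjugation is moved past the restriction to $L$, the two restrictions are merged, and
      -- ${}^gx_{(K,\lambda)}$ becomes $x_{{}^g(K,\lambda)}$. The subgroup $L$ has then disappeared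
      -- from the value.
      rw [if_pos ((conjM_inv_le_iff hG g _ _).2 h), dif_pos h,
        FConj_FRes hG F z.1.2.2 z.1.1.2 (conjM hG g z.1.1).2 (conjM hG g z.1.2).2 g z.2.fst rfl
          hz.fst rfl, FRes_FRes, x.2.2]
      have := (dif_pos (h.trans hz) : f z.1.2 = _)
      exact congrArg (IncidenceAlgebra.mu ℤ z.1.1 z.1.2 • ·) this.symm
    · rw [if_neg (mt (conjM_inv_le_iff hG g _ _).1 h), dif_neg h, smul_zero]
  rw [← hf, ← IncidenceAlgebra.finsum_mu_smul_snd _ hs]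
  have h₁ := IncidenceAlgebra.support_finite_mu_smul_snd (conjM hG g⁻¹ q) hs
  constructor
  · rw [funext key]
    exact h₁
  · exact finsum_congr key

/-- After the factor $|L|$ has been spent on replacing orbits by elements of $G$, each $g\in G$
contributes $x_q$ by Möbius inversion. -/
theorem mark_nMap_apply (x : Upper hG F) (q : MonIn 𝓓 G) :
    (mark hG F (nMap hG F x)).1 q = Nat.card G • x.1 q := by
  classical
  have := Fintype.ofFinite G
  let ev : Lower hG F →ₗ[R] F.obj (ob R q.1.sub q.2) :=
    LinearMap.proj q ∘ₗ (Upper hG F).subtype ∘ₗ mark hG F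
  have h₁ : ev (∑ᶠ z, nTerm hG F z x) = ∑ᶠ z, ev (nTerm hG F z x) :=
    ev.toAddMonoidHom.map_finsum (finite_nTerm hG F x)
  have h₂ : ∀ z : {z : MonIn 𝓓 G × MonIn 𝓓 G // z.1 ≤ z.2}, ev (nTerm hG F z x) = ∑ g : G,
      (IncidenceAlgebra.mu ℤ z.1.1 z.1.2 • if h : q ≤ conjM hG g z.1.1 then
        FRes hG F q.2 (conjM hG g z.1.1).2 h.fst (FConj hG F g z.1.1.2 (conjM hG g z.1.1).2 rfl
          (FRes hG F z.1.1.2 z.1.2.2 z.2.fst (x.1 z.1.2))) else 0) := by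
    intro z
    -- Read backwards: of the coefficient $|L|\mu$, the factor $|L|$ is used up in unfolding the
    -- mark as a sum over $G$, and $\mu$ stays in front.
    rw [← Finset.smul_sum, ← card_smul_mark_bracket, ← natCast_zsmul, ← mul_smul, mul_comm]
    exact map_zsmul ev _ _
  refine h₁.trans ?_
  rw [finsum_congr h₂, finsum_sum_comm _ _ fun g _ => (finsum_mu_smul_conj x q g).1,
    Finset.sum_congr rfl fun g _ => (finsum_mu_smul_conj x q g).2, Finset.sum_const,
    Finset.card_univ, ← Nat.card_eq_fintype_card]

theorem mark_comp_nMap :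
    mark hG F ∘ₗ nMap hG F = Nat.card G • LinearMap.id :=
  LinearMap.ext fun x => Subtype.ext (funext fun q => mark_nMap_apply x q)

end FiberedData

end Fibered

/-! ### Consequences for invertibility and injectivity -/

theorem mainTheorem4 {A : Type u} [CommGroup A] {𝓓 : Fibered.FiberedData A}
    {R : Type v} [CommRing R] (F : 𝓓.Obj R ⥤ ModuleCat.{w} R) [F.Additive] [F.Linear R]
    (G : Type u) [Group G] [Finite G] (hG : 𝓓.mem G) :
    (Fibered.FiberedData.nMap hG F ∘ₗ Fibered.FiberedData.mark hG F = Nat.card G • LinearMap.id) ∧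
    (Fibered.FiberedData.mark hG F ∘ₗ Fibered.FiberedData.nMap hG F = Nat.card G • LinearMap.id) ∧
    (IsUnit (Nat.card G : R) →
      ∃ e : Fibered.FiberedData.Lower hG F ≃ₗ[R] Fibered.FiberedData.Upper hG F,
        (∀ x, e x = Fibered.FiberedData.mark hG F x) ∧
        ∀ y, e.symm y = Ring.inverse (Nat.card G : R) • Fibered.FiberedData.nMap hG F y) ∧
    ((∀ x : Fibered.FiberedData.Lower hG F, Nat.card G • x = 0 → x = 0) →
      Function.Injective (Fibered.FiberedData.mark hG F)) := by
  have h₁ := Fibered.FiberedData.nMap_comp_mark (hG := hG) (F := F)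
  have h₂ := Fibered.FiberedData.mark_comp_nMap (hG := hG) (F := F)
  refine ⟨h₁, h₂, fun hu => ?_, fun ht => ?_⟩
  -- `Ring.inverse` is 0 on non-units; here `hu` makes it the true inverse of $|G|$, which cancels
  -- the factor in both composites.
  · refine ⟨LinearEquiv.ofLinearMap (Fibered.FiberedData.mark hG F)
      (Ring.inverse (Nat.card G : R) • Fibered.FiberedData.nMap hG F) ?_ ?_,
      fun _ => rfl, fun _ => rfl⟩
    · rw [LinearMap.comp_smul, h₂, ← Nat.cast_smul_eq_nsmul R, smul_smul,
        Ring.inverse_mul_cancel _ hu, one_smul]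
    · rw [LinearMap.smul_comp, h₁, ← Nat.cast_smul_eq_nsmul R, smul_smul,
        Ring.inverse_mul_cancel _ hu, one_smul]
  -- An element of the kernel of $m$ satisfies $|G|x=n(m(x))=0$, so it is $|G|$-torsion.
  · refine (injective_iff_map_eq_zero _).2 fun x hx => ht x ?_
    have := LinearMap.congr_fun h₁ x
    rw [LinearMap.comp_apply, hx, map_zero] at this
    exact this.symm
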